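/- Let $d\ge 2$, $0<s<\frac d2$ and $1<q<\frac{d}{2s}$. All functions are real valued. Let $\mathring H^{s}(\mathbb R^d)$ be the space of all $u\in L^{\frac{2d}{d-2s}}(\mathbb R^d)$ whose Fourier transform $\mathscr F[u]$ is a function with $\|u\|_{\mathring H^s}^2=\int_{\mathbb R^d}|\xi|^{2s}|\mathscr F[u](\xi)|^2\,d\xi<\infty$ (here $\mathscr F[u](\xi)=(2\pi)^{-d/2}\int e^{-ix\cdot\xi}u(x)\,dx$), with the corresponding inner product $\langle\cdot,\cdot\rangle_{\mathring H^s}$, and let $\mathring H^{-s}(\mathbb R^d)$ be its dual. Let $T\in \mathring H^{-s}(\mathbb R^d)\cap L^{q}(\mathbb R^d)$, that is, $T\in L^q(\mathbb R^d)$ and $T$ is identified with a continuous linear functional on $\mathring H^{s}(\mathbb R^d)$ such that $\langle T,\varphi\rangle=\int_{\mathbb R^d} T\varphi\,dx$ for all $\varphi\in C_c^\infty(\mathbb R^d)$. Let $$I_{2s}(x)=A_{2s}|x|^{2s-d},\qquad A_{2s}=\frac{\Gamma\big(\frac{d-2s}{2}\big)}{\pi^{d/2}\,2^{2s}\,\Gamma(s)}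 .$$ Then the Riesz potential $(I_{2s}*T)(x)=\int_{\mathbb R^d} I_{2s}(x-y)T(y)\,dy$ converges absolutely for a.e. $x\in\mathbb R^d$. There is exactly one weak solution $U_T\in\mathring H^s(\mathbb R^d)$ of $(-\Delta)^su=T$, that is, one element with $$\langle T,\varphi\rangle=\langle U_T,\varphi\rangle_{\mathring H^s}\qquad\text{for all }\varphi\in\mathring H^s(\mathbb R^d),$$ and $$U_T=I_{2s}*T\quad\text{a.e. in }\mathbb R^d .$$ Moreover, $I_{2s}*T$ is a distributional solution of $(-\Delta)^su=T$ in $\mathbb R^d$, and every distributional solution $u\in\mathring H^s(\mathbb R^d)$ of this equation equals $I_{2s}*T$ a.e. Here $u$ is a distributional solution if $u\in L^1_{loc}(\mathbb R^d)$, $\int_{\mathbb R^d}\frac{|u(x)|}{(1+|x|)^{d+2s}}dx<\infty$ and $\int_{\mathbb R^d} u\,(-\Delta)^s\varphi\,dx=\int_{\mathbb R^d} T\varphi\,dx$ for all $\varphi\in C_c^\infty(\mathbb R^d)$, where $(-\Delta)^s\varphi=\mathscr F^{-1}\big[|\cdot|^{2s}\mathscr F[\varphi]\big]$. -/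

import Mathlib

open MeasureTheory
open scoped ENNReal SchwartzMap FourierTransform ContDiff

noncomputable section

/-- `g` is the (distributional) Fourier transform of the real function `u`: both are locally
integrable functions defining tempered distributions, and `⟨g, φ⟩ = ⟨u, 𝓕 φ⟩` for every Schwartz
function `φ`. As everywhere in Mathlib, `𝓕 φ ξ = ∫ exp (-2πi x·ξ) φ x dx`. -/
structure IsFourierTransformOf {d : ℕ} (g : EuclideanSpace ℝ (Fin d) → ℂ)
    (u : EuclideanSpace ℝ (Fin d) → ℝ) : Prop where
  locallyIntegrable_fun : LocallyIntegrable u volume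
  locallyIntegrable : LocallyIntegrable g volume
  integrable_fun_mul : ∀ φ : 𝓢(EuclideanSpace ℝ (Fin d), ℂ),
    Integrable (fun x => (u x : ℂ) * φ x) volume
  integrable_mul : ∀ φ : 𝓢(EuclideanSpace ℝ (Fin d), ℂ), Integrable (fun ξ => g ξ * φ ξ) volume
  integral_eq : ∀ φ : 𝓢(EuclideanSpace ℝ (Fin d), ℂ),
    ∫ ξ, g ξ * φ ξ = ∫ x, (u x : ℂ) * (𝓕 φ) x

namespace IsFourierTransformOf

variable {d : ℕ} {g h : EuclideanSpace ℝ (Fin d) → ℂ} {u v : EuclideanSpace ℝ (Fin d) → ℝ}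

theorem congr_fun (H : IsFourierTransformOf g u) (huv : u =ᵐ[volume] v) :
    IsFourierTransformOf g v where
  locallyIntegrable_fun := H.locallyIntegrable_fun.congr huv
  locallyIntegrable := H.locallyIntegrable
  integrable_fun_mul φ := (H.integrable_fun_mul φ).congr (by
    filter_upwards [huv] with x hx
    rw [hx])
  integrable_mul := H.integrable_mul
  integral_eq φ := by
    rw [H.integral_eq φ]
    refine integral_congr_ae ?_
    filter_upwards [huv] with x hx
    rw [hx]

theorem zero : IsFourierTransformOf (0 : EuclideanSpace ℝ (Fin d) → ℂ) 0 where
  locallyIntegrable_fun := locallyIntegrable_zero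
  locallyIntegrable := locallyIntegrable_zero
  integrable_fun_mul φ := by simp
  integrable_mul φ := by simp
  integral_eq φ := by simp

theorem add (H : IsFourierTransformOf g u) (K : IsFourierTransformOf h v) :
    IsFourierTransformOf (g + h) (u + v) where
  locallyIntegrable_fun := H.locallyIntegrable_fun.add K.locallyIntegrable_fun
  locallyIntegrable := H.locallyIntegrable.add K.locallyIntegrable
  integrable_fun_mul φ := by
    refine ((H.integrable_fun_mul φ).add (K.integrable_fun_mul φ)).congr ?_
    exact Filter.Eventually.of_forall fun x => by simp [add_mul]
  integrable_mul φ := by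
    refine ((H.integrable_mul φ).add (K.integrable_mul φ)).congr ?_
    exact Filter.Eventually.of_forall fun ξ => by simp [add_mul]
  integral_eq φ := by
    simp only [Pi.add_apply, Complex.ofReal_add, add_mul]
    rw [integral_add (H.integrable_mul φ) (K.integrable_mul φ),
      integral_add (H.integrable_fun_mul _) (K.integrable_fun_mul _), H.integral_eq, K.integral_eq]

theorem smul (c : ℝ) (H : IsFourierTransformOf g u) : IsFourierTransformOf (c • g) (c • u) where
  locallyIntegrable_fun := H.locallyIntegrable_fun.smul c
  locallyIntegrable := H.locallyIntegrable.smul c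
  integrable_fun_mul φ := by
    simpa [mul_assoc] using (H.integrable_fun_mul φ).const_mul (c : ℂ)
  integrable_mul φ := by simpa [mul_assoc] using (H.integrable_mul φ).const_mul (c : ℂ)
  integral_eq φ := by
    simp only [Pi.smul_apply, smul_eq_mul, Complex.real_smul, Complex.ofReal_mul, mul_assoc]
    rw [integral_const_mul, integral_const_mul, H.integral_eq]

/-- The Fourier transform is unique up to a null set. -/
theorem ae_eq (H : IsFourierTransformOf g u) (K : IsFourierTransformOf h u) :
    g =ᵐ[volume] h := by
  refine ae_eq_of_integral_contDiff_smul_eq H.locallyIntegrable K.locallyIntegrable ?_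
  intro φ hφ hc
  have hc' : HasCompactSupport (fun x => (φ x : ℂ)) := hc.comp_left Complex.ofReal_zero
  have hφ' : ContDiff ℝ ∞ (fun x => (φ x : ℂ)) := Complex.ofRealCLM.contDiff.comp hφ
  have e := (H.integral_eq (hc'.toSchwartzMap hφ')).trans
    (K.integral_eq (hc'.toSchwartzMap hφ')).symm
  simpa [Complex.real_smul, mul_comm] using e

end IsFourierTransformOf

/-- The critical Sobolev exponent `2d / (d - 2s)`, for `0 < s < d / 2`. -/
def sobolevExponent (d : ℕ) (s : ℝ) : ℝ≥0∞ := ENNReal.ofReal (2 * d / (d - 2 * s))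

/-- The weighted transform `ξ ↦ (2π|ξ|)^s g(ξ)`. With Mathlib's Fourier transform `g = 𝓕 u` this is
`ξ ↦ |ξ|^s û(ξ)` for the unitary transform `û` with kernel `(2π)^(-d/2) exp (-i x·ξ)`, up
to the change of variables `ξ ↦ 2πξ`, which preserves `L²` norms and inner products. -/
def sobolevWeight {d : ℕ} (s : ℝ) (g : EuclideanSpace ℝ (Fin d) → ℂ) :
    EuclideanSpace ℝ (Fin d) → ℂ :=
  fun ξ => (((2 * Real.pi * ‖ξ‖) ^ s : ℝ) : ℂ) * g ξ

/-- The homogeneous fractional Sobolev space of order `s`, as a real vector space: the (classes of)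
real functions `u ∈ L^{2d/(d-2s)}(ℝ^d)` whose Fourier transform is a function with
`∫ |ξ|^{2s} |û(ξ)|² dξ < ∞`. -/
def homSobolevSubmodule (d : ℕ) (s : ℝ) :
    Submodule ℝ (Lp ℝ (sobolevExponent d s) (volume : Measure (EuclideanSpace ℝ (Fin d)))) where
  carrier := {u | ∃ g : EuclideanSpace ℝ (Fin d) → ℂ,
    IsFourierTransformOf g u ∧ MemLp (sobolevWeight s g) 2 volume}
  zero_mem' := by
    refine ⟨0, IsFourierTransformOf.zero.congr_fun (Lp.coeFn_zero _ _ _).symm, ?_⟩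
    have : sobolevWeight s (0 : EuclideanSpace ℝ (Fin d) → ℂ) = 0 := by
      funext ξ; simp [sobolevWeight]
    rw [this]
    exact MemLp.zero
  add_mem' := by
    rintro u v ⟨g, hg, hg'⟩ ⟨h, hh, hh'⟩
    refine ⟨g + h, (hg.add hh).congr_fun (Lp.coeFn_add u v).symm, ?_⟩
    have : sobolevWeight s (g + h) = sobolevWeight s g + sobolevWeight s h := by
      funext ξ; simp [sobolevWeight, mul_add]
    rw [this]
    exact hg'.add hh'
  smul_mem' := by
    rintro c u ⟨g, hg, hg'⟩
    refine ⟨c • g, (hg.smul c).congr_fun (Lp.coeFn_smul c u).symm, ?_⟩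
    have : sobolevWeight s (c • g) = c • sobolevWeight s g := by
      funext ξ; simp [sobolevWeight, mul_left_comm]
    rw [this]
    exact hg'.const_smul c

/-- The homogeneous fractional Sobolev space of order `s` on `ℝ^d`. It is a type of its own, so that
it carries the Sobolev inner product below and not the norm of `L^{2d/(d-2s)}`. -/
def HomSobolev (d : ℕ) (s : ℝ) : Type := homSobolevSubmodule d s

namespace HomSobolev

variable {d : ℕ} {s : ℝ}

instance : AddCommGroup (HomSobolev d s) := inferInstanceAs (AddCommGroup (homSobolevSubmodule d s))

instance : Module ℝ (HomSobolev d s) := inferInstanceAs (Module ℝ (homSobolevSubmodule d s))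

/-- The underlying class in `L^{2d/(d-2s)}`. -/
def toLp (u : HomSobolev d s) :
    Lp ℝ (sobolevExponent d s) (volume : Measure (EuclideanSpace ℝ (Fin d))) :=
  Subtype.val u

instance : CoeFun (HomSobolev d s) fun _ => EuclideanSpace ℝ (Fin d) → ℝ :=
  ⟨fun u => u.toLp⟩

/-- The Fourier transform of an element of the space (a function, unique up to a null set). -/
def fourier (u : HomSobolev d s) : EuclideanSpace ℝ (Fin d) → ℂ := Classical.choose u.2

theorem isFourierTransformOf (u : HomSobolev d s) : IsFourierTransformOf u.fourier u :=
  (Classical.choose_spec u.2).1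

theorem memLp_sobolevWeight (u : HomSobolev d s) : MemLp (sobolevWeight s u.fourier) 2 volume :=
  (Classical.choose_spec u.2).2

theorem fourier_add (u v : HomSobolev d s) :
    (u + v).fourier =ᵐ[volume] u.fourier + v.fourier :=
  (u + v).isFourierTransformOf.ae_eq
    ((u.isFourierTransformOf.add v.isFourierTransformOf).congr_fun
      (Lp.coeFn_add u.toLp v.toLp).symm)

theorem fourier_smul (c : ℝ) (u : HomSobolev d s) :
    (c • u).fourier =ᵐ[volume] c • u.fourier :=
  (c • u).isFourierTransformOf.ae_eq
    ((u.isFourierTransformOf.smul c).congr_fun (Lp.coeFn_smul c u.toLp).symm)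

/-- The inner product `∫ |ξ|^{2s} û(ξ) conj(v̂(ξ)) dξ`, written with Mathlib's Fourier transform as
`∫ (2π|ξ|)^s 𝓕u(ξ) · conj ((2π|ξ|)^s 𝓕v(ξ)) dξ`. For real functions this integral is real; the real
part makes its value a real number by definition. -/
def sobolevInner (u v : HomSobolev d s) : ℝ :=
  ∫ ξ, (sobolevWeight s u.fourier ξ * (starRingEnd ℂ) (sobolevWeight s v.fourier ξ)).re

theorem integrable_sobolevInner (u v : HomSobolev d s) :
    Integrable (fun ξ => (sobolevWeight s u.fourier ξ *
      (starRingEnd ℂ) (sobolevWeight s v.fourier ξ)).re) volume :=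
  (u.memLp_sobolevWeight.integrable_mul v.memLp_sobolevWeight.star).re

/-- The Sobolev inner product satisfies the axioms of a positive semidefinite inner product. (It is
definite in all dimensions `d ≥ 1`.) -/
abbrev innerCore : PreInnerProductSpace.Core ℝ (HomSobolev d s) where
  inner u v := sobolevInner u v
  conj_inner_symm u v := by
    simp only [sobolevInner, conj_trivial]
    refine integral_congr_ae (Filter.Eventually.of_forall fun ξ => ?_)
    simp only [Complex.mul_re, Complex.conj_re, Complex.conj_im]
    ring
  re_inner_nonneg u := by
    refine integral_nonneg fun ξ => ?_
    simp only [Pi.zero_apply, Complex.mul_re, Complex.conj_re, Complex.conj_im]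
    nlinarith [mul_self_nonneg (sobolevWeight s u.fourier ξ).re,
      mul_self_nonneg (sobolevWeight s u.fourier ξ).im]
  add_left u v w := by
    simp only [sobolevInner]
    rw [← integral_add (integrable_sobolevInner u w) (integrable_sobolevInner v w)]
    refine integral_congr_ae ?_
    filter_upwards [fourier_add u v] with ξ hξ
    simp only [sobolevWeight, hξ, Pi.add_apply, mul_add, add_mul, Complex.add_re]
  smul_left u v c := by
    simp only [sobolevInner, conj_trivial]
    rw [← integral_const_mul]
    refine integral_congr_ae ?_
    filter_upwards [fourier_smul c u] with ξ hξ
    simp only [sobolevWeight, hξ, Pi.smul_apply, Complex.real_smul]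
    rw [mul_left_comm, mul_assoc, Complex.re_ofReal_mul]

instance : SeminormedAddCommGroup (HomSobolev d s) :=
  @InnerProductSpace.Core.toSeminormedAddCommGroup ℝ _ _ _ _ innerCore

instance : InnerProductSpace ℝ (HomSobolev d s) := InnerProductSpace.ofCore innerCore

end HomSobolev

/-- The functional `τ` on the homogeneous Sobolev space is the regular distribution given by the
function `T`: `⟨τ, φ⟩ = ∫ T φ` for all `φ ∈ C_c^∞(ℝ^d)`. -/
def IsRegularDistribution {d : ℕ} {s : ℝ} (τ : StrongDual ℝ (HomSobolev d s))
    (T : EuclideanSpace ℝ (Fin d) → ℝ) : Prop :=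
  ∀ (φ : EuclideanSpace ℝ (Fin d) → ℝ) (ψ : HomSobolev d s), ContDiff ℝ ∞ φ →
    HasCompactSupport φ → ψ =ᵐ[volume] φ → τ ψ = ∫ x, T x * φ x

/-- `U` is a weak solution of `(-Δ)^s u = τ`: `⟨τ, φ⟩ = ⟨U, φ⟩` for all `φ` in the space. -/
def IsWeakSolution {d : ℕ} {s : ℝ} (τ : StrongDual ℝ (HomSobolev d s)) (U : HomSobolev d s) :
    Prop :=
  ∀ φ : HomSobolev d s, τ φ = inner ℝ U φ

/-- The fractional Laplacian `(-Δ)^s φ = 𝓕⁻¹ (|ξ|^{2s} 𝓕 φ)` of a real test function; in Mathlib's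
normalization of `𝓕` the symbol is `(2π|ξ|)^{2s}`. -/
def fracLaplacian {d : ℕ} (s : ℝ) (φ : EuclideanSpace ℝ (Fin d) → ℝ) :
    EuclideanSpace ℝ (Fin d) → ℝ :=
  fun x => (𝓕⁻ (fun ξ : EuclideanSpace ℝ (Fin d) =>
    (((2 * Real.pi * ‖ξ‖) ^ (2 * s) : ℝ) : ℂ) *
      𝓕 (fun y : EuclideanSpace ℝ (Fin d) => (φ y : ℂ)) ξ) x).re

/-- `u` is a distributional solution of `(-Δ)^s u = T` on `ℝ^d`: `u` is locally integrable with
`∫ |u(x)| / (1 + |x|)^{d+2s} dx < ∞`, and `∫ u (-Δ)^s φ = ∫ T φ` for all `φ ∈ C_c^∞(ℝ^d)`. -/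
structure IsDistributionalSolution {d : ℕ} (s : ℝ) (T u : EuclideanSpace ℝ (Fin d) → ℝ) :
    Prop where
  locallyIntegrable : LocallyIntegrable u volume
  integrable_weighted : Integrable (fun x => |u x| / (1 + ‖x‖) ^ ((d : ℝ) + 2 * s)) volume
  integral_eq : ∀ φ : EuclideanSpace ℝ (Fin d) → ℝ, ContDiff ℝ ∞ φ → HasCompactSupport φ →
    ∫ x, u x * fracLaplacian s φ x = ∫ x, T x * φ x

/-- The Riesz kernel `I_α(x) = A_α |x|^{α-d}`, with
`A_α = Γ((d-α)/2) / (π^{d/2} 2^α Γ(α/2))`, for `0 < α < d`. -/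
def rieszKernel (d : ℕ) (α : ℝ) (x : EuclideanSpace ℝ (Fin d)) : ℝ :=
  Real.Gamma ((d - α) / 2) / (Real.pi ^ ((d : ℝ) / 2) * 2 ^ α * Real.Gamma (α / 2)) *
    ‖x‖ ^ (α - d)

/-- The Riesz potential `I_α * T`, a convolution. -/
def rieszPotential {d : ℕ} (α : ℝ) (T : EuclideanSpace ℝ (Fin d) → ℝ) :
    EuclideanSpace ℝ (Fin d) → ℝ :=
  convolution (rieszKernel d α) T (ContinuousLinearMap.mul ℝ ℝ) volume

end

/-! Existence and uniqueness of the weak solution are the Riesz representation theorem, carried out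
through the isometry `HomSobolev.toL2`, $u\mapsto(2\pi|\xi|)^s\mathscr F u$, into $L^2$. The
functional is extended to all of $L^2$ and represented there by some $G$; only the Hermitian part of
$G$ is seen by transforms of real functions. That this Hermitian part is the weighted transform of
an element of the space is the Sobolev inequality (`exists_lintegral_fourierInv_rpow_le`), extended
by density in `exists_memLp_integral_mul_fourier_eq`.

The identity $U=I_{2s}*T$ is a Liouville argument for $v=U-I_{2s}*T$. Both terms are integrable
against $(1+|x|)^{-a}$ for some $a<d$: the first by Hölder, since $U\in L^{2d/(d-2s)}$; the second
by Tonelli, since $T\in L^q$ with $q<d/(2s)$. Let $\varphi$ be a test function and remove the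
frequencies below about $2^{-k}$ from it. The resulting Schwartz function is $(-\Delta)^s$ of
another Schwartz function $\eta$, because $|\xi|^{-2s}$ is smooth away from the origin. Pairing $U$
with it gives $\int T\eta$ by the equation, and pairing $I_{2s}*T$ with it gives $\int T\eta$ as
well, because the Riesz kernel acts as the multiplier $(2\pi|\xi|)^{-2s}$
(`integral_rieszKernel_mul_fourierInv`, by writing the kernel as a superposition of Gaussians). So
$v$ pairs to zero with every high-frequency part. The discarded low-frequency part is at most
$C\,2^{k(a-d)}(1+|x|)^{-a}$, so its pairing with $v$ tends to $0$ and $v=0$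
(`ae_eq_zero_of_integral_mul_highFreq_eq_zero`).

The distributional statements rest on $\int U(-\Delta)^s\varphi=\langle U,\varphi\rangle$ for test
functions $\varphi$ (`HomSobolev.integral_mul_fracLaplacian`). Here $(-\Delta)^s\varphi$ need not be
Schwartz, so the low frequencies are again cut off, and the limit is justified by a decay bound
uniform in the cutoff (`exists_norm_fourierInv_highFreq_le`). The Liouville argument uses the
equation only against test functions, so it applies to weak and distributional solutions alike. -/

set_option linter.unusedSectionVars false

/-! ### Polynomial weights and their convolution with power kernels -/

section Weights

open Module Set Filter

variable {V : Type*} [NormedAddCommGroup V]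

/-- The larger of $A$ and $B$ is at least $Y/2$, so $c$ of its powers can be traded for $2^cY^{-c}$.
What remains of it has nonpositive exponent and is bounded by the same power of the smaller one. The
sum on the right covers both orderings. -/
theorem rpow_neg_mul_rpow_neg_le {p q c A B Y : ℝ} (hc : 0 ≤ c) (hcp : c ≤ p) (hcq : c ≤ q)
    (hA : 1 ≤ A) (hB : 1 ≤ B) (hY : 1 ≤ Y) (hYAB : Y ≤ A + B) :
    A ^ (-p) * B ^ (-q) ≤ 2 ^ c * Y ^ (-c) * (A ^ (-(p + q - c)) + B ^ (-(p + q - c))) := by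
  have key : ∀ {p q A B : ℝ}, c ≤ q → 1 ≤ A → A ≤ B → Y ≤ A + B →
      A ^ (-p) * B ^ (-q) ≤ 2 ^ c * Y ^ (-c) * A ^ (-(p + q - c)) := by
    intro p q A B hcq hA hAB hY'
    have hA0 : 0 < A := by linarith
    have hB0 : 0 < B := by linarith
    have hY0 : 0 < Y := by linarith
    have h1 : Y ^ c ≤ 2 ^ c * B ^ c := by
      rw [← Real.mul_rpow (by norm_num) hB0.le]
      exact Real.rpow_le_rpow hY0.le (by linarith) hc
    have h2 : B ^ (c - q) ≤ A ^ (c - q) :=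
      Real.rpow_le_rpow_of_nonpos hA0 hAB (by linarith)
    have h3 : A ^ (-(p + q - c)) = A ^ (-p) * A ^ (c - q) := by
      rw [← Real.rpow_add hA0]; ring_nf
    have h4 : B ^ (-q) = B ^ (-c) * B ^ (c - q) := by
      rw [← Real.rpow_add hB0]; ring_nf
    have h5 : B ^ (-c) ≤ 2 ^ c * Y ^ (-c) := by
      rw [Real.rpow_neg hB0.le, Real.rpow_neg hY0.le]
      have := Real.rpow_pos_of_pos hB0 c
      have := Real.rpow_pos_of_pos hY0 c
      rw [← div_eq_mul_inv, inv_eq_one_div, div_le_div_iff₀ (by assumption) (by assumption)]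
      linarith
    rw [h3, h4]
    have hAp : 0 ≤ A ^ (-p) := by positivity
    have hBc : 0 ≤ B ^ (-c) := by positivity
    have hBq : 0 ≤ B ^ (c - q) := by positivity
    calc A ^ (-p) * (B ^ (-c) * B ^ (c - q))
        ≤ A ^ (-p) * ((2 ^ c * Y ^ (-c)) * A ^ (c - q)) := by gcongr
      _ = _ := by ring
  have hA0 : 0 < A := by linarith
  have hB0 : 0 < B := by linarith
  have hY0 : 0 < Y := by linarith
  rcases le_total A B with h | h
  · refine (key (p := p) hcq hA h hYAB).trans ?_
    gcongr
    exact le_add_of_nonneg_right (by positivity)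
  · have := key (p := q) hcp hB h (by linarith)
    rw [mul_comm, add_comm p q]
    refine this.trans ?_
    gcongr
    exact le_add_of_nonneg_left (by positivity)

/-- Peetre's inequality. -/
theorem one_add_norm_rpow_neg_sub_le {a : ℝ} (ha : 0 ≤ a) (x y : V) :
    (1 + ‖x - y‖) ^ (-a) ≤ (1 + ‖x‖) ^ (-a) * (1 + ‖y‖) ^ a := by
  have h : 1 + ‖x‖ ≤ (1 + ‖x - y‖) * (1 + ‖y‖) := by
    have := norm_sub_norm_le x y
    nlinarith [norm_nonneg (x - y), norm_nonneg y]
  have h' : (1 + ‖x‖) ^ a ≤ (1 + ‖x - y‖) ^ a * (1 + ‖y‖) ^ a := by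
    rw [← Real.mul_rpow (by positivity) (by positivity)]
    exact Real.rpow_le_rpow (by positivity) h ha
  have h1 : 0 < (1 + ‖x‖) ^ a := by positivity
  have h2 : 0 < (1 + ‖x - y‖) ^ a := by positivity
  rw [Real.rpow_neg (by positivity), Real.rpow_neg (by positivity), inv_mul_eq_div,
    inv_eq_one_div, div_le_div_iff₀ h2 h1]
  linarith

theorem one_add_norm_rpow_neg_le_of_dist_le_one {a : ℝ} (ha : 0 ≤ a) {x y : V}
    (h : ‖y - x‖ ≤ 1) : (1 + ‖x‖) ^ (-a) ≤ 2 ^ a * (1 + ‖y‖) ^ (-a) := by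
  have h' : 1 + ‖y‖ ≤ 2 * (1 + ‖x‖) := by
    have := norm_sub_norm_le y x
    nlinarith [norm_nonneg x]
  have h1 : (1 + ‖y‖) ^ a ≤ 2 ^ a * (1 + ‖x‖) ^ a := by
    rw [← Real.mul_rpow (by positivity) (by positivity)]
    exact Real.rpow_le_rpow (by positivity) h' ha
  have h2 : 0 < (1 + ‖x‖) ^ a := by positivity
  have h3 : 0 < (1 + ‖y‖) ^ a := by positivity
  rw [Real.rpow_neg (by positivity), Real.rpow_neg (by positivity), ← div_eq_mul_inv,
    inv_eq_one_div, div_le_div_iff₀ h2 h3]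
  linarith

theorem continuous_one_add_norm_rpow (a : ℝ) : Continuous fun x : V => (1 + ‖x‖) ^ a :=
  (continuous_const.add continuous_norm).rpow_const fun x =>
    Or.inl (by positivity : (0 : ℝ) < 1 + ‖x‖).ne'

variable [NormedSpace ℝ V] [FiniteDimensional ℝ V] [MeasurableSpace V] [BorelSpace V]

theorem memLp_one_add_norm_rpow_neg (μ : Measure V) [μ.IsAddHaarMeasure] {a p : ℝ} (hp : 0 < p)
    (ha : finrank ℝ V < a * p) :
    MemLp (fun x : V => (1 + ‖x‖) ^ (-a)) (ENNReal.ofReal p) μ := by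
  rw [← integrable_norm_rpow_iff (continuous_one_add_norm_rpow _).aestronglyMeasurable
    (by simpa using hp) ENNReal.ofReal_ne_top, ENNReal.toReal_ofReal hp.le]
  refine (integrable_one_add_norm (μ := μ) ha).congr (Eventually.of_forall fun x => ?_)
  simp only
  rw [Real.norm_of_nonneg (by positivity), ← Real.rpow_mul (by positivity)]
  ring_nf

/-- Hölder's inequality: `hc` says exactly that the weight belongs to $L^{p'}$ for the conjugate
exponent $p'$. -/
theorem MeasureTheory.MemLp.integrable_mul_one_add_norm_rpow_neg {μ : Measure V}
    [μ.IsAddHaarMeasure] {f : V → ℝ} {p c : ℝ}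
    (hf : MemLp f (ENNReal.ofReal p) μ) (hp : 1 < p) (hc : finrank ℝ V * (1 - 1 / p) < c) :
    Integrable (fun x => f x * (1 + ‖x‖) ^ (-c)) μ := by
  have hpq := Real.HolderConjugate.conjExponent hp
  have hq : p.conjExponent = p / (p - 1) := rfl
  have hq0 : 0 < p.conjExponent := hpq.symm.pos
  have : ENNReal.HolderConjugate (ENNReal.ofReal p) (ENNReal.ofReal p.conjExponent) :=
    hpq.ennrealOfReal
  refine hf.integrable_mul (memLp_one_add_norm_rpow_neg μ hq0 ?_)
  have h1 : 1 - 1 / p = 1 / p.conjExponent := by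
    rw [hq]; field_simp
  rw [h1, mul_one_div, div_lt_iff₀ hq0] at hc
  exact hc

variable {μ : Measure V} [μ.IsAddHaarMeasure]

theorem lintegral_one_add_norm_conv_le {p q c : ℝ} (hc : 0 ≤ c) (hcp : c ≤ p) (hcq : c ≤ q)
    (h : finrank ℝ V < p + q - c) :
    ∃ C : ℝ, 0 ≤ C ∧ ∀ y : V,
      ∫⁻ x, ENNReal.ofReal ((1 + ‖y - x‖) ^ (-p) * (1 + ‖x‖) ^ (-q)) ∂μ ≤
        ENNReal.ofReal (C * (1 + ‖y‖) ^ (-c)) := by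
  have hint := integrable_one_add_norm (μ := μ) h
  set J : ℝ := ∫ x, (1 + ‖x‖) ^ (-(p + q - c)) ∂μ
  have hJ : 0 ≤ J := integral_nonneg fun x => by positivity
  refine ⟨2 ^ c * (J + J), by positivity, fun y => ?_⟩
  have hint' : Integrable (fun x => (1 + ‖y - x‖) ^ (-(p + q - c))) μ := hint.comp_sub_left y
  have e : ∫ x, 2 ^ c * (1 + ‖y‖) ^ (-c) *
      ((1 + ‖y - x‖) ^ (-(p + q - c)) + (1 + ‖x‖) ^ (-(p + q - c))) ∂μ =
      2 ^ c * (J + J) * (1 + ‖y‖) ^ (-c) := by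
    rw [integral_const_mul, integral_add hint' hint,
      integral_sub_left_eq_self (fun x => (1 + ‖x‖) ^ (-(p + q - c))) μ y]
    ring
  have hI : Integrable (fun x => 2 ^ c * (1 + ‖y‖) ^ (-c) *
      ((1 + ‖y - x‖) ^ (-(p + q - c)) + (1 + ‖x‖) ^ (-(p + q - c)))) μ :=
    (hint'.add hint).const_mul _
  rw [← e, ofReal_integral_eq_lintegral_ofReal hI (Eventually.of_forall fun x => by positivity)]
  refine lintegral_mono fun x => ENNReal.ofReal_le_ofReal ?_
  refine rpow_neg_mul_rpow_neg_le hc hcp hcq ?_ ?_ ?_ ?_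
  · linarith [norm_nonneg (y - x)]
  · linarith [norm_nonneg x]
  · linarith [norm_nonneg y]
  · have := norm_sub_norm_le y x
    linarith

theorem integrableOn_ball_norm_rpow_sub {α : ℝ} (hα : 0 < α) (hV : 1 ≤ finrank ℝ V) (r : ℝ) :
    IntegrableOn (fun x : V => ‖x‖ ^ (α - finrank ℝ V)) (Metric.ball 0 r) μ := by
  refine integrableOn_ball_of_norm_le_rpow (C := 1) (α := finrank ℝ V - α) hV (by linarith) ?_ ?_
  · refine Eventually.of_forall fun x => ?_
    rw [Real.norm_of_nonneg (by positivity), one_mul, neg_sub]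
  · exact (measurable_norm.pow_const _).aestronglyMeasurable

/-- The kernel is split at distance $1$. Near its singularity the weights at $x$ and $y$ are
comparable and the kernel is integrable. Further away it is comparable to $(1+|y-x|)^{\alpha-n}$,
and `lintegral_one_add_norm_conv_le` applies with $p=n-\alpha$ and $q=a$, for which the
integrability condition $n<p+q-c$ reads $c<a-\alpha$. -/
theorem lintegral_norm_rpow_conv_one_add_norm_le {α a c : ℝ} (hα : 0 < α) (hαn : α < finrank ℝ V)
    (hc : 0 ≤ c) (hca : c < a - α) (hcα : c ≤ finrank ℝ V - α) :
    ∃ C : ℝ, 0 ≤ C ∧ ∀ y : V,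
      ∫⁻ x, ENNReal.ofReal (‖y - x‖ ^ (α - finrank ℝ V) * (1 + ‖x‖) ^ (-a)) ∂μ ≤
        ENNReal.ofReal (C * (1 + ‖y‖) ^ (-c)) := by
  set n : ℝ := (finrank ℝ V : ℝ) with hn
  have hV : 1 ≤ finrank ℝ V := by
    have : 0 < (finrank ℝ V : ℝ) := hα.trans hαn
    exact_mod_cast this
  have ha : 0 ≤ a := by linarith
  obtain ⟨C, hC, h⟩ := lintegral_one_add_norm_conv_le (μ := μ) (p := n - α) (q := a) hc hcα
    (by linarith) (by linarith)
  have hloc : IntegrableOn (fun x : V => ‖x‖ ^ (α - n)) (Metric.ball 0 1) μ :=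
    integrableOn_ball_norm_rpow_sub hα hV 1
  set k : V → ℝ := (Metric.ball (0 : V) 1).indicator fun x => ‖x‖ ^ (α - n) with hk
  have hkint : Integrable k μ := (integrable_indicator_iff Metric.isOpen_ball.measurableSet).2 hloc
  have hk0 : ∀ x, 0 ≤ k x := fun x => indicator_nonneg (fun x _ => by positivity) x
  set J : ℝ := ∫ x, k x ∂μ
  have hJ : 0 ≤ J := integral_nonneg hk0
  refine ⟨J * 2 ^ a + 2 ^ (n - α) * C, by positivity, fun y => ?_⟩
  have hpt : ∀ x, ‖y - x‖ ^ (α - n) * (1 + ‖x‖) ^ (-a) ≤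
      2 ^ a * (1 + ‖y‖) ^ (-c) * k (y - x) +
        2 ^ (n - α) * ((1 + ‖y - x‖) ^ (-(n - α)) * (1 + ‖x‖) ^ (-a)) := by
    intro x
    by_cases hx : ‖y - x‖ < 1
    · have e : k (y - x) = ‖y - x‖ ^ (α - n) := indicator_of_mem (by simpa using hx) _
      rw [e]
      have h1 := one_add_norm_rpow_neg_le_of_dist_le_one ha hx.le
      have h2 : (1 + ‖y‖) ^ (-a) ≤ (1 + ‖y‖) ^ (-c) :=
        Real.rpow_le_rpow_of_exponent_le (by linarith [norm_nonneg y]) (by linarith)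
      have h3 : 0 ≤ ‖y - x‖ ^ (α - n) := by positivity
      have h4 : (1 + ‖x‖) ^ (-a) ≤ 2 ^ a * (1 + ‖y‖) ^ (-c) := h1.trans (by gcongr)
      have h5 := mul_le_mul_of_nonneg_left h4 h3
      have h6 : 0 ≤ 2 ^ (n - α) * ((1 + ‖y - x‖) ^ (-(n - α)) * (1 + ‖x‖) ^ (-a)) := by positivity
      linarith
    · push Not at hx
      have h1 : ‖y - x‖ ^ (α - n) ≤ 2 ^ (n - α) * (1 + ‖y - x‖) ^ (-(n - α)) := by
        have h2 : (1 + ‖y - x‖) / 2 ≤ ‖y - x‖ := by linarith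
        have h3 := Real.rpow_le_rpow_of_nonpos (by positivity) h2
          (show α - n ≤ 0 by linarith)
        refine h3.trans_eq ?_
        rw [Real.div_rpow (by positivity) (by norm_num), div_eq_inv_mul,
          ← Real.rpow_neg (by norm_num), neg_sub, neg_sub]
      have h4 : 0 ≤ 2 ^ a * (1 + ‖y‖) ^ (-c) * k (y - x) := mul_nonneg (by positivity) (hk0 _)
      have h5 := mul_le_mul_of_nonneg_right h1 (show 0 ≤ (1 + ‖x‖) ^ (-a) by positivity)
      linarith
  have hkint' : Integrable (fun x => k (y - x)) μ := hkint.comp_sub_left y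
  calc ∫⁻ x, ENNReal.ofReal (‖y - x‖ ^ (α - n) * (1 + ‖x‖) ^ (-a)) ∂μ
      ≤ ∫⁻ x, (ENNReal.ofReal (2 ^ a * (1 + ‖y‖) ^ (-c) * k (y - x)) +
        ENNReal.ofReal (2 ^ (n - α)) *
          ENNReal.ofReal ((1 + ‖y - x‖) ^ (-(n - α)) * (1 + ‖x‖) ^ (-a))) ∂μ := by
        refine lintegral_mono fun x => ?_
        refine (ENNReal.ofReal_le_ofReal (hpt x)).trans ?_
        rw [ENNReal.ofReal_add (mul_nonneg (by positivity) (hk0 _)) (by positivity),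
          ENNReal.ofReal_mul (p := 2 ^ (n - α)) (by positivity)]
    _ = ENNReal.ofReal (2 ^ a * (1 + ‖y‖) ^ (-c) * J) + ENNReal.ofReal (2 ^ (n - α)) *
          ∫⁻ x, ENNReal.ofReal ((1 + ‖y - x‖) ^ (-(n - α)) * (1 + ‖x‖) ^ (-a)) ∂μ := by
        rw [lintegral_add_left' , lintegral_const_mul' _ _ ENNReal.ofReal_ne_top,
          ← ofReal_integral_eq_lintegral_ofReal (hkint'.const_mul _)
            (Eventually.of_forall fun x => mul_nonneg (by positivity) (hk0 _)),
          integral_const_mul, integral_sub_left_eq_self k μ y]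
        exact (hkint'.aestronglyMeasurable.aemeasurable.const_mul _).ennreal_ofReal
    _ ≤ ENNReal.ofReal (2 ^ a * (1 + ‖y‖) ^ (-c) * J) + ENNReal.ofReal (2 ^ (n - α)) *
          ENNReal.ofReal (C * (1 + ‖y‖) ^ (-c)) := by gcongr; exact h y
    _ = _ := by
        rw [← ENNReal.ofReal_mul (by positivity), ← ENNReal.ofReal_add (by positivity)
          (by positivity)]
        ring_nf

end Weights

/-! ### Functions integrable against a polynomial weight -/

section WeightedIntegrability

open Filter

variable {V : Type*} [NormedAddCommGroup V]

theorem mul_one_add_norm_rpow_neg_mul_rpow (v : V → ℝ) (a : ℝ) :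
    (fun x => v x * (1 + ‖x‖) ^ (-a) * (1 + ‖x‖) ^ a) = v := by
  funext x
  have h : (1 + ‖x‖) ^ (-a) * (1 + ‖x‖) ^ a = 1 := by
    rw [← Real.rpow_add (by positivity), neg_add_cancel, Real.rpow_zero]
  rw [mul_assoc, h, mul_one]

variable [MeasurableSpace V] [BorelSpace V] {μ : Measure V} {v : V → ℝ} {a : ℝ}

theorem aestronglyMeasurable_of_integrable_mul_weight
    (hv : Integrable (fun x => v x * (1 + ‖x‖) ^ (-a)) μ) : AEStronglyMeasurable v μ := by
  rw [← mul_one_add_norm_rpow_neg_mul_rpow v a]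
  exact hv.aestronglyMeasurable.mul
    ((continuous_one_add_norm_rpow a).measurable.aestronglyMeasurable)

theorem locallyIntegrable_of_integrable_mul_weight [LocallyCompactSpace V]
    (hv : Integrable (fun x => v x * (1 + ‖x‖) ^ (-a)) μ) : LocallyIntegrable v μ := by
  rw [← mul_one_add_norm_rpow_neg_mul_rpow v a]
  have h := hv.locallyIntegrable.continuous_mul (continuous_one_add_norm_rpow (V := V) a)
  refine h.congr (Eventually.of_forall fun x => ?_)
  simp [mul_comm]

theorem integrable_mul_of_norm_le_weight {ψ : V → ℂ} {C : ℝ}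
    (hv : Integrable (fun x => v x * (1 + ‖x‖) ^ (-a)) μ) (hψ : AEStronglyMeasurable ψ μ)
    (hC : ∀ x, ‖ψ x‖ ≤ C * (1 + ‖x‖) ^ (-a)) :
    Integrable (fun x => (v x : ℂ) * ψ x) μ := by
  refine (hv.norm.const_mul C).mono' ?_ (Eventually.of_forall fun x => ?_)
  · exact (Complex.continuous_ofReal.comp_aestronglyMeasurable
      (aestronglyMeasurable_of_integrable_mul_weight hv)).mul hψ
  · rw [norm_mul, Complex.norm_real, norm_mul, Real.norm_of_nonneg (r := (1 + ‖x‖) ^ (-a))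
      (by positivity)]
    nlinarith [hC x, norm_nonneg (v x)]

theorem integrable_mul_weight_of_le {b : ℝ} (hab : a ≤ b)
    (hv : Integrable (fun x => v x * (1 + ‖x‖) ^ (-a)) μ) :
    Integrable (fun x => v x * (1 + ‖x‖) ^ (-b)) μ := by
  refine hv.norm.mono' ?_ (Eventually.of_forall fun x => ?_)
  · exact (aestronglyMeasurable_of_integrable_mul_weight hv).mul
      ((continuous_one_add_norm_rpow _).measurable.aestronglyMeasurable)
  · rw [norm_mul, norm_mul, Real.norm_of_nonneg (r := (1 + ‖x‖) ^ (-b)) (by positivity),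
      Real.norm_of_nonneg (r := (1 + ‖x‖) ^ (-a)) (by positivity)]
    gcongr
    linarith [norm_nonneg x]

end WeightedIntegrability

/-! ### Absolute convergence and Fubini for the Riesz potential -/

section RieszPotential

open Filter

variable {d : ℕ} {α a c : ℝ} {T : EuclideanSpace ℝ (Fin d) → ℝ}

theorem measurable_rieszKernel (d : ℕ) (α : ℝ) : Measurable (rieszKernel d α) :=
  (measurable_norm.pow_const _).const_mul _

theorem rieszKernel_sub_comm (x y : EuclideanSpace ℝ (Fin d)) :
    rieszKernel d α (x - y) = rieszKernel d α (y - x) := by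
  simp only [rieszKernel, norm_sub_rev]

theorem rieszKernel_nonneg (hα : 0 < α) (hαd : α < d) (x : EuclideanSpace ℝ (Fin d)) :
    0 ≤ rieszKernel d α x := by
  have h1 : 0 < Real.Gamma ((d - α) / 2) := Real.Gamma_pos_of_pos (by linarith)
  have h2 : 0 < Real.Gamma (α / 2) := Real.Gamma_pos_of_pos (by linarith)
  simp only [rieszKernel]
  positivity

theorem lintegral_rieszKernel_conv_one_add_norm_le (hα : 0 < α) (hαd : α < d)
    (hc : 0 ≤ c) (hca : c < a - α) (hcα : c ≤ d - α) :
    ∃ C : ℝ, 0 ≤ C ∧ ∀ y : EuclideanSpace ℝ (Fin d),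
      ∫⁻ x, ENNReal.ofReal (rieszKernel d α (x - y) * (1 + ‖x‖) ^ (-a)) ≤
        ENNReal.ofReal (C * (1 + ‖y‖) ^ (-c)) := by
  have hd : (Module.finrank ℝ (EuclideanSpace ℝ (Fin d)) : ℝ) = d := by simp
  obtain ⟨C, hC, h⟩ := lintegral_norm_rpow_conv_one_add_norm_le
    (μ := (volume : Measure (EuclideanSpace ℝ (Fin d)))) hα (hαd.trans_eq hd.symm) hc hca
    (by rw [hd]; exact hcα)
  rw [hd] at h
  set A := Real.Gamma ((d - α) / 2) /
    (Real.pi ^ ((d : ℝ) / 2) * 2 ^ α * Real.Gamma (α / 2)) with hA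
  have hA0 : 0 ≤ A := by
    have h1 : 0 < Real.Gamma ((d - α) / 2) := Real.Gamma_pos_of_pos (by linarith)
    have h2 : 0 < Real.Gamma (α / 2) := Real.Gamma_pos_of_pos (by linarith)
    positivity
  refine ⟨A * C, by positivity, fun y => ?_⟩
  calc ∫⁻ x, ENNReal.ofReal (rieszKernel d α (x - y) * (1 + ‖x‖) ^ (-a))
      = ∫⁻ x, ENNReal.ofReal A * ENNReal.ofReal (‖y - x‖ ^ (α - d) * (1 + ‖x‖) ^ (-a)) := by
        refine lintegral_congr fun x => ?_
        rw [← ENNReal.ofReal_mul hA0, rieszKernel, ← hA, norm_sub_rev, mul_assoc]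
    _ = ENNReal.ofReal A * ∫⁻ x, ENNReal.ofReal (‖y - x‖ ^ (α - d) * (1 + ‖x‖) ^ (-a)) :=
        lintegral_const_mul' _ _ ENNReal.ofReal_ne_top
    _ ≤ ENNReal.ofReal A * ENNReal.ofReal (C * (1 + ‖y‖) ^ (-c)) := by gcongr; exact h y
    _ = _ := by rw [← ENNReal.ofReal_mul hA0]; ring_nf

theorem integrable_rieszKernel_mul_of_norm_le (hα : 0 < α) (hαd : α < d) (hαa : α < a)
    {ψ : EuclideanSpace ℝ (Fin d) → ℂ} {C : ℝ} (hψ : AEStronglyMeasurable ψ volume)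
    (hC : ∀ x, ‖ψ x‖ ≤ C * (1 + ‖x‖) ^ (-a)) (y : EuclideanSpace ℝ (Fin d)) :
    Integrable (fun x => (rieszKernel d α (x - y) : ℂ) * ψ x) volume := by
  obtain ⟨D, -, hD⟩ := lintegral_rieszKernel_conv_one_add_norm_le (d := d) (c := 0) (a := a) hα hαd
    le_rfl (by linarith) (by linarith)
  have hm : Measurable fun x : EuclideanSpace ℝ (Fin d) => rieszKernel d α (x - y) :=
    (measurable_rieszKernel d α).comp (measurable_id.sub_const y)
  refine integrable_mul_of_norm_le_weight ?_ hψ hC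
  refine ⟨(hm.mul (continuous_one_add_norm_rpow _).measurable).aestronglyMeasurable, ?_⟩
  rw [hasFiniteIntegral_iff_ofReal
    (Eventually.of_forall fun x => mul_nonneg (rieszKernel_nonneg hα hαd _) (by positivity))]
  exact (hD y).trans_lt ENNReal.ofReal_lt_top

/-- By Tonelli the $x$-integral may be done first. It turns the weight $(1+|x|)^{-a}$ into a
multiple of $(1+|y|)^{-c}$, against which $T$ is integrable. Almost everywhere convergence of the
potential, its weighted integrability and the exchange of integrals all follow from this. -/
theorem integrable_prod_rieszKernel_mul (hα : 0 < α) (hαd : α < d)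
    (hc : 0 ≤ c) (hca : c < a - α) (hcα : c ≤ d - α)
    (hT : Integrable (fun y => T y * (1 + ‖y‖) ^ (-c)) volume) :
    Integrable (fun p : EuclideanSpace ℝ (Fin d) × EuclideanSpace ℝ (Fin d) =>
      rieszKernel d α (p.1 - p.2) * T p.2 * (1 + ‖p.1‖) ^ (-a)) (volume.prod volume) := by
  obtain ⟨C, hC, h⟩ := lintegral_rieszKernel_conv_one_add_norm_le (d := d) hα hαd hc hca hcα
  have hm : AEStronglyMeasurable (fun p : EuclideanSpace ℝ (Fin d) × EuclideanSpace ℝ (Fin d) =>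
      rieszKernel d α (p.1 - p.2) * T p.2 * (1 + ‖p.1‖) ^ (-a)) (volume.prod volume) := by
    refine (AEStronglyMeasurable.mul ?_
      (aestronglyMeasurable_of_integrable_mul_weight hT).comp_snd).mul ?_
    · exact ((measurable_rieszKernel d α).comp
        (measurable_fst.sub measurable_snd)).aestronglyMeasurable
    · exact ((continuous_one_add_norm_rpow _).measurable.comp measurable_fst).aestronglyMeasurable
  refine ⟨hm, ?_⟩
  rw [HasFiniteIntegral, lintegral_prod_symm _ hm.enorm]
  calc ∫⁻ y, ∫⁻ x, ‖rieszKernel d α (x - y) * T y * (1 + ‖x‖) ^ (-a)‖ₑ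
      = ∫⁻ y, ‖T y‖ₑ * ∫⁻ x, ENNReal.ofReal (rieszKernel d α (x - y) * (1 + ‖x‖) ^ (-a)) := by
        refine lintegral_congr fun y => ?_
        rw [← lintegral_const_mul' _ _ enorm_ne_top]
        refine lintegral_congr fun x => ?_
        rw [enorm_mul, enorm_mul, Real.enorm_of_nonneg (rieszKernel_nonneg hα hαd _),
          Real.enorm_of_nonneg (r := (1 + ‖x‖) ^ (-a)) (by positivity),
          ENNReal.ofReal_mul (rieszKernel_nonneg hα hαd _)]
        ring
    _ ≤ ∫⁻ y, ‖T y‖ₑ * ENNReal.ofReal (C * (1 + ‖y‖) ^ (-c)) := by gcongr with y; exact h y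
    _ = ENNReal.ofReal C * ∫⁻ y, ‖T y * (1 + ‖y‖) ^ (-c)‖ₑ := by
        rw [← lintegral_const_mul' _ _ ENNReal.ofReal_ne_top]
        refine lintegral_congr fun y => ?_
        rw [enorm_mul, Real.enorm_of_nonneg (r := (1 + ‖y‖) ^ (-c)) (by positivity),
          ENNReal.ofReal_mul hC]
        ring
    _ < ⊤ := ENNReal.mul_lt_top ENNReal.ofReal_lt_top hT.2

theorem rieszPotential_eq (x : EuclideanSpace ℝ (Fin d)) :
    rieszPotential α T x = ∫ y, rieszKernel d α (x - y) * T y := by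
  rw [rieszPotential, convolution_eq_swap]
  rfl

theorem ae_convolutionExistsAt_rieszKernel (hα : 0 < α) (hαd : α < d)
    (hc : 0 ≤ c) (hca : c < a - α) (hcα : c ≤ d - α)
    (hT : Integrable (fun y => T y * (1 + ‖y‖) ^ (-c)) volume) :
    ∀ᵐ x ∂(volume : Measure (EuclideanSpace ℝ (Fin d))),
      ConvolutionExistsAt (rieszKernel d α) T x (ContinuousLinearMap.mul ℝ ℝ) volume := by
  filter_upwards [(integrable_prod_rieszKernel_mul hα hαd hc hca hcα hT).prod_right_ae] with x hx
  rw [convolutionExistsAt_iff_integrable_swap]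
  refine (hx.mul_const ((1 + ‖x‖) ^ a)).congr (Eventually.of_forall fun y => ?_)
  have := congrFun (mul_one_add_norm_rpow_neg_mul_rpow
    (fun x => rieszKernel d α (x - y) * T y) a) x
  simpa using this

theorem integrable_rieszPotential_mul_weight (hα : 0 < α) (hαd : α < d)
    (hc : 0 ≤ c) (hca : c < a - α) (hcα : c ≤ d - α)
    (hT : Integrable (fun y => T y * (1 + ‖y‖) ^ (-c)) volume) :
    Integrable (fun x => rieszPotential α T x * (1 + ‖x‖) ^ (-a)) volume := by
  refine (integrable_prod_rieszKernel_mul hα hαd hc hca hcα hT).integral_prod_left.congr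
    (Eventually.of_forall fun x => ?_)
  simp only [integral_mul_const, rieszPotential_eq]

theorem integral_rieszPotential_mul (hα : 0 < α) (hαd : α < d)
    (hc : 0 ≤ c) (hca : c < a - α) (hcα : c ≤ d - α)
    (hT : Integrable (fun y => T y * (1 + ‖y‖) ^ (-c)) volume)
    {ψ : EuclideanSpace ℝ (Fin d) → ℂ} {C : ℝ} (hψ : AEStronglyMeasurable ψ volume)
    (hC : ∀ x, ‖ψ x‖ ≤ C * (1 + ‖x‖) ^ (-a)) :
    ∫ x, (rieszPotential α T x : ℂ) * ψ x =
      ∫ y, (T y : ℂ) * ∫ x, (rieszKernel d α (x - y) : ℂ) * ψ x := by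
  have hI := integrable_prod_rieszKernel_mul hα hαd hc hca hcα hT
  have hTm := (aestronglyMeasurable_of_integrable_mul_weight hT)
  have hJ : Integrable (fun p : EuclideanSpace ℝ (Fin d) × EuclideanSpace ℝ (Fin d) =>
      ((rieszKernel d α (p.1 - p.2) * T p.2 : ℝ) : ℂ) * ψ p.1) (volume.prod volume) := by
    refine (hI.norm.const_mul C).mono' ?_ (Eventually.of_forall fun p => ?_)
    · refine (Complex.continuous_ofReal.comp_aestronglyMeasurable
        (AEStronglyMeasurable.mul ?_ hTm.comp_snd)).mul hψ.comp_fst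
      exact ((measurable_rieszKernel d α).comp
        (measurable_fst.sub measurable_snd)).aestronglyMeasurable
    · rw [norm_mul, Complex.norm_real, norm_mul _ ((1 + ‖p.1‖) ^ (-a)),
        Real.norm_of_nonneg (r := (1 + ‖p.1‖) ^ (-a)) (by positivity)]
      nlinarith [hC p.1, norm_nonneg (rieszKernel d α (p.1 - p.2) * T p.2)]
  calc ∫ x, (rieszPotential α T x : ℂ) * ψ x
      = ∫ x, ∫ y, ((rieszKernel d α (x - y) * T y : ℝ) : ℂ) * ψ x := by
        congr 1 with x
        rw [rieszPotential_eq, integral_mul_const, integral_complex_ofReal]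
    _ = ∫ y, ∫ x, ((rieszKernel d α (x - y) * T y : ℝ) : ℂ) * ψ x :=
        integral_integral_swap hJ
    _ = _ := by
        congr 1 with y
        rw [← integral_const_mul]
        congr 1 with x
        push_cast
        ring

end RieszPotential

/-! ### Fourier multipliers as convolutions; decay and conjugation -/

section FourierConvolution

open Module Filter

variable {V : Type*} [NormedAddCommGroup V] [InnerProductSpace ℝ V] [FiniteDimensional ℝ V]
  [MeasurableSpace V] [BorelSpace V]

theorem integral_fourier_mul_eq_flip {f g : V → ℂ} (hf : Integrable f) (hg : Integrable g) :
    ∫ ξ, 𝓕 f ξ * g ξ = ∫ x, f x * 𝓕 g x := by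
  simpa using! VectorFourier.integral_bilin_fourierIntegral_eq_flip (.mul ℂ ℂ) (L := innerₗ V)
    Real.continuous_fourierChar continuous_inner hf hg

/-- Transposing the Fourier transform onto $F$ modulated by the character at $x$ gives the
convolution formula without asking that $\mathscr F^{-1}F$ be integrable. -/
theorem fourierInv_mul_fourier_eq_integral {F ψ : V → ℂ} (hF : Integrable F) (hψ : Integrable ψ)
    (x : V) : 𝓕⁻ (fun ξ => F ξ * 𝓕 ψ ξ) x = ∫ y, ψ y * 𝓕⁻ F (x - y) := by
  have hh : Integrable fun ξ => Real.fourierChar (inner ℝ ξ x) • F ξ := by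
    refine hF.norm.mono' ?_ (Eventually.of_forall fun ξ => by rw [Circle.norm_smul])
    exact ((Real.continuous_fourierChar.comp
      (continuous_id.inner continuous_const)).aestronglyMeasurable).smul hF.aestronglyMeasurable
  have h := integral_fourier_mul_eq_flip hψ hh
  rw [Real.fourierInv_eq]
  calc ∫ ξ, Real.fourierChar (inner ℝ ξ x) • (F ξ * 𝓕 ψ ξ)
      = ∫ ξ, 𝓕 ψ ξ * (Real.fourierChar (inner ℝ ξ x) • F ξ) := by
        congr 1 with ξ
        simp only [Circle.smul_def, smul_eq_mul]
        ring
    _ = _ := h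
    _ = _ := by
        congr 1 with y
        congr 1
        rw [Real.fourier_eq, Real.fourierInv_eq]
        congr 1 with ξ
        rw [smul_smul, ← AddChar.map_add_eq_mul, inner_sub_right]
        congr 2
        ring

theorem SchwartzMap.exists_norm_le_one_add_norm_rpow_neg {F : Type*} [NormedAddCommGroup F]
    [NormedSpace ℝ F] (f : 𝓢(V, F)) (a : ℝ) :
    ∃ C : ℝ, 0 ≤ C ∧ ∀ x, ‖f x‖ ≤ C * (1 + ‖x‖) ^ (-a) := by
  -- The natural ceiling is $0$ for negative $a$; the bound $a\le k$ still holds, so no sign of $a$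
  -- is required.
  set k := ⌈a⌉₊
  refine ⟨2 ^ k * (Finset.Iic (k, 0)).sup (fun m => SchwartzMap.seminorm ℝ m.1 m.2) f,
    by positivity, fun x => ?_⟩
  have h := SchwartzMap.one_add_le_sup_seminorm_apply (𝕜 := ℝ) (m := (k, 0)) le_rfl le_rfl f x
  rw [norm_iteratedFDeriv_zero] at h
  have h1 : (1 + ‖x‖) ^ a ≤ (1 + ‖x‖) ^ k := by
    rw [← Real.rpow_natCast]
    exact Real.rpow_le_rpow_of_exponent_le (by linarith [norm_nonneg x]) (Nat.le_ceil a)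
  have h2 : 0 < (1 + ‖x‖) ^ a := by positivity
  rw [Real.rpow_neg (by positivity), ← div_eq_mul_inv, le_div_iff₀ h2, mul_comm]
  exact (mul_le_mul_of_nonneg_right h1 (norm_nonneg _)).trans h

theorem SchwartzMap.integrable_norm_mul_one_add_norm_rpow {F : Type*} [NormedAddCommGroup F]
    [NormedSpace ℝ F] (f : 𝓢(V, F)) (a : ℝ) :
    Integrable (fun x => ‖f x‖ * (1 + ‖x‖) ^ a) volume := by
  obtain ⟨C, hC, h⟩ := f.exists_norm_le_one_add_norm_rpow_neg (a + (finrank ℝ V + 1))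
  have hi : Integrable (fun x : V => C * (1 + ‖x‖) ^ (-((finrank ℝ V : ℝ) + 1))) volume :=
    (integrable_one_add_norm (by linarith)).const_mul C
  refine hi.mono' (f.continuous.norm.mul
    (continuous_one_add_norm_rpow a)).aestronglyMeasurable (Eventually.of_forall fun x => ?_)
  rw [norm_mul, norm_norm, Real.norm_of_nonneg (by positivity)]
  refine (mul_le_mul_of_nonneg_right (h x) (by positivity)).trans_eq ?_
  rw [mul_assoc, ← Real.rpow_add (by positivity)]
  ring_nf

theorem fourierInv_comp_smul (F : V → ℂ) {r : ℝ} (hr : 0 < r) (x : V) :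
    𝓕⁻ (fun ξ => F (r • ξ)) x = (r ^ (-(finrank ℝ V : ℝ)) : ℝ) • 𝓕⁻ F (r⁻¹ • x) := by
  rw [Real.fourierInv_eq, Real.fourierInv_eq]
  have h := Measure.integral_comp_smul (volume : Measure V)
    (fun ξ => Real.fourierChar (inner ℝ ξ (r⁻¹ • x)) • F ξ) r
  rw [Real.rpow_neg hr.le, Real.rpow_natCast, ← abs_of_pos (a := (r ^ finrank ℝ V)⁻¹)
    (by positivity), ← h]
  congr 1 with ξ
  rw [inner_smul_left, inner_smul_right]
  simp [hr.ne']

/-- The operator with multiplier `M (r ξ)` decays as fast as its dilated kernel. -/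
theorem exists_norm_fourierInv_dilation_mul_fourier_le (M ψ : 𝓢(V, ℂ)) {a : ℝ} (ha : 0 ≤ a) :
    ∃ C : ℝ, 0 ≤ C ∧ ∀ r : ℝ, 1 ≤ r → ∀ x,
      ‖𝓕⁻ (fun ξ => M (r • ξ) * 𝓕 (ψ : V → ℂ) ξ) x‖ ≤
        C * r ^ (a - finrank ℝ V) * (1 + ‖x‖) ^ (-a) := by
  obtain ⟨D, hD, h⟩ := (𝓕⁻ M).exists_norm_le_one_add_norm_rpow_neg a
  have hI := ψ.integrable_norm_mul_one_add_norm_rpow a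
  set J := ∫ y, ‖ψ y‖ * (1 + ‖y‖) ^ a
  have hJ : 0 ≤ J := integral_nonneg fun y => by positivity
  refine ⟨D * J, by positivity, fun r hr x => ?_⟩
  have hr0 : 0 < r := by linarith
  have hF : Integrable (fun ξ => M (r • ξ)) volume := M.integrable.comp_smul hr0.ne'
  -- The kernel is $r^{-n}(\mathscr F^{-1}M)(z/r)$. As $r\ge1$, $1+|z/r|\ge r^{-1}(1+|z|)$, which
  -- costs the factor $r^a$. Peetre's inequality then carries the weight through the convolution
  -- with $\psi$.
  have hK : ∀ z, ‖𝓕⁻ (fun ξ => M (r • ξ)) z‖ ≤ D * r ^ (a - finrank ℝ V) * (1 + ‖z‖) ^ (-a) := by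
    intro z
    rw [fourierInv_comp_smul _ hr0, norm_smul, Real.norm_of_nonneg (by positivity),
      ← SchwartzMap.fourierInv_coe]
    have h1 : (1 + ‖r⁻¹ • z‖) ^ (-a) ≤ r ^ a * (1 + ‖z‖) ^ (-a) := by
      have h2 : r⁻¹ * (1 + ‖z‖) ≤ 1 + ‖r⁻¹ • z‖ := by
        rw [norm_smul, norm_inv, Real.norm_of_nonneg hr0.le]
        have := inv_le_one_of_one_le₀ hr
        linarith
      refine (Real.rpow_le_rpow_of_nonpos (by positivity) h2 (by linarith)).trans_eq ?_
      rw [Real.mul_rpow (by positivity) (by positivity), Real.inv_rpow hr0.le, Real.rpow_neg hr0.le,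
        inv_inv]
    calc r ^ (-(finrank ℝ V : ℝ)) * ‖(𝓕⁻ M) (r⁻¹ • z)‖
        ≤ r ^ (-(finrank ℝ V : ℝ)) * (D * (r ^ a * (1 + ‖z‖) ^ (-a))) := by
          gcongr
          exact (h _).trans (by gcongr)
      _ = _ := by
          rw [sub_eq_add_neg a, Real.rpow_add hr0]
          ring
  rw [fourierInv_mul_fourier_eq_integral hF ψ.integrable]
  calc ‖∫ y, ψ y * 𝓕⁻ (fun ξ => M (r • ξ)) (x - y)‖
      ≤ ∫ y, D * r ^ (a - finrank ℝ V) * (1 + ‖x‖) ^ (-a) * (‖ψ y‖ * (1 + ‖y‖) ^ a) := by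
        refine norm_integral_le_of_norm_le (hI.const_mul _) (Eventually.of_forall fun y => ?_)
        rw [norm_mul]
        have h3 := one_add_norm_rpow_neg_sub_le ha x y
        calc ‖ψ y‖ * ‖𝓕⁻ (fun ξ => M (r • ξ)) (x - y)‖
            ≤ ‖ψ y‖ * (D * r ^ (a - finrank ℝ V) * ((1 + ‖x‖) ^ (-a) * (1 + ‖y‖) ^ a)) := by
              gcongr
              exact (hK _).trans (by gcongr)
          _ = _ := by ring
    _ = _ := by
        rw [integral_const_mul]
        ring

theorem conj_fourier (f : V → ℂ) (ξ : V) :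
    (starRingEnd ℂ) (𝓕 f ξ) = 𝓕⁻ (fun x => (starRingEnd ℂ) (f x)) ξ := by
  rw [Real.fourier_eq', Real.fourierInv_eq', ← integral_conj]
  congr 1 with x
  simp only [smul_eq_mul, map_mul, ← Complex.exp_conj, Complex.conj_ofReal, Complex.conj_I]
  congr 2
  push_cast
  ring

theorem conj_fourierInv (f : V → ℂ) (ξ : V) :
    (starRingEnd ℂ) (𝓕⁻ f ξ) = 𝓕 (fun x => (starRingEnd ℂ) (f x)) ξ := by
  rw [← Complex.conj_conj (𝓕 (fun x => (starRingEnd ℂ) (f x)) ξ), conj_fourier]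
  simp

theorem fourier_neg_eq_fourierInv (f : V → ℂ) (ξ : V) : 𝓕 f (-ξ) = 𝓕⁻ f ξ :=
  (Real.fourierInv_eq_fourier_neg f ξ).symm

theorem conj_fourier_ofReal (f : V → ℝ) (ξ : V) :
    (starRingEnd ℂ) (𝓕 (fun x => (f x : ℂ)) ξ) = 𝓕 (fun x => (f x : ℂ)) (-ξ) := by
  rw [conj_fourier, fourier_neg_eq_fourierInv]
  simp

end FourierConvolution

/-! ### Smooth cutoffs in frequency -/

section FrequencyCutoff

open Filter Topology

variable {V : Type*} [NormedAddCommGroup V] [InnerProductSpace ℝ V]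

/-- A smooth radial cutoff: equal to `1` for `‖ξ‖ ^ 2 ≤ 1` and to `0` for `2 ≤ ‖ξ‖ ^ 2`. -/
noncomputable def freqCutoff (ξ : V) : ℝ := Real.smoothTransition (2 - ‖ξ‖ ^ 2)

theorem freqCutoff_nonneg (ξ : V) : 0 ≤ freqCutoff ξ := Real.smoothTransition.nonneg _

theorem freqCutoff_le_one (ξ : V) : freqCutoff ξ ≤ 1 := Real.smoothTransition.le_one _

theorem freqCutoff_neg (ξ : V) : freqCutoff (-ξ) = freqCutoff ξ := by simp [freqCutoff]

theorem freqCutoff_eq_one {ξ : V} (h : ‖ξ‖ ^ 2 ≤ 1) : freqCutoff ξ = 1 :=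
  Real.smoothTransition.one_of_one_le (by linarith)

theorem freqCutoff_eq_zero {ξ : V} (h : 2 ≤ ‖ξ‖ ^ 2) : freqCutoff ξ = 0 :=
  Real.smoothTransition.zero_of_nonpos (by linarith)

theorem contDiff_freqCutoff : ContDiff ℝ ∞ (freqCutoff : V → ℝ) :=
  Real.smoothTransition.contDiff.comp (contDiff_const.sub (contDiff_norm_sq ℝ))

theorem hasCompactSupport_freqCutoff [ProperSpace V] :
    HasCompactSupport (freqCutoff : V → ℝ) := by
  refine HasCompactSupport.intro (isCompact_closedBall (0 : V) 2) fun ξ hξ => ?_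
  refine freqCutoff_eq_zero ?_
  rw [Metric.mem_closedBall, dist_zero_right, not_le] at hξ
  nlinarith

theorem hasTemperateGrowth_freqCutoff [ProperSpace V] :
    Function.HasTemperateGrowth (freqCutoff : V → ℝ) :=
  hasCompactSupport_freqCutoff.hasTemperateGrowth contDiff_freqCutoff

/-- The multiplier `(2π‖ξ‖)^r` cut off to high frequencies. -/
noncomputable def highFreqPow (r : ℝ) (ξ : V) : ℝ := (1 - freqCutoff ξ) * (2 * Real.pi * ‖ξ‖) ^ r

theorem hasTemperateGrowth_highFreqPow [ProperSpace V] (r : ℝ) :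
    Function.HasTemperateGrowth (highFreqPow r : V → ℝ) := by
  -- With $b=(1+|\xi|^2)^{-1}$ one has $|\xi|^2=(1+|\xi|^2)(1-b)$, hence
  -- $|\xi|^r=(1+|\xi|^2)^{r/2}(1-b)^{r/2}$. The singular point $\xi=0$ is $b=1$, where $\chi$
  -- vanishes, while $|\xi|\ge1$ means $b\le1/2$, where $\chi=1$. So $\chi(b)(1-b)^{r/2}$ is smooth
  -- with compact support and may replace the last factor wherever $1-$`freqCutoff` is nonzero.
  let χ : ContDiffBump (0 : ℝ) := ⟨1 / 2, 3 / 4, by norm_num, by norm_num⟩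
  let h : ℝ → ℝ := fun b => χ b * (1 - b) ^ (r / 2)
  have hcs : HasCompactSupport h := χ.hasCompactSupport.mul_right
  have hsm : ContDiff ℝ ∞ h := by
    rw [contDiff_iff_contDiffAt]
    intro b
    by_cases hb : b = 1
    · have : h =ᶠ[𝓝 b] fun _ => 0 := by
        filter_upwards [(isOpen_lt continuous_const continuous_id).mem_nhds
          (show (3 / 4 : ℝ) < b by rw [hb]; norm_num)] with x hx
        have hx' : (3 / 4 : ℝ) < x := hx
        have : χ x = 0 := χ.zero_of_le_dist (by
          rw [Real.dist_eq, sub_zero]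
          exact hx'.le.trans (le_abs_self x))
        simp [h, this]
      exact contDiffAt_const.congr_of_eventuallyEq this
    · refine χ.contDiff.contDiffAt.mul ?_
      exact (contDiffAt_const.sub contDiffAt_id).rpow_const_of_ne (sub_ne_zero.2 (Ne.symm hb))
  have hG : Function.HasTemperateGrowth fun ξ : V => h ((1 + ‖ξ‖ ^ 2) ^ (-1 : ℝ)) :=
    (hcs.hasTemperateGrowth hsm).comp
      (Function.hasTemperateGrowth_one_add_norm_sq_rpow V (-1))
  have hF : Function.HasTemperateGrowth fun ξ : V => (2 * Real.pi) ^ r * ((1 - freqCutoff ξ) *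
      ((1 + ‖ξ‖ ^ 2) ^ (r / 2) * h ((1 + ‖ξ‖ ^ 2) ^ (-1 : ℝ)))) :=
    (Function.HasTemperateGrowth.const _).mul
      (((Function.HasTemperateGrowth.const 1).sub hasTemperateGrowth_freqCutoff).mul
        ((Function.hasTemperateGrowth_one_add_norm_sq_rpow V (r / 2)).mul hG))
  convert hF using 1
  funext ξ
  by_cases hξ : ‖ξ‖ ^ 2 ≤ 1
  · simp [highFreqPow, freqCutoff_eq_one hξ]
  · push Not at hξ
    have hb : (1 + ‖ξ‖ ^ 2) ^ (-1 : ℝ) ≤ 1 / 2 := by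
      rw [Real.rpow_neg_one, one_div]
      exact inv_anti₀ (by norm_num) (by linarith)
    have hb0 : 0 ≤ (1 + ‖ξ‖ ^ 2) ^ (-1 : ℝ) := by positivity
    have hχ : χ ((1 + ‖ξ‖ ^ 2) ^ (-1 : ℝ)) = 1 := χ.one_of_mem_closedBall (by
      rw [Metric.mem_closedBall, Real.dist_eq, sub_zero, abs_of_nonneg hb0]
      exact hb)
    have e : (1 + ‖ξ‖ ^ 2) ^ (r / 2) * h ((1 + ‖ξ‖ ^ 2) ^ (-1 : ℝ)) = ‖ξ‖ ^ r := by
      simp only [h, hχ, one_mul]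
      rw [← Real.mul_rpow (by positivity) (by linarith), Real.rpow_neg_one]
      have : (1 + ‖ξ‖ ^ 2) * (1 - (1 + ‖ξ‖ ^ 2)⁻¹) = ‖ξ‖ ^ 2 := by
        have : 1 + ‖ξ‖ ^ 2 ≠ 0 := by positivity
        field_simp
        ring
      rw [this, ← Real.rpow_natCast, ← Real.rpow_mul (norm_nonneg _)]
      congr 1
      push_cast
      ring
    rw [e, highFreqPow, Real.mul_rpow (by positivity) (norm_nonneg _)]
    ring

/-- The multiplier `(2π‖ξ‖)^r` localized to a dyadic annulus. -/
noncomputable def dyadicPow (r : ℝ) (ξ : V) : ℝ :=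
  (freqCutoff ξ - freqCutoff ((2 : ℝ) • ξ)) * (2 * Real.pi * ‖ξ‖) ^ r

/-- The cutoff at $\xi$ equals $1$ wherever the cutoff at $2\xi$ is nonzero, so the difference
factors as a product. The form on the right displays smoothness at the origin and compact support
for every real $r$. -/
theorem dyadicPow_eq (r : ℝ) (ξ : V) :
    dyadicPow r ξ = 2 ^ (-r) * (freqCutoff ξ * highFreqPow r ((2 : ℝ) • ξ)) := by
  have h1 : freqCutoff ξ * freqCutoff ((2 : ℝ) • ξ) = freqCutoff ((2 : ℝ) • ξ) := by
    have e : ‖(2 : ℝ) • ξ‖ ^ 2 = 4 * ‖ξ‖ ^ 2 := by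
      rw [norm_smul, mul_pow]; norm_num
    by_cases h : 2 ≤ ‖(2 : ℝ) • ξ‖ ^ 2
    · simp [freqCutoff_eq_zero h]
    · rw [freqCutoff_eq_one (ξ := ξ) (by linarith), one_mul]
  have h2 : (2 * Real.pi * ‖(2 : ℝ) • ξ‖) ^ r = 2 ^ r * (2 * Real.pi * ‖ξ‖) ^ r := by
    rw [← Real.mul_rpow (by norm_num) (by positivity), norm_smul]
    norm_num
    ring_nf
  have h3 : (2 : ℝ) ^ (-r) * 2 ^ r = 1 := by
    rw [← Real.rpow_add (by norm_num), neg_add_cancel, Real.rpow_zero]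
  rw [dyadicPow, highFreqPow, h2]
  conv_lhs => rw [← h1]
  have : ∀ A B P R R' : ℝ, R' * R = 1 →
      (A - A * B) * P = R' * (A * ((1 - B) * (R * P))) := by
    intro A B P R R' h
    calc (A - A * B) * P = (R' * R) * ((A - A * B) * P) := by rw [h, one_mul]
      _ = _ := by ring
  exact this _ _ _ _ _ h3

theorem contDiff_dyadicPow [ProperSpace V] (r : ℝ) : ContDiff ℝ ∞ (dyadicPow r : V → ℝ) := by
  rw [show (dyadicPow r : V → ℝ) = _ from funext (dyadicPow_eq r)]
  exact contDiff_const.mul (contDiff_freqCutoff.mul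
    ((hasTemperateGrowth_highFreqPow r).1.comp (contDiff_const_smul _)))

theorem hasCompactSupport_dyadicPow [ProperSpace V] (r : ℝ) :
    HasCompactSupport (dyadicPow r : V → ℝ) := by
  rw [show (dyadicPow r : V → ℝ) = _ from funext (dyadicPow_eq r)]
  exact (hasCompactSupport_freqCutoff.mul_right).mul_left

theorem tendsto_freqCutoff_pow_smul {ξ : V} (hξ : ξ ≠ 0) :
    Tendsto (fun k : ℕ => freqCutoff ((2 : ℝ) ^ k • ξ)) atTop (𝓝 0) := by
  have h : Tendsto (fun k : ℕ => (2 : ℝ) ^ k * ‖ξ‖) atTop atTop :=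
    (tendsto_pow_atTop_atTop_of_one_lt one_lt_two).atTop_mul_const (norm_pos_iff.2 hξ)
  refine tendsto_const_nhds.congr' ?_
  filter_upwards [h.eventually_ge_atTop 2] with k hk
  refine (freqCutoff_eq_zero ?_).symm
  rw [norm_smul, norm_pow, Real.norm_of_nonneg zero_le_two]
  nlinarith

theorem norm_one_sub_freqCutoff_le (ξ : V) : ‖((1 - freqCutoff ξ : ℝ) : ℂ)‖ ≤ 1 := by
  rw [Complex.norm_real, Real.norm_of_nonneg (by linarith [freqCutoff_le_one ξ])]
  linarith [freqCutoff_nonneg ξ]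

end FrequencyCutoff

/-! ### Uniform decay of truncated multipliers, and a Liouville theorem -/

section Multipliers

open Filter Topology Module

variable {V : Type*} [NormedAddCommGroup V] [InnerProductSpace ℝ V] [FiniteDimensional ℝ V]

/-- `HasCompactSupport.toSchwartzMap` for a real function, with values in `ℂ`. -/
noncomputable def toSchwartzComplex (φ : V → ℝ) (hc : HasCompactSupport φ) (hφ : ContDiff ℝ ∞ φ) :
    𝓢(V, ℂ) :=
  (hc.comp_left (g := Complex.ofReal) Complex.ofReal_zero).toSchwartzMap
    (Complex.ofRealCLM.contDiff.comp hφ)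

@[simp]
theorem toSchwartzComplex_apply (φ : V → ℝ) (hc : HasCompactSupport φ) (hφ : ContDiff ℝ ∞ φ)
    (x : V) : toSchwartzComplex φ hc hφ x = φ x := rfl

/-- Product of a Schwartz function with a real multiplier of temperate growth. -/
noncomputable def SchwartzMap.realMul (m : V → ℝ) (f : 𝓢(V, ℂ)) : 𝓢(V, ℂ) :=
  SchwartzMap.smulLeftCLM ℂ m f

theorem SchwartzMap.realMul_apply {m : V → ℝ} (hm : m.HasTemperateGrowth) (f : 𝓢(V, ℂ)) (x : V) :
    f.realMul m x = (m x : ℂ) * f x := by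
  rw [SchwartzMap.realMul, SchwartzMap.smulLeftCLM_apply_apply hm, Complex.real_smul]

theorem hasTemperateGrowth_comp_const_smul {m : V → ℝ} (hm : m.HasTemperateGrowth) (r : ℝ) :
    Function.HasTemperateGrowth fun ξ => m (r • ξ) :=
  hm.comp (r • ContinuousLinearMap.id ℝ V).hasTemperateGrowth

variable [MeasurableSpace V] [BorelSpace V]

theorem SchwartzMap.fourierInv_realMul_fourier {m : V → ℝ} (hm : m.HasTemperateGrowth)
    (f : 𝓢(V, ℂ)) :
    ((𝓕⁻ ((𝓕 f).realMul m) : 𝓢(V, ℂ)) : V → ℂ) =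
      𝓕⁻ (fun ξ => (m ξ : ℂ) * 𝓕 (f : V → ℂ) ξ) := by
  rw [SchwartzMap.fourierInv_coe]
  congr 1
  funext ξ
  rw [SchwartzMap.realMul_apply hm, SchwartzMap.fourier_coe]

theorem integrable_mul_fourier {m : V → ℝ} (hm : m.HasTemperateGrowth) (f : 𝓢(V, ℂ)) :
    Integrable (fun ξ => (m ξ : ℂ) * 𝓕 (f : V → ℂ) ξ) := by
  refine ((𝓕 f).realMul m).integrable.congr (Eventually.of_forall fun ξ => ?_)
  simp only [SchwartzMap.realMul_apply hm, SchwartzMap.fourier_coe]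

theorem fourierInv_add_apply {f g : V → ℂ} (hf : Integrable f) (hg : Integrable g) (x : V) :
    𝓕⁻ (fun ξ => f ξ + g ξ) x = 𝓕⁻ f x + 𝓕⁻ g x := by
  have key : ∀ {f : V → ℂ}, Integrable f →
      Integrable fun v => Real.fourierChar (inner ℝ v x) • f v := by
    intro f hf
    refine hf.norm.mono' ?_ (Eventually.of_forall fun ξ => by rw [Circle.norm_smul])
    exact ((Real.continuous_fourierChar.comp
      (continuous_id.inner continuous_const)).aestronglyMeasurable).smul hf.aestronglyMeasurable
  simp only [Real.fourierInv_eq, smul_add]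
  exact integral_add (key hf) (key hg)

theorem fourierInv_const_mul_apply (c : ℂ) (f : V → ℂ) (x : V) :
    𝓕⁻ (fun ξ => c * f ξ) x = c * 𝓕⁻ f x := by
  simp only [Real.fourierInv_eq, ← integral_const_mul]
  congr 1 with ξ
  rw [mul_smul_comm]

theorem norm_fourierInv_le (f : V → ℂ) (x : V) : ‖𝓕⁻ f x‖ ≤ ∫ ξ, ‖f ξ‖ := by
  rw [Real.fourierInv_eq]
  refine (norm_integral_le_integral_norm _).trans_eq ?_
  simp only [Circle.norm_smul]

theorem tendsto_fourierInv_of_dominated {F : ℕ → V → ℂ} {G : V → ℂ} {bound : V → ℝ}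
    (hm : ∀ k, AEStronglyMeasurable (F k) volume) (hb : Integrable bound)
    (h : ∀ k, ∀ᵐ ξ, ‖F k ξ‖ ≤ bound ξ)
    (hlim : ∀ᵐ ξ, Tendsto (fun k => F k ξ) atTop (𝓝 (G ξ))) (x : V) :
    Tendsto (fun k => 𝓕⁻ (F k) x) atTop (𝓝 (𝓕⁻ G x)) := by
  simp only [Real.fourierInv_eq]
  refine tendsto_integral_of_dominated_convergence bound (fun k => ?_) hb (fun k => ?_) ?_
  · exact ((Real.continuous_fourierChar.comp
      (continuous_id.inner continuous_const)).aestronglyMeasurable).smul (hm k)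
  · simpa only [Circle.norm_smul] using h k
  · filter_upwards [hlim] with ξ hξ
    exact hξ.const_smul _

/-- Truncated fractional Laplacians of a Schwartz function decay uniformly. -/
theorem exists_norm_fourierInv_highFreq_le (f : 𝓢(V, ℂ)) {b a : ℝ} (ha : 0 ≤ a)
    (hab : a < finrank ℝ V + b) :
    ∃ C : ℝ, ∀ (k : ℕ) (x : V),
      ‖𝓕⁻ (fun ξ => (((1 - freqCutoff ((2 : ℝ) ^ k • ξ)) * (2 * Real.pi * ‖ξ‖) ^ b : ℝ) : ℂ) *
        𝓕 (f : V → ℂ) ξ) x‖ ≤ C * (1 + ‖x‖) ^ (-a) := by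
  set n : ℝ := (finrank ℝ V : ℝ)
  set M := toSchwartzComplex _ (hasCompactSupport_dyadicPow (V := V) b) (contDiff_dyadicPow b)
  obtain ⟨C₁, hC₁, h₁⟩ := exists_norm_fourierInv_dilation_mul_fourier_le M f ha
  have hT := hasTemperateGrowth_highFreqPow (V := V) b
  obtain ⟨C₀, hC₀, h₀⟩ :=
    (𝓕⁻ ((𝓕 f).realMul (highFreqPow b))).exists_norm_le_one_add_norm_rpow_neg a
  rw [SchwartzMap.fourierInv_realMul_fourier hT] at h₀
  -- Passing from cutoff $k$ to $k+1$ adds the dyadic multiplier at $2^k\xi$ times $2^{-bk}$. Its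
  -- contribution has size $2^{-bk}\,2^{k(a-n)}=\rho^k$ in the weighted sup norm, and `hab` says
  -- $\rho<1$, so the increments sum geometrically.
  set ρ : ℝ := 2 ^ (a - n - b)
  have hρ0 : 0 ≤ ρ := by positivity
  have hρ1 : ρ < 1 := Real.rpow_lt_one_of_one_lt_of_neg one_lt_two (by linarith)
  set m : ℕ → V → ℝ := fun k ξ =>
    (1 - freqCutoff ((2 : ℝ) ^ k • ξ)) * (2 * Real.pi * ‖ξ‖) ^ b with hm
  have hpow : ∀ (k : ℕ) (ξ : V),
      (2 * Real.pi * ‖ξ‖) ^ b = 2 ^ (-(b * k)) * (2 * Real.pi * ‖(2 : ℝ) ^ k • ξ‖) ^ b := by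
    intro k ξ
    have e : 2 * Real.pi * ‖(2 : ℝ) ^ k • ξ‖ = 2 ^ (k : ℝ) * (2 * Real.pi * ‖ξ‖) := by
      rw [norm_smul, norm_pow, Real.norm_of_nonneg zero_le_two, Real.rpow_natCast]
      ring
    rw [e, Real.mul_rpow (x := 2 ^ (k : ℝ)) (by positivity) (by positivity),
      ← Real.rpow_mul (by norm_num),
      ← mul_assoc, ← Real.rpow_add (by norm_num), mul_comm (k : ℝ) b, neg_add_cancel,
      Real.rpow_zero, one_mul]
  have hmT : ∀ k, Function.HasTemperateGrowth (m k) := by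
    intro k
    have : m k = fun ξ => 2 ^ (-(b * k)) * highFreqPow b ((2 : ℝ) ^ k • ξ) := by
      funext ξ
      simp only [hm, highFreqPow]
      rw [hpow k ξ]
      ring
    rw [this]
    exact (Function.HasTemperateGrowth.const _).mul (hasTemperateGrowth_comp_const_smul hT _)
  have hstep : ∀ (k : ℕ) (x : V), 𝓕⁻ (fun ξ => (m (k + 1) ξ : ℂ) * 𝓕 (f : V → ℂ) ξ) x =
      𝓕⁻ (fun ξ => (m k ξ : ℂ) * 𝓕 (f : V → ℂ) ξ) x +
      ((2 ^ (-(b * k)) : ℝ) : ℂ) * 𝓕⁻ (fun ξ => M ((2 : ℝ) ^ k • ξ) * 𝓕 (f : V → ℂ) ξ) x := by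
    intro k x
    rw [← fourierInv_const_mul_apply, ← fourierInv_add_apply (integrable_mul_fourier (hmT k) f)]
    · refine congrFun (congrArg _ (funext fun ξ => ?_)) x
      rw [← mul_assoc, ← add_mul]
      congr 1
      rw [toSchwartzComplex_apply, dyadicPow, smul_smul, ← pow_succ']
      simp only [hm]
      rw [← Complex.ofReal_mul, ← Complex.ofReal_add, mul_left_comm, ← hpow k ξ]
      congr 1
      ring
    · have hd := hasTemperateGrowth_comp_const_smul ((hasCompactSupport_dyadicPow (V := V) b
        ).hasTemperateGrowth (contDiff_dyadicPow b)) ((2 : ℝ) ^ k)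
      exact (integrable_mul_fourier hd f).const_mul _
  have hbound : ∀ (k : ℕ) (x : V), ‖𝓕⁻ (fun ξ => (m k ξ : ℂ) * 𝓕 (f : V → ℂ) ξ) x‖ ≤
      (C₀ + C₁ * ∑ j ∈ Finset.range k, ρ ^ j) * (1 + ‖x‖) ^ (-a) := by
    intro k x
    induction k with
    | zero =>
      have e : m 0 = highFreqPow b := by
        funext ξ
        simp [hm, highFreqPow]
      simpa [e] using h₀ x
    | succ k ih =>
      rw [hstep]
      have h2 := h₁ ((2 : ℝ) ^ k) (one_le_pow₀ one_le_two) x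
      have h3 : (2 : ℝ) ^ (-(b * k)) * (((2 : ℝ) ^ k) ^ (a - n)) = ρ ^ k := by
        rw [← Real.rpow_natCast, ← Real.rpow_natCast, ← Real.rpow_mul (by norm_num),
          ← Real.rpow_add (by norm_num), ← Real.rpow_mul (by norm_num)]
        congr 1
        ring
      refine (norm_add_le _ _).trans ?_
      rw [norm_mul, Complex.norm_real, Real.norm_of_nonneg (by positivity), Finset.sum_range_succ]
      calc _ ≤ (C₀ + C₁ * ∑ j ∈ Finset.range k, ρ ^ j) * (1 + ‖x‖) ^ (-a) +
            2 ^ (-(b * k)) * (C₁ * ((2 : ℝ) ^ k) ^ (a - n) * (1 + ‖x‖) ^ (-a)) := by gcongr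
        _ = (C₀ + C₁ * ∑ j ∈ Finset.range k, ρ ^ j) * (1 + ‖x‖) ^ (-a) +
            (2 ^ (-(b * k)) * ((2 : ℝ) ^ k) ^ (a - n)) * C₁ * (1 + ‖x‖) ^ (-a) := by ring
        _ = _ := by rw [h3]; ring
  refine ⟨C₀ + C₁ * (1 - ρ)⁻¹, fun k x => (hbound k x).trans ?_⟩
  gcongr
  rw [← tsum_geometric_of_lt_one hρ0 hρ1]
  exact (summable_geometric_of_lt_one hρ0 hρ1).sum_le_tsum _ (fun j _ => by positivity)

/-- A function that is `o(1)` at infinity in a weak averaged sense and whose Fourier transform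
vanishes away from the origin is zero. -/
theorem ae_eq_zero_of_integral_mul_highFreq_eq_zero {v : V → ℝ} {a : ℝ} (ha : 0 ≤ a)
    (han : a < finrank ℝ V) (hv : Integrable (fun x => v x * (1 + ‖x‖) ^ (-a)))
    (h : ∀ φ : V → ℝ, ContDiff ℝ ∞ φ → HasCompactSupport φ → ∀ k : ℕ,
      ∫ x, (v x : ℂ) * 𝓕⁻ (fun ξ => ((1 - freqCutoff ((2 : ℝ) ^ k • ξ) : ℝ) : ℂ) *
        𝓕 (fun y => (φ y : ℂ)) ξ) x = 0) : v =ᵐ[volume] 0 := by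
  refine ae_eq_zero_of_integral_contDiff_smul_eq_zero
    (locallyIntegrable_of_integrable_mul_weight hv) fun φ hφ hc => ?_
  set f := toSchwartzComplex φ hc hφ
  set M := toSchwartzComplex _ (hasCompactSupport_freqCutoff (V := V)) contDiff_freqCutoff
  obtain ⟨C, hC, hbd⟩ := exists_norm_fourierInv_dilation_mul_fourier_le M f ha
  obtain ⟨D, hD, hfd⟩ := f.exists_norm_le_one_add_norm_rpow_neg a
  have hmT : ∀ k : ℕ, Function.HasTemperateGrowth fun ξ : V => freqCutoff ((2 : ℝ) ^ k • ξ) :=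
    fun k => hasTemperateGrowth_comp_const_smul hasTemperateGrowth_freqCutoff _
  have hmT' : ∀ k : ℕ, Function.HasTemperateGrowth
      fun ξ : V => 1 - freqCutoff ((2 : ℝ) ^ k • ξ) :=
    fun k => (Function.HasTemperateGrowth.const 1).sub (hmT k)
  -- Only the low-frequency part of $\varphi$ contributes to the pairing with $v$, since `h` kills
  -- the rest.
  have hsplit : ∀ (k : ℕ) (x : V), (φ x : ℂ) =
      𝓕⁻ (fun ξ => ((1 - freqCutoff ((2 : ℝ) ^ k • ξ) : ℝ) : ℂ) * 𝓕 (f : V → ℂ) ξ) x +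
      𝓕⁻ (fun ξ => M ((2 : ℝ) ^ k • ξ) * 𝓕 (f : V → ℂ) ξ) x := by
    intro k x
    refine Eq.trans ?_ (fourierInv_add_apply (integrable_mul_fourier (hmT' k) f)
      (integrable_mul_fourier (hmT k) f) x)
    have e : (fun ξ => ((1 - freqCutoff ((2 : ℝ) ^ k • ξ) : ℝ) : ℂ) * 𝓕 (f : V → ℂ) ξ +
        (freqCutoff ((2 : ℝ) ^ k • ξ) : ℂ) * 𝓕 (f : V → ℂ) ξ) = 𝓕 (f : V → ℂ) := by
      funext ξ
      rw [← add_mul]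
      push_cast
      ring
    rw [e, ← SchwartzMap.fourier_coe, ← SchwartzMap.fourierInv_coe,
      FourierTransform.fourierInv_fourier_eq]
    rfl
  -- The left side does not depend on $k$, while the right side decays geometrically because $a<n$.
  have hval : ∀ k : ℕ, ‖∫ x, (v x : ℂ) * φ x‖ ≤
      (∫ x, |v x * (1 + ‖x‖) ^ (-a)|) * C * ((2 : ℝ) ^ (a - finrank ℝ V)) ^ k := by
    intro k
    have hlow : ∀ x, ‖𝓕⁻ (fun ξ => M ((2 : ℝ) ^ k • ξ) * 𝓕 (f : V → ℂ) ξ) x‖ ≤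
        C * ((2 : ℝ) ^ (a - finrank ℝ V)) ^ k * (1 + ‖x‖) ^ (-a) := by
      intro x
      refine (hbd ((2 : ℝ) ^ k) (one_le_pow₀ one_le_two) x).trans_eq ?_
      rw [← Real.rpow_natCast, ← Real.rpow_natCast, ← Real.rpow_mul (by norm_num),
        ← Real.rpow_mul (by norm_num), mul_comm (k : ℝ)]
    have hlowm : AEStronglyMeasurable
        (𝓕⁻ (fun ξ => M ((2 : ℝ) ^ k • ξ) * 𝓕 (f : V → ℂ) ξ)) volume := by
      have := SchwartzMap.fourierInv_realMul_fourier (hmT k) f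
      have e : (fun ξ => M ((2 : ℝ) ^ k • ξ) * 𝓕 (f : V → ℂ) ξ) =
        (fun ξ => (freqCutoff ((2 : ℝ) ^ k • ξ) : ℂ) * 𝓕 (f : V → ℂ) ξ) := rfl
      rw [e, ← this]
      exact (SchwartzMap.continuous _).aestronglyMeasurable
    have hi := integrable_mul_of_norm_le_weight hv hlowm hlow
    have hiφ := integrable_mul_of_norm_le_weight hv f.continuous.aestronglyMeasurable hfd
    have e : ∫ x, (v x : ℂ) * φ x =
        ∫ x, (v x : ℂ) * 𝓕⁻ (fun ξ => M ((2 : ℝ) ^ k • ξ) * 𝓕 (f : V → ℂ) ξ) x := by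
      have h0 := h φ hφ hc k
      have h1 : (∫ x, (v x : ℂ) * φ x) -
          ∫ x, (v x : ℂ) * 𝓕⁻ (fun ξ => M ((2 : ℝ) ^ k • ξ) * 𝓕 (f : V → ℂ) ξ) x = _ :=
        (integral_sub hiφ hi).symm
      refine sub_eq_zero.1 (h1.trans ?_)
      rw [← h0]
      congr 1 with x
      rw [← mul_sub]
      congr 1
      rw [toSchwartzComplex_apply, hsplit k x, add_sub_cancel_right]
      rfl
    rw [e]
    refine (norm_integral_le_of_norm_le (hv.norm.const_mul
      (C * ((2 : ℝ) ^ (a - finrank ℝ V)) ^ k)) (Eventually.of_forall fun x => ?_)).trans_eq ?_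
    · rw [norm_mul, Complex.norm_real, norm_mul, Real.norm_of_nonneg (r := (1 + ‖x‖) ^ (-a))
        (by positivity)]
      nlinarith [hlow x, norm_nonneg (v x)]
    · rw [integral_const_mul]
      simp only [Real.norm_eq_abs]
      ring
  have hlim : Tendsto (fun k : ℕ => (∫ x, |v x * (1 + ‖x‖) ^ (-a)|) * C *
      ((2 : ℝ) ^ (a - finrank ℝ V)) ^ k) atTop (𝓝 0) := by
    have := (tendsto_pow_atTop_nhds_zero_of_lt_one (r := (2 : ℝ) ^ (a - finrank ℝ V))
      (by positivity) (Real.rpow_lt_one_of_one_lt_of_neg one_lt_two (by linarith))).const_mul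
      ((∫ x, |v x * (1 + ‖x‖) ^ (-a)|) * C)
    simpa using this
  have h0 : ‖∫ x, (v x : ℂ) * φ x‖ ≤ 0 := ge_of_tendsto' hlim hval
  have h1 : ∫ x, (v x : ℂ) * φ x = 0 := norm_le_zero_iff.1 h0
  have h2 : ((∫ x, φ x • v x : ℝ) : ℂ) = 0 := by
    rw [← integral_complex_ofReal, ← h1]
    congr 1 with x
    push_cast [smul_eq_mul]
    ring
  exact_mod_cast h2

end Multipliers

/-! ### Gamma integrals and Gaussian convolution -/

section Subordination

open Filter Topology Module Set

/-- Since $\kappa\ge0$, the norm of the integrand integrates in $b$ to the norm of $(\int\kappa)f$.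
Hypothesis `hi` is therefore already joint absolute integrability, and Fubini applies. -/
theorem integral_mul_eq_integral_integral_of_nonneg {X : Type*} [MeasurableSpace X]
    {μ : Measure X} [SFinite μ] {κ : X → ℝ → ℝ} (hκm : Measurable (Function.uncurry κ))
    (hκ0 : ∀ y b, 0 < b → 0 ≤ κ y b) (hκi : ∀ᵐ y ∂μ, IntegrableOn (κ y) (Ioi 0))
    {f : X → ℂ} (hf : AEStronglyMeasurable f μ)
    (hi : Integrable (fun y => ((∫ b in Ioi 0, κ y b : ℝ) : ℂ) * f y) μ) :
    ∫ y, ((∫ b in Ioi 0, κ y b : ℝ) : ℂ) * f y ∂μ =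
      ∫ b in Ioi 0, ∫ y, (κ y b : ℂ) * f y ∂μ := by
  have hm : AEStronglyMeasurable (fun p : X × ℝ => (κ p.1 p.2 : ℂ) * f p.1)
      (μ.prod (volume.restrict (Ioi 0))) := by
    refine AEStronglyMeasurable.mul ?_ hf.comp_fst
    exact (Complex.measurable_ofReal.comp hκm).aestronglyMeasurable
  have hI : Integrable (fun p : X × ℝ => (κ p.1 p.2 : ℂ) * f p.1)
      (μ.prod (volume.restrict (Ioi 0))) := by
    rw [integrable_prod_iff hm]
    refine ⟨?_, ?_⟩
    · filter_upwards [hκi] with y hy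
      exact hy.ofReal.mul_const _
    · refine hi.norm.congr (Eventually.of_forall fun y => ?_)
      have e : ∫ b in Ioi 0, ‖(κ y b : ℂ) * f y‖ = ∫ b in Ioi 0, κ y b * ‖f y‖ := by
        refine setIntegral_congr_fun measurableSet_Ioi fun b hb => ?_
        rw [norm_mul, Complex.norm_real, Real.norm_of_nonneg (hκ0 y b hb)]
      have e0 : 0 ≤ ∫ b in Ioi 0, κ y b := setIntegral_nonneg measurableSet_Ioi fun b hb => hκ0 y b hb
      beta_reduce
      rw [e, integral_mul_const, norm_mul, Complex.norm_real, Real.norm_of_nonneg e0]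
  rw [← integral_integral_swap hI]
  congr 1 with y
  rw [integral_mul_const, integral_complex_ofReal]

theorem integrableOn_rpow_mul_exp_neg_mul {a r : ℝ} (ha : 0 < a) (hr : 0 < r) :
    IntegrableOn (fun t : ℝ => t ^ (a - 1) * Real.exp (-(r * t))) (Ioi 0) := by
  have := integrableOn_rpow_mul_exp_neg_mul_rpow (s := a - 1) (by linarith) one_pos hr
  simpa using this

/-- The substitution $t\mapsto 1/t$, in the shape required by the change of variables $t\mapsto t^p$
at $p=-1$; it reduces the integrals with $e^{-r/t}$ to the Gamma integral. -/
theorem rpow_neg_sub_one_mul_exp_eq {a r : ℝ} {t : ℝ} (ht : 0 < t) :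
    t ^ (-a - 1) * Real.exp (-(r / t)) =
      (|(-1 : ℝ)| * t ^ ((-1 : ℝ) - 1)) •
        ((t ^ (-1 : ℝ)) ^ (a - 1) * Real.exp (-(r * t ^ (-1 : ℝ)))) := by
  rw [smul_eq_mul, abs_neg, abs_one, one_mul, ← mul_assoc, ← Real.rpow_mul ht.le,
    ← Real.rpow_add ht, Real.rpow_neg_one, ← div_eq_mul_inv]
  congr 2
  ring

theorem integrableOn_rpow_neg_mul_exp_neg_div {a r : ℝ} (ha : 0 < a) (hr : 0 < r) :
    IntegrableOn (fun t : ℝ => t ^ (-a - 1) * Real.exp (-(r / t))) (Ioi 0) :=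
  ((integrableOn_Ioi_comp_rpow_iff _ (by norm_num : (-1 : ℝ) ≠ 0)).2
    (integrableOn_rpow_mul_exp_neg_mul ha hr)).congr_fun
    (fun _ ht => (rpow_neg_sub_one_mul_exp_eq ht).symm) measurableSet_Ioi

theorem integral_rpow_neg_mul_exp_neg_div {a r : ℝ} (ha : 0 < a) (hr : 0 < r) :
    ∫ t in Ioi 0, t ^ (-a - 1) * Real.exp (-(r / t)) = (1 / r) ^ a * Real.Gamma a := by
  rw [← Real.integral_rpow_mul_exp_neg_mul_Ioi ha hr, ← integral_comp_rpow_Ioi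
    (fun t => t ^ (a - 1) * Real.exp (-(r * t))) (by norm_num : (-1 : ℝ) ≠ 0)]
  exact setIntegral_congr_fun measurableSet_Ioi fun t ht => rpow_neg_sub_one_mul_exp_eq ht

variable {V : Type*} [NormedAddCommGroup V] [InnerProductSpace ℝ V] [FiniteDimensional ℝ V]
  [MeasurableSpace V] [BorelSpace V]

theorem integral_gaussian_conv_fourierInv {F : V → ℂ} (hF : Integrable F) {b : ℝ} (hb : 0 < b)
    (x : V) : ∫ y, ((Real.exp (-(‖x - y‖ ^ 2 * b)) : ℝ) : ℂ) * 𝓕⁻ F y =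
      ∫ ξ, (((Real.pi / b) ^ ((finrank ℝ V : ℝ) / 2) *
        Real.exp (-(Real.pi ^ 2 * ‖ξ‖ ^ 2 / b)) : ℝ) : ℂ) *
          (Real.fourierChar (inner ℝ ξ x) • F ξ) := by
  set ψ : V → ℂ := fun v => Complex.exp (-(b : ℂ) * ‖v‖ ^ 2) with hψ
  have hb' : 0 < (b : ℂ).re := by simpa using hb
  have hψi : Integrable ψ := by
    simpa [hψ] using GaussianFourier.integrable_cexp_neg_mul_sq_norm_add (V := V) hb' 0 0
  have h := fourierInv_mul_fourier_eq_integral hF hψi x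
  rw [← integral_sub_left_eq_self _ volume x] at h
  have e1 : ∀ y, ((Real.exp (-(‖x - y‖ ^ 2 * b)) : ℝ) : ℂ) * 𝓕⁻ F y =
      ψ (x - y) * 𝓕⁻ F (x - (x - y)) := by
    intro y
    rw [sub_sub_cancel, hψ]
    push_cast
    congr 2
    ring
  simp only [e1]
  rw [← h, Real.fourierInv_eq]
  congr 1 with ξ
  rw [fourier_gaussian_innerProductSpace hb']
  have e2 : ((Real.pi : ℂ) / b) ^ ((finrank ℝ V : ℂ) / 2) =
      (((Real.pi / b) ^ ((finrank ℝ V : ℝ) / 2) : ℝ) : ℂ) := by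
    rw [Complex.ofReal_cpow (by positivity)]
    push_cast
    rfl
  have e3 : Complex.exp (-(Real.pi : ℂ) ^ 2 * ‖ξ‖ ^ 2 / b) =
      ((Real.exp (-(Real.pi ^ 2 * ‖ξ‖ ^ 2 / b)) : ℝ) : ℂ) := by
    push_cast
    congr 1
    ring
  rw [e2, e3, Circle.smul_def, Circle.smul_def, smul_eq_mul, smul_eq_mul]
  push_cast
  ring

end Subordination

/-! ### The Riesz kernel as a Fourier multiplier -/

section RieszFourier

open Filter Topology Set

variable {d : ℕ} {α : ℝ}

/-- The Gamma integral writes $|z|^{\alpha-d}$ as a superposition of Gaussians. The numerator of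
$A_\alpha$ is the Gamma value it produces, so only the denominator of $A_\alpha$ is left as a
factor. -/
theorem rieszKernel_eq_integral (hα : 0 < α) (hαd : α < d) {z : EuclideanSpace ℝ (Fin d)}
    (hz : z ≠ 0) :
    rieszKernel d α z * (Real.pi ^ ((d : ℝ) / 2) * 2 ^ α * Real.Gamma (α / 2)) =
      ∫ b in Ioi 0, b ^ ((d - α) / 2 - 1) * Real.exp (-(‖z‖ ^ 2 * b)) := by
  have hz' : 0 < ‖z‖ := norm_pos_iff.2 hz
  have h2 : 0 < Real.Gamma (α / 2) := Real.Gamma_pos_of_pos (by linarith)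
  rw [Real.integral_rpow_mul_exp_neg_mul_Ioi (by linarith) (by positivity), rieszKernel]
  have e : (1 / ‖z‖ ^ 2) ^ ((d - α) / 2) = ‖z‖ ^ (α - d) := by
    rw [one_div, Real.inv_rpow (by positivity), ← Real.rpow_natCast, ← Real.rpow_mul hz'.le,
      ← Real.rpow_neg hz'.le]
    congr 1
    push_cast
    ring
  rw [e]
  have h3 : Real.pi ^ ((d : ℝ) / 2) * 2 ^ α * Real.Gamma (α / 2) ≠ 0 := by positivity
  field_simp

/-- The same superposition applied to the Fourier transforms of the Gaussians. It yields the same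
factor as `rieszKernel_eq_integral`, which is why $A_\alpha$ is the right normalization. -/
theorem integral_rpow_mul_gaussian_eq (hα : 0 < α) {ξ : EuclideanSpace ℝ (Fin d)}
    (hξ : ξ ≠ 0) :
    ∫ b in Ioi 0, b ^ ((d - α) / 2 - 1) * ((Real.pi / b) ^ ((d : ℝ) / 2) *
        Real.exp (-(Real.pi ^ 2 * ‖ξ‖ ^ 2 / b))) =
      (2 * Real.pi * ‖ξ‖) ^ (-α) * (Real.pi ^ ((d : ℝ) / 2) * 2 ^ α * Real.Gamma (α / 2)) ∧
    IntegrableOn (fun b => b ^ ((d - α) / 2 - 1) * ((Real.pi / b) ^ ((d : ℝ) / 2) *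
        Real.exp (-(Real.pi ^ 2 * ‖ξ‖ ^ 2 / b)))) (Ioi 0) := by
  have hξ' : 0 < ‖ξ‖ := norm_pos_iff.2 hξ
  have hr : 0 < Real.pi ^ 2 * ‖ξ‖ ^ 2 := by positivity
  have e : ∀ b ∈ Ioi (0 : ℝ), Real.pi ^ ((d : ℝ) / 2) *
      (b ^ (-(α / 2) - 1) * Real.exp (-(Real.pi ^ 2 * ‖ξ‖ ^ 2 / b))) =
      b ^ ((d - α) / 2 - 1) * ((Real.pi / b) ^ ((d : ℝ) / 2) *
        Real.exp (-(Real.pi ^ 2 * ‖ξ‖ ^ 2 / b))) := by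
    intro b hb
    have hb' : 0 < b := hb
    rw [Real.div_rpow Real.pi_pos.le hb'.le, div_eq_mul_inv (_ ^ _), ← Real.rpow_neg hb'.le]
    have : b ^ (-(α / 2) - 1) = b ^ ((d - α) / 2 - 1) * b ^ (-((d : ℝ) / 2)) := by
      rw [← Real.rpow_add hb']
      congr 1
      ring
    rw [this]
    ring
  constructor
  · rw [← setIntegral_congr_fun measurableSet_Ioi e, integral_const_mul,
      integral_rpow_neg_mul_exp_neg_div (by linarith) hr]
    have e2 : (1 / (Real.pi ^ 2 * ‖ξ‖ ^ 2)) ^ (α / 2) = (2 * Real.pi * ‖ξ‖) ^ (-α) * 2 ^ α := by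
      have e3 : ((2 : ℕ) : ℝ) * (α / 2) = α := by push_cast; ring
      have hpξ : 0 < Real.pi * ‖ξ‖ := by positivity
      rw [one_div, Real.inv_rpow (by positivity), ← mul_pow, ← Real.rpow_natCast,
        ← Real.rpow_mul hpξ.le, e3, mul_assoc 2, Real.mul_rpow (by norm_num) hpξ.le,
        Real.rpow_neg (by norm_num), Real.rpow_neg hpξ.le]
      have : (2 : ℝ) ^ α ≠ 0 := by positivity
      field_simp
    rw [e2]
    ring
  · have h := (integrableOn_rpow_neg_mul_exp_neg_div (half_pos hα) hr).const_mul
      (Real.pi ^ ((d : ℝ) / 2))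
    exact IntegrableOn.congr_fun h e measurableSet_Ioi

/-- The Riesz potential acts on the Fourier side as multiplication by `(2π‖ξ‖)^(-α)`. -/
theorem integral_rieszKernel_mul_fourierInv (hα : 0 < α) (hαd : α < d)
    {F : EuclideanSpace ℝ (Fin d) → ℂ} (hF : Integrable F)
    (hG : Integrable fun ξ => (((2 * Real.pi * ‖ξ‖) ^ (-α) : ℝ) : ℂ) * F ξ)
    (hm : AEStronglyMeasurable (𝓕⁻ F) volume) (x : EuclideanSpace ℝ (Fin d))
    (hK : Integrable fun y => (rieszKernel d α (x - y) : ℂ) * 𝓕⁻ F y) :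
    ∫ y, (rieszKernel d α (x - y) : ℂ) * 𝓕⁻ F y =
      𝓕⁻ (fun ξ => (((2 * Real.pi * ‖ξ‖) ^ (-α) : ℝ) : ℂ) * F ξ) x := by
  have hd0 : 0 < d := by
    have : (0 : ℝ) < d := hα.trans hαd
    exact_mod_cast this
  have : Nonempty (Fin d) := ⟨⟨0, hd0⟩⟩
  set c : ℝ := Real.pi ^ ((d : ℝ) / 2) * 2 ^ α * Real.Gamma (α / 2) with hc
  have hc0 : 0 < c := by
    have : 0 < Real.Gamma (α / 2) := Real.Gamma_pos_of_pos (by linarith)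
    positivity
  have hcC : (c : ℂ) ≠ 0 := by exact_mod_cast hc0.ne'
  set κ₁ : EuclideanSpace ℝ (Fin d) → ℝ → ℝ := fun y b => b ^ ((d - α) / 2 - 1) * Real.exp (-(‖x - y‖ ^ 2 * b)) with hκ₁
  set κ₂ : EuclideanSpace ℝ (Fin d) → ℝ → ℝ := fun ξ b => b ^ ((d - α) / 2 - 1) * ((Real.pi / b) ^ ((d : ℝ) / 2) *
        Real.exp (-(Real.pi ^ 2 * ‖ξ‖ ^ 2 / b))) with hκ₂
  have hne : ∀ z : EuclideanSpace ℝ (Fin d), ∀ᵐ y ∂(volume : Measure (EuclideanSpace ℝ (Fin d))), y ≠ z := fun z => by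
    simp [ae_iff, measure_singleton]
  have h1 : ∀ᵐ y ∂(volume : Measure (EuclideanSpace ℝ (Fin d))), ((∫ b in Ioi 0, κ₁ y b : ℝ) : ℂ) * 𝓕⁻ F y =
      (c : ℂ) * ((rieszKernel d α (x - y) : ℂ) * 𝓕⁻ F y) := by
    filter_upwards [hne x] with y hy
    rw [← rieszKernel_eq_integral hα hαd (sub_ne_zero.2 hy.symm), ← hc]
    push_cast
    ring
  set H : EuclideanSpace ℝ (Fin d) → ℂ := fun ξ => Real.fourierChar (inner ℝ ξ x) • F ξ with hH
  have hchar : AEStronglyMeasurable (fun ξ : EuclideanSpace ℝ (Fin d) => Real.fourierChar (inner ℝ ξ x)) volume :=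
    (Real.continuous_fourierChar.comp (continuous_id.inner continuous_const)).aestronglyMeasurable
  have h2 : ∀ᵐ ξ ∂(volume : Measure (EuclideanSpace ℝ (Fin d))), ((∫ b in Ioi 0, κ₂ ξ b : ℝ) : ℂ) * H ξ =
      (c : ℂ) * (Real.fourierChar (inner ℝ ξ x) •
        ((((2 * Real.pi * ‖ξ‖) ^ (-α) : ℝ) : ℂ) * F ξ)) := by
    filter_upwards [hne 0] with ξ hξ
    rw [(integral_rpow_mul_gaussian_eq hα hξ).1, ← hc, hH]
    simp only [Circle.smul_def, smul_eq_mul]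
    push_cast
    ring
  have s1 := integral_mul_eq_integral_integral_of_nonneg (μ := (volume : Measure (EuclideanSpace ℝ (Fin d)))) (κ := κ₁)
    (f := 𝓕⁻ F) (by fun_prop) (fun y b hb => by positivity) (by
      filter_upwards [hne x] with y hy
      have : 0 < ‖x - y‖ := norm_pos_iff.2 (sub_ne_zero.2 hy.symm)
      exact integrableOn_rpow_mul_exp_neg_mul (by linarith) (by positivity)) hm
    ((hK.const_mul (c : ℂ)).congr (h1.mono fun y hy => hy.symm))
  have hGx : Integrable fun ξ => Real.fourierChar (inner ℝ ξ x) •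
      ((((2 * Real.pi * ‖ξ‖) ^ (-α) : ℝ) : ℂ) * F ξ) := by
    refine hG.norm.mono' ?_ (Eventually.of_forall fun ξ => by rw [Circle.norm_smul])
    exact hchar.smul hG.aestronglyMeasurable
  have s2 := integral_mul_eq_integral_integral_of_nonneg (μ := (volume : Measure (EuclideanSpace ℝ (Fin d)))) (κ := κ₂)
    (f := H) (by fun_prop) (fun y b hb => by positivity) (by
      filter_upwards [hne 0] with ξ hξ
      exact (integral_rpow_mul_gaussian_eq hα hξ).2) (hchar.smul hF.aestronglyMeasurable)
    ((hGx.const_mul (c : ℂ)).congr (h2.mono fun y hy => hy.symm))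
  rw [integral_congr_ae h1, integral_const_mul] at s1
  rw [integral_congr_ae h2, integral_const_mul, ← Real.fourierInv_eq] at s2
  -- Multiplied by $c$, both sides are integrals over the Gaussian parameter $b$; it remains to
  -- compare the integrands, which is the convolution theorem for a single Gaussian.
  refine mul_left_cancel₀ hcC (s1.trans (Eq.trans ?_ s2.symm))
  refine setIntegral_congr_fun measurableSet_Ioi fun b hb => ?_
  have h3 := integral_gaussian_conv_fourierInv hF hb x
  rw [show Module.finrank ℝ (EuclideanSpace ℝ (Fin d)) = d from finrank_euclideanSpace_fin] at h3
  simp only [hκ₁, hκ₂, Complex.ofReal_mul, mul_assoc] at h3 ⊢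
  rw [integral_const_mul, integral_const_mul, h3]

end RieszFourier

/-! ### Plancherel for integrable square-integrable functions -/

section FourierL2

open Filter Topology Module Set

variable {V : Type*} [NormedAddCommGroup V] [InnerProductSpace ℝ V] [FiniteDimensional ℝ V]
  [MeasurableSpace V] [BorelSpace V]

theorem integral_fourierInv_mul_eq_flip {f g : V → ℂ} (hf : Integrable f) (hg : Integrable g) :
    ∫ ξ, 𝓕⁻ f ξ * g ξ = ∫ x, f x * 𝓕⁻ g x := by
  have h := integral_fourier_mul_eq_flip hf.comp_neg hg
  rw [← integral_neg_eq_self] at h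
  rw [Real.fourierInv_eq_fourier_comp_neg]
  rw [← integral_neg_eq_self]
  refine h.trans ?_
  rw [← integral_neg_eq_self]
  congr 1 with x
  rw [neg_neg, fourier_neg_eq_fourierInv]

theorem continuous_fourierInv {f : V → ℂ} (hf : Integrable f) : Continuous (𝓕⁻ f) := by
  rw [Real.fourierInv_eq_fourier_comp_neg]
  exact VectorFourier.fourierIntegral_continuous Real.continuous_fourierChar
    (by exact continuous_inner) hf.comp_neg

/-- The $L^2$ inverse transform is an isometry. It agrees almost everywhere with the integral
formula because the two define the same distribution on test functions. -/
theorem memLp_fourierInv_and_eLpNorm_eq {g : V → ℂ} (hg : Integrable g) (hg2 : MemLp g 2) :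
    MemLp (𝓕⁻ g) 2 ∧ eLpNorm (𝓕⁻ g) 2 volume = eLpNorm g 2 volume := by
  set G := hg2.toLp g
  set H : Lp ℂ 2 (volume : Measure V) := 𝓕⁻ G
  have hHG : ‖H‖ = ‖G‖ := by
    rw [← Lp.norm_fourier_eq H, FourierTransform.fourier_fourierInv_eq]
  have hdist := Lp.fourierInv_toTemperedDistribution_eq G
  have hae : (H : V → ℂ) =ᵐ[volume] 𝓕⁻ g := by
    refine ae_eq_of_integral_contDiff_smul_eq ((Lp.memLp H).locallyIntegrable one_le_two)
      (continuous_fourierInv hg).locallyIntegrable fun φ hφ hc => ?_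
    set f := toSchwartzComplex φ hc hφ
    have h1 : (𝓕⁻ (G : 𝓢'(V, ℂ))) f = (H : 𝓢'(V, ℂ)) f := by rw [hdist]
    rw [TemperedDistribution.fourierInv_apply, Lp.toTemperedDistribution_apply,
      Lp.toTemperedDistribution_apply] at h1
    have e1 : ∫ x, φ x • H x = ∫ x, f x • H x := by
      congr 1 with x
    have e2 : ∫ x, φ x • 𝓕⁻ g x = ∫ x, f x * 𝓕⁻ g x := by
      congr 1 with x
    rw [e1, e2, ← h1, ← integral_fourierInv_mul_eq_flip f.integrable hg]
    refine integral_congr_ae ?_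
    filter_upwards [hg2.coeFn_toLp] with x hx
    rw [hx, smul_eq_mul, SchwartzMap.fourierInv_coe]
  refine ⟨(memLp_congr_ae hae).1 (Lp.memLp H), ?_⟩
  rw [← eLpNorm_congr_ae hae, ← eLpNorm_congr_ae hg2.coeFn_toLp]
  have := congrArg ENNReal.ofReal hHG
  rwa [Lp.norm_def, Lp.norm_def, ENNReal.ofReal_toReal (Lp.eLpNorm_ne_top _),
    ENNReal.ofReal_toReal (Lp.eLpNorm_ne_top _)] at this

end FourierL2

/-! ### Power weights in frequency -/

section PowerWeights

open Filter Topology Module Set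

variable {V : Type*} [NormedAddCommGroup V] [InnerProductSpace ℝ V] [FiniteDimensional ℝ V]
  [MeasurableSpace V] [BorelSpace V]

theorem measurable_two_pi_norm_rpow (r : ℝ) :
    Measurable fun ξ : V => (2 * Real.pi * ‖ξ‖) ^ r :=
  (measurable_norm.const_mul _).pow_const _

theorem integrableOn_ball_two_pi_norm_rpow (hV : 1 ≤ finrank ℝ V) {r : ℝ}
    (hr : -(finrank ℝ V : ℝ) < r) (R : ℝ) :
    IntegrableOn (fun ξ : V => (2 * Real.pi * ‖ξ‖) ^ r) (Metric.ball 0 R) := by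
  have h := (integrableOn_ball_norm_rpow_sub (V := V) (μ := volume)
    (α := r + finrank ℝ V) (by linarith) hV R).const_mul ((2 * Real.pi) ^ r)
  refine IntegrableOn.congr_fun h (fun ξ _ => ?_) Metric.isOpen_ball.measurableSet
  rw [Real.mul_rpow (by positivity) (norm_nonneg _), add_sub_cancel_right]

/-- On the unit ball $|\xi|^{2r}$ is integrable because $2r>-n$; outside it the Schwartz decay
absorbs any power. -/
theorem SchwartzMap.memLp_two_pi_norm_rpow_mul (hV : 1 ≤ finrank ℝ V) {r : ℝ}
    (hr : -(finrank ℝ V : ℝ) < 2 * r) (φ : 𝓢(V, ℂ)) :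
    MemLp (fun ξ => (((2 * Real.pi * ‖ξ‖) ^ r : ℝ) : ℂ) * φ ξ) 2 := by
  have hm : AEStronglyMeasurable (fun ξ => (((2 * Real.pi * ‖ξ‖) ^ r : ℝ) : ℂ) * φ ξ) volume :=
    ((Complex.measurable_ofReal.comp (measurable_two_pi_norm_rpow r)).mul
      φ.continuous.measurable).aestronglyMeasurable
  rw [memLp_two_iff_integrable_sq_norm hm]
  have e : ∀ ξ : V, ‖(((2 * Real.pi * ‖ξ‖) ^ r : ℝ) : ℂ) * φ ξ‖ ^ 2 =
      (2 * Real.pi * ‖ξ‖) ^ (2 * r) * ‖φ ξ‖ ^ 2 := by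
    intro ξ
    rw [norm_mul, Complex.norm_real, Real.norm_of_nonneg (by positivity), mul_pow,
      ← Real.rpow_natCast ((2 * Real.pi * ‖ξ‖) ^ r), ← Real.rpow_mul (by positivity), mul_comm 2 r]
    norm_num
  have hm2 : AEStronglyMeasurable (fun ξ => ‖(((2 * Real.pi * ‖ξ‖) ^ r : ℝ) : ℂ) * φ ξ‖ ^ 2)
    volume := hm.norm.pow 2
  obtain ⟨C, hC, hφ⟩ := φ.exists_norm_le_one_add_norm_rpow_neg 0
  have hφ' : ∀ ξ, ‖φ ξ‖ ≤ C := fun ξ => by simpa using hφ ξ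
  have h1 : IntegrableOn (fun ξ => ‖(((2 * Real.pi * ‖ξ‖) ^ r : ℝ) : ℂ) * φ ξ‖ ^ 2)
      (Metric.ball 0 1) := by
    refine ((integrableOn_ball_two_pi_norm_rpow hV hr 1).mul_const (C ^ 2)).mono'
      hm2.restrict (Eventually.of_forall fun ξ => ?_)
    rw [Real.norm_of_nonneg (by positivity), e]
    gcongr
    exact hφ' ξ
  have h2 : IntegrableOn (fun ξ => ‖(((2 * Real.pi * ‖ξ‖) ^ r : ℝ) : ℂ) * φ ξ‖ ^ 2)
      (Metric.ball 0 1)ᶜ := by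
    have hi := ((φ.integrable_norm_mul_one_add_norm_rpow |2 * r|).const_mul
      ((2 * Real.pi) ^ (2 * r) * C)).integrableOn (s := (Metric.ball 0 1)ᶜ)
    refine Integrable.mono' hi hm2.restrict ?_
    filter_upwards [ae_restrict_mem Metric.isOpen_ball.measurableSet.compl] with ξ hξ
    have hξ1 : 1 ≤ ‖ξ‖ := by simpa using hξ
    rw [Real.norm_of_nonneg (by positivity), e, Real.mul_rpow (by positivity) (norm_nonneg _)]
    have h3 : ‖ξ‖ ^ (2 * r) ≤ (1 + ‖ξ‖) ^ |2 * r| :=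
      (Real.rpow_le_rpow_of_exponent_le hξ1 (le_abs_self _)).trans
        (Real.rpow_le_rpow (norm_nonneg _) (by linarith) (abs_nonneg _))
    have h4 : ‖φ ξ‖ ^ 2 ≤ C * ‖φ ξ‖ := by
      rw [sq]
      exact mul_le_mul_of_nonneg_right (hφ' ξ) (norm_nonneg _)
    calc (2 * Real.pi) ^ (2 * r) * ‖ξ‖ ^ (2 * r) * ‖φ ξ‖ ^ 2
        ≤ (2 * Real.pi) ^ (2 * r) * (1 + ‖ξ‖) ^ |2 * r| * (C * ‖φ ξ‖) := by gcongr
      _ = _ := by ring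
  have := h1.union h2
  rwa [union_compl_self, integrableOn_univ] at this

theorem setIntegral_ball_two_pi_norm_rpow (r : ℝ) {A : ℝ} (hA : 0 < A) :
    ∫ ξ in Metric.ball (0 : V) A, (2 * Real.pi * ‖ξ‖) ^ r =
      A ^ (r + finrank ℝ V) * ∫ ξ in Metric.ball (0 : V) 1, (2 * Real.pi * ‖ξ‖) ^ r := by
  have h := Measure.setIntegral_comp_smul_of_pos (volume : Measure V)
    (fun ξ => (2 * Real.pi * ‖ξ‖) ^ r) (Metric.ball 0 1) hA
  rw [smul_unitBall_of_pos hA] at h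
  have e : ∀ ξ : V, (2 * Real.pi * ‖A • ξ‖) ^ r = A ^ r * (2 * Real.pi * ‖ξ‖) ^ r := by
    intro ξ
    rw [norm_smul, Real.norm_of_nonneg hA.le, ← Real.mul_rpow hA.le (by positivity)]
    congr 1
    ring
  simp only [e, integral_const_mul, smul_eq_mul] at h
  have hAn : (A ^ finrank ℝ V) ≠ 0 := by positivity
  rw [Real.rpow_add hA, Real.rpow_natCast, mul_right_comm, h]
  field_simp

/-- Cauchy–Schwarz for $|g|=|\xi|^{-s}\cdot|\xi|^s|g|$; by scaling, $\int_{|\xi|<A}|\xi|^{-2s}$ is a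
multiple of $A^{n-2s}$, which is finite because $2s<n$. -/
theorem exists_lintegral_ball_le_eLpNorm (hV : 1 ≤ finrank ℝ V) {s : ℝ}
    (hs : 2 * s < finrank ℝ V) :
    ∃ B : ℝ, 0 < B ∧ ∀ g : V → ℂ, AEStronglyMeasurable g volume → ∀ A : ℝ, 0 < A →
      ∫⁻ ξ in Metric.ball 0 A, ‖g ξ‖ₑ ≤ ENNReal.ofReal (B * A ^ (((finrank ℝ V : ℝ) - 2 * s) / 2)) *
        eLpNorm (fun ξ => (((2 * Real.pi * ‖ξ‖) ^ s : ℝ) : ℂ) * g ξ) 2 volume := by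
  set n : ℝ := (finrank ℝ V : ℝ) with hn
  set J : ℝ := ∫ ξ in Metric.ball (0 : V) 1, (2 * Real.pi * ‖ξ‖) ^ (-(2 * s)) with hJ
  have hJ0 : 0 ≤ J := setIntegral_nonneg Metric.isOpen_ball.measurableSet fun ξ _ => by positivity
  have : Nontrivial V := Module.nontrivial_of_finrank_pos (R := ℝ) (by omega)
  -- The summand $1$ only makes the constant strictly positive, so that it can be divided by later.
  refine ⟨J ^ (1 / 2 : ℝ) + 1, by positivity, fun g hg A hA => ?_⟩
  have hne : ∀ᵐ ξ ∂(volume.restrict (Metric.ball (0 : V) A)), ξ ≠ 0 :=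
    ae_restrict_of_ae (by simp [ae_iff, measure_singleton])
  set w : V → ℝ≥0∞ := fun ξ => ENNReal.ofReal ((2 * Real.pi * ‖ξ‖) ^ (-s)) with hw
  set h : V → ℝ≥0∞ := fun ξ => ‖(((2 * Real.pi * ‖ξ‖) ^ s : ℝ) : ℂ) * g ξ‖ₑ with hh
  have hhm : AEMeasurable h volume := ((Complex.measurable_ofReal.comp
    (measurable_two_pi_norm_rpow s)).aestronglyMeasurable.mul hg).enorm
  have e1 : ∫⁻ ξ in Metric.ball 0 A, ‖g ξ‖ₑ = ∫⁻ ξ in Metric.ball 0 A, (w * h) ξ := by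
    refine lintegral_congr_ae ?_
    filter_upwards [hne] with ξ hξ
    have hξ' : 0 < 2 * Real.pi * ‖ξ‖ := by positivity
    simp only [Pi.mul_apply, hw, hh]
    rw [enorm_mul, ← mul_assoc, ← ofReal_norm (((2 * Real.pi * ‖ξ‖) ^ s : ℝ) : ℂ),
      Complex.norm_real, Real.norm_of_nonneg (by positivity),
      ← ENNReal.ofReal_mul (by positivity), ← Real.rpow_add hξ', neg_add_cancel, Real.rpow_zero,
      ENNReal.ofReal_one, one_mul]
  have e2 : ∫⁻ ξ in Metric.ball 0 A, w ξ ^ (2 : ℝ) = ENNReal.ofReal (A ^ (n - 2 * s) * J) := by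
    have : A ^ (n - 2 * s) * J = ∫ ξ in Metric.ball (0 : V) A, (2 * Real.pi * ‖ξ‖) ^ (-(2 * s)) := by
      rw [setIntegral_ball_two_pi_norm_rpow _ hA, hJ, hn]
      ring_nf
    rw [this, ofReal_integral_eq_lintegral_ofReal
      (integrableOn_ball_two_pi_norm_rpow hV (by linarith) A)
      (Eventually.of_forall fun ξ => by positivity)]
    refine lintegral_congr fun ξ => ?_
    rw [hw, ENNReal.ofReal_rpow_of_nonneg (by positivity) (by norm_num),
      ← Real.rpow_mul (by positivity)]
    ring_nf
  have e3 : (∫⁻ ξ in Metric.ball 0 A, h ξ ^ (2 : ℝ)) ^ (1 / 2 : ℝ) ≤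
      eLpNorm (fun ξ => (((2 * Real.pi * ‖ξ‖) ^ s : ℝ) : ℂ) * g ξ) 2 volume := by
    rw [eLpNorm_eq_lintegral_rpow_enorm_toReal (by norm_num) (by norm_num)]
    simp only [ENNReal.toReal_ofNat]
    gcongr
    exact Measure.restrict_le_self
  have hH := ENNReal.lintegral_mul_le_Lp_mul_Lq (volume.restrict (Metric.ball (0 : V) A))
    Real.HolderConjugate.two_two (f := w) (g := h)
    ((measurable_two_pi_norm_rpow (-s)).ennreal_ofReal.aemeasurable) hhm.restrict
  rw [e1]
  refine hH.trans ?_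
  rw [e2, ENNReal.ofReal_rpow_of_nonneg (by positivity) (by norm_num)]
  refine mul_le_mul' (ENNReal.ofReal_le_ofReal ?_) e3
  rw [Real.mul_rpow (by positivity) hJ0, ← Real.rpow_mul hA.le, mul_one_div, mul_comm]
  have : 0 ≤ A ^ ((n - 2 * s) / 2) := by positivity
  nlinarith

end PowerWeights

/-! ### The Sobolev inequality by splitting frequencies at each level -/

section SobolevEmbedding

open Filter Topology Module Set

variable {V : Type*} [NormedAddCommGroup V] [InnerProductSpace ℝ V] [FiniteDimensional ℝ V]
  [MeasurableSpace V] [BorelSpace V]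

/-- The frequencies in $S$ contribute at most $t/2$ pointwise. Where the whole exceeds $t$, the
remaining frequencies contribute at least $t/2$, and Chebyshev with Plancherel bounds the measure of
that set. -/
theorem measure_lt_norm_fourierInv_le {g : V → ℂ} (hg : Integrable g) (hg2 : MemLp g 2)
    {S : Set V} (hS : MeasurableSet S) {t : ℝ} (ht : 0 < t)
    (hlow : ∫⁻ ξ in S, ‖g ξ‖ₑ ≤ ENNReal.ofReal (t / 2)) :
    volume {x | t < ‖𝓕⁻ g x‖} ≤
      ENNReal.ofReal (4 * t ^ (-2 : ℝ)) * ∫⁻ ξ in Sᶜ, ‖g ξ‖ₑ ^ (2 : ℝ) := by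
  set l : V → ℂ := S.indicator g
  set h : V → ℂ := Sᶜ.indicator g
  have hl : Integrable l := hg.indicator hS
  have hh : Integrable h := hg.indicator hS.compl
  have hh2 : MemLp h 2 := hg2.indicator hS.compl
  have hsum : ∀ x, 𝓕⁻ g x = 𝓕⁻ l x + 𝓕⁻ h x := by
    intro x
    rw [← fourierInv_add_apply hl hh]
    exact congrArg (fun f : V → ℂ => 𝓕⁻ f x) (indicator_self_add_compl S g).symm
  have hlx : ∀ x, ‖𝓕⁻ l x‖ ≤ t / 2 := by
    intro x
    refine (norm_fourierInv_le l x).trans ?_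
    have e : ∫ ξ, ‖l ξ‖ = ∫ ξ in S, ‖g ξ‖ := by
      rw [← integral_indicator hS]
      congr 1 with ξ
      exact norm_indicator_eq_indicator_norm g ξ
    rw [e, integral_norm_eq_lintegral_enorm hg.1.restrict]
    exact ENNReal.toReal_le_of_le_ofReal (by positivity) hlow
  have hsub : {x | t < ‖𝓕⁻ g x‖} ⊆ {x | ENNReal.ofReal (t / 2) ^ (2 : ℝ) ≤ ‖𝓕⁻ h x‖ₑ ^ (2 : ℝ)} := by
    intro x hx
    have h1 : t < ‖𝓕⁻ g x‖ := hx
    rw [hsum x] at h1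
    have h2 : t / 2 ≤ ‖𝓕⁻ h x‖ := by linarith [norm_add_le (𝓕⁻ l x) (𝓕⁻ h x), hlx x]
    rw [mem_ofPred_eq, ← ofReal_norm]
    gcongr
  have hpl : ∫⁻ x, ‖𝓕⁻ h x‖ₑ ^ (2 : ℝ) = ∫⁻ ξ in Sᶜ, ‖g ξ‖ₑ ^ (2 : ℝ) := by
    have e1 := (memLp_fourierInv_and_eLpNorm_eq hh hh2).2
    rw [eLpNorm_indicator_eq_eLpNorm_restrict hS.compl,
      eLpNorm_eq_lintegral_rpow_enorm_toReal (by norm_num) (by norm_num),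
      eLpNorm_eq_lintegral_rpow_enorm_toReal (by norm_num) (by norm_num)] at e1
    simp only [ENNReal.toReal_ofNat] at e1
    exact ENNReal.rpow_left_injective (by norm_num : (1 / 2 : ℝ) ≠ 0) e1
  have hcheb := mul_meas_ge_le_lintegral₀ (μ := (volume : Measure V))
    (f := fun x => ‖𝓕⁻ h x‖ₑ ^ (2 : ℝ))
    ((continuous_fourierInv hh).measurable.enorm.pow_const _).aemeasurable
    (ENNReal.ofReal (t / 2) ^ (2 : ℝ))
  rw [hpl] at hcheb
  have e4 : ENNReal.ofReal (4 * t ^ (-2 : ℝ)) * ENNReal.ofReal (t / 2) ^ (2 : ℝ) = 1 := by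
    rw [ENNReal.ofReal_rpow_of_nonneg (by positivity) (by norm_num),
      ← ENNReal.ofReal_mul (by positivity), Real.rpow_neg ht.le]
    norm_num
    field_simp
    norm_num
  calc volume {x | t < ‖𝓕⁻ g x‖} ≤ 1 * volume
          {x | ENNReal.ofReal (t / 2) ^ (2 : ℝ) ≤ ‖𝓕⁻ h x‖ₑ ^ (2 : ℝ)} := by
        rw [one_mul]; exact measure_mono hsub
    _ = ENNReal.ofReal (4 * t ^ (-2 : ℝ)) * (ENNReal.ofReal (t / 2) ^ (2 : ℝ) * volume
          {x | ENNReal.ofReal (t / 2) ^ (2 : ℝ) ≤ ‖𝓕⁻ h x‖ₑ ^ (2 : ℝ)}) := by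
        rw [← e4, mul_assoc]
    _ ≤ _ := by gcongr

theorem lintegral_Ioi_indicator_rpow {r b : ℝ} (hr : -1 < r) (hb : 0 ≤ b) :
    ∫⁻ t in Ioi (0 : ℝ), (Iic b).indicator (fun t => ENNReal.ofReal (t ^ r)) t =
      ENNReal.ofReal (b ^ (r + 1) / (r + 1)) := by
  rw [lintegral_indicator measurableSet_Iic, Measure.restrict_restrict measurableSet_Iic,
    Iic_inter_Ioi, ← ofReal_integral_eq_lintegral_ofReal, ← intervalIntegral.integral_of_le hb,
    integral_rpow (Or.inl hr), Real.zero_rpow (by linarith), sub_zero]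
  · exact (intervalIntegrable_iff_integrableOn_Ioc_of_le hb).1
      (intervalIntegral.intervalIntegrable_rpow' hr)
  · filter_upwards [ae_restrict_mem measurableSet_Ioc] with t ht
    exact Real.rpow_nonneg ht.1.le _

/-- The $L^p$ norm is written by the layer-cake formula, and at each level $t$ the frequencies are
split at a radius depending on $t$ for which the low part is at most $t/2$. Exchanging the
integrals, the $t$-integral of $t^{p-3}$ up to a multiple of $|\xi|^\gamma$ gives a multiple of
$|\xi|^{\gamma(p-2)}=|\xi|^{2s}$, hence the square of the homogeneous Sobolev norm. -/
theorem exists_lintegral_fourierInv_rpow_le (hV : 1 ≤ finrank ℝ V) {s : ℝ} (hs : 0 < s)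
    (hsV : 2 * s < finrank ℝ V) :
    ∃ K : ℝ, 0 ≤ K ∧ ∀ g : V → ℂ, Integrable g → MemLp g 2 → ∀ M : ℝ, 0 < M →
      eLpNorm (fun ξ => (((2 * Real.pi * ‖ξ‖) ^ s : ℝ) : ℂ) * g ξ) 2 volume ≤ ENNReal.ofReal M →
      ∫⁻ x, ‖𝓕⁻ g x‖ₑ ^ (2 * (finrank ℝ V : ℝ) / (finrank ℝ V - 2 * s)) ≤
        ENNReal.ofReal (K * M ^ (2 * (finrank ℝ V : ℝ) / (finrank ℝ V - 2 * s))) := by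
  obtain ⟨B, hB, hlow⟩ := exists_lintegral_ball_le_eLpNorm hV hsV
  set n : ℝ := (finrank ℝ V : ℝ) with hn
  set p : ℝ := 2 * n / (n - 2 * s) with hp
  have hns : 0 < n - 2 * s := by linarith
  have hn0 : 0 < n := by linarith
  have hp0 : 0 < p := by positivity
  have hp2 : p - 2 = 4 * s / (n - 2 * s) := by rw [hp]; field_simp; ring
  have hp2' : 0 < p - 2 := by rw [hp2]; positivity
  set γ : ℝ := (n - 2 * s) / 2 with hγ
  have hγ0 : 0 < γ := by positivity
  have hγp : γ * (p - 2) = 2 * s := by rw [hp2, hγ]; field_simp; ring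
  refine ⟨p * (4 * ((2 * B) ^ (p - 2) / (p - 2)) * (2 * Real.pi) ^ (-(2 * s))), by positivity,
    fun g hg hg2 M hM hgM => ?_⟩
  -- With this $c$ and radius $A=(t/c)^{1/\gamma}$, the low-frequency bound $BA^\gamma M$ equals
  -- $t/2$. Frequencies outside that ball are those with $t\le c|\xi|^\gamma$, that is $t\le
  -- L(\xi)$.
  set c : ℝ := 2 * (B * M) with hc
  have hc0 : 0 < c := by positivity
  set L : V → ℝ := fun ξ => c * ‖ξ‖ ^ γ with hL
  have hLm : Measurable L := (measurable_norm.pow_const _).const_mul _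
  have hL0 : ∀ ξ, 0 ≤ L ξ := fun ξ => by positivity
  have hmeas : ∀ t : ℝ, 0 < t → volume {x | t < ‖𝓕⁻ g x‖} ≤ ENNReal.ofReal (4 * t ^ (-2 : ℝ)) *
      ∫⁻ ξ, {ξ | t ≤ L ξ}.indicator (fun ξ => ‖g ξ‖ₑ ^ (2 : ℝ)) ξ := by
    intro t ht
    have hset : {ξ | t ≤ L ξ} = (Metric.ball (0 : V) ((t / c) ^ γ⁻¹))ᶜ := by
      ext ξ
      rw [mem_compl_iff, mem_ball_zero_iff, Real.lt_rpow_inv_iff_of_pos (norm_nonneg _)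
        (by positivity) hγ0, not_lt, div_le_iff₀ hc0, mem_ofPred_eq, hL, mul_comm]
    rw [lintegral_indicator (measurableSet_le measurable_const hLm), hset]
    refine measure_lt_norm_fourierInv_le hg hg2 measurableSet_ball ht ?_
    refine (hlow g hg.1 _ (by positivity)).trans ((mul_le_mul_right hgM _).trans ?_)
    rw [← ENNReal.ofReal_mul (by positivity), ← Real.rpow_mul (by positivity),
      inv_mul_cancel₀ hγ0.ne', Real.rpow_one, hc]
    refine ENNReal.ofReal_le_ofReal (le_of_eq ?_)
    field_simp
  have hum : Measurable (𝓕⁻ g) := (continuous_fourierInv hg).measurable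
  have hcake := lintegral_rpow_eq_lintegral_meas_lt_mul (volume : Measure V)
    (f := fun x => ‖𝓕⁻ g x‖) (Eventually.of_forall fun x => norm_nonneg _)
    hum.norm.aemeasurable hp0
  have e0 : ∫⁻ x, ‖𝓕⁻ g x‖ₑ ^ p = ∫⁻ x, ENNReal.ofReal (‖𝓕⁻ g x‖ ^ p) := by
    refine lintegral_congr fun x => ?_
    rw [← ENNReal.ofReal_rpow_of_nonneg (norm_nonneg _) hp0.le, ofReal_norm]
  have hind : ∀ t ξ, {ξ | t ≤ L ξ}.indicator (fun ξ => ‖g ξ‖ₑ ^ (2 : ℝ)) ξ =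
      (Iic (L ξ)).indicator (fun _ => 1) t * ‖g ξ‖ₑ ^ (2 : ℝ) := by
    intro t ξ
    by_cases h : t ≤ L ξ <;> simp [indicator, h]
  have h1 : ∫⁻ t in Ioi (0 : ℝ), volume {x | t < ‖𝓕⁻ g x‖} * ENNReal.ofReal (t ^ (p - 1)) ≤
      ∫⁻ t in Ioi (0 : ℝ), ∫⁻ ξ, 4 * ((Iic (L ξ)).indicator
        (fun t => ENNReal.ofReal (t ^ (p - 3))) t * ‖g ξ‖ₑ ^ (2 : ℝ)) := by
    refine lintegral_mono_ae ?_
    filter_upwards [ae_restrict_mem measurableSet_Ioi] with t ht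
    have ht0 : 0 < t := ht
    refine (mul_le_mul_left (hmeas t ht0) _).trans (le_of_eq ?_)
    rw [mul_right_comm, ← ENNReal.ofReal_mul (by positivity), mul_assoc, ← Real.rpow_add ht0,
      ← lintegral_const_mul' _ _ ENNReal.ofReal_ne_top]
    refine lintegral_congr fun ξ => ?_
    rw [hind, ENNReal.ofReal_mul (by norm_num), show (-2 : ℝ) + (p - 1) = p - 3 by ring,
      ENNReal.ofReal_ofNat, mul_assoc]
    congr 1
    rw [← mul_assoc]
    congr 1
    by_cases h : t ≤ L ξ <;> simp [indicator, h]
  have hswapm : AEMeasurable (Function.uncurry fun (t : ℝ) (ξ : V) => 4 * ((Iic (L ξ)).indicator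
        (fun t => ENNReal.ofReal (t ^ (p - 3))) t * ‖g ξ‖ₑ ^ (2 : ℝ)))
      ((volume.restrict (Ioi 0)).prod volume) := by
    have ha : Measurable fun z : ℝ × V => (Iic (L z.2)).indicator
        (fun t => ENNReal.ofReal (t ^ (p - 3))) z.1 := by
      have hb : Measurable fun z : ℝ × V => ENNReal.ofReal (z.1 ^ (p - 3)) :=
        (measurable_fst.pow_const _).ennreal_ofReal
      exact hb.indicator (measurableSet_le measurable_fst (hLm.comp measurable_snd))
    refine AEMeasurable.const_mul (ha.aemeasurable.mul ?_) _
    exact (hg.1.comp_snd).enorm.pow_const _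
  rw [e0, hcake]
  have hinner : ∀ ξ, ∫⁻ t in Ioi (0 : ℝ), 4 * ((Iic (L ξ)).indicator
        (fun t => ENNReal.ofReal (t ^ (p - 3))) t * ‖g ξ‖ₑ ^ (2 : ℝ)) =
      ENNReal.ofReal (4 * (c ^ (p - 2) / (p - 2)) * (2 * Real.pi) ^ (-(2 * s))) *
        ‖(((2 * Real.pi * ‖ξ‖) ^ s : ℝ) : ℂ) * g ξ‖ₑ ^ (2 : ℝ) := by
    intro ξ
    rw [lintegral_const_mul' _ _ (by norm_num), lintegral_mul_const' _ _
      (ENNReal.rpow_ne_top_of_nonneg (by norm_num) enorm_ne_top),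
      lintegral_Ioi_indicator_rpow (by linarith) (hL0 ξ), enorm_mul,
      ENNReal.mul_rpow_of_nonneg _ _ (by norm_num), ← mul_assoc, ← mul_assoc]
    congr 1
    rw [← ofReal_norm, Complex.norm_real, Real.norm_of_nonneg (by positivity),
      ENNReal.ofReal_rpow_of_nonneg (by positivity) (by norm_num),
      ← ENNReal.ofReal_mul (by positivity), ← ENNReal.ofReal_ofNat,
      ← ENNReal.ofReal_mul (by norm_num)]
    congr 1
    rw [show p - 3 + 1 = p - 2 by ring, hL]
    beta_reduce
    rw [Real.mul_rpow hc0.le (by positivity), ← Real.rpow_mul (norm_nonneg _), hγp,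
      ← Real.rpow_mul (by positivity), mul_comm s 2, Real.mul_rpow (by positivity) (norm_nonneg _),
      Real.rpow_neg (by positivity)]
    field_simp
  have hM2 : ∫⁻ ξ, ‖(((2 * Real.pi * ‖ξ‖) ^ s : ℝ) : ℂ) * g ξ‖ₑ ^ (2 : ℝ) ≤
      ENNReal.ofReal (M ^ (2 : ℝ)) := by
    rw [eLpNorm_eq_lintegral_rpow_enorm_toReal (by norm_num) (by norm_num),
      ENNReal.toReal_ofNat] at hgM
    have := ENNReal.rpow_le_rpow hgM (by norm_num : (0 : ℝ) ≤ 2)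
    rwa [← ENNReal.rpow_mul, one_div, inv_mul_cancel₀ (by norm_num), ENNReal.rpow_one,
      ENNReal.ofReal_rpow_of_nonneg hM.le (by norm_num)] at this
  calc ENNReal.ofReal p * _ ≤ ENNReal.ofReal p * _ := mul_le_mul_right h1 _
    _ = ENNReal.ofReal p * (ENNReal.ofReal (4 * (c ^ (p - 2) / (p - 2)) *
          (2 * Real.pi) ^ (-(2 * s))) *
          ∫⁻ ξ, ‖(((2 * Real.pi * ‖ξ‖) ^ s : ℝ) : ℂ) * g ξ‖ₑ ^ (2 : ℝ)) := by
        rw [lintegral_lintegral_swap hswapm]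
        simp only [hinner]
        rw [lintegral_const_mul' _ _ ENNReal.ofReal_ne_top]
    _ ≤ ENNReal.ofReal p * (ENNReal.ofReal (4 * (c ^ (p - 2) / (p - 2)) *
          (2 * Real.pi) ^ (-(2 * s))) * ENNReal.ofReal (M ^ (2 : ℝ))) := by gcongr
    _ = _ := by
        rw [← ENNReal.ofReal_mul (by positivity), ← ENNReal.ofReal_mul (by positivity)]
        congr 1
        have : c ^ (p - 2) * M ^ (2 : ℝ) = (2 * B) ^ (p - 2) * M ^ p := by
          rw [hc, ← mul_assoc, Real.mul_rpow (by positivity) hM.le, mul_assoc, ← Real.rpow_add hM,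
            sub_add_cancel]
        calc _ = p * (4 * (c ^ (p - 2) * M ^ (2 : ℝ) / (p - 2)) * (2 * Real.pi) ^ (-(2 * s))) := by
              ring
          _ = _ := by rw [this]; ring

end SobolevEmbedding

/-! ### Inverting the weighted transform on all of $L^2$ -/

section SobolevExtension

open Filter Topology Module Set

variable {V : Type*} [NormedAddCommGroup V] [InnerProductSpace ℝ V] [FiniteDimensional ℝ V]
  [MeasurableSpace V] [BorelSpace V]

theorem exists_eLpNorm_fourierInv_le (hV : 1 ≤ finrank ℝ V) {s : ℝ} (hs : 0 < s)
    (hsV : 2 * s < finrank ℝ V) :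
    ∃ K : ℝ, 0 ≤ K ∧ ∀ g : V → ℂ, Integrable g → MemLp g 2 → ∀ M : ℝ, 0 < M →
      eLpNorm (fun ξ => (((2 * Real.pi * ‖ξ‖) ^ s : ℝ) : ℂ) * g ξ) 2 volume ≤ ENNReal.ofReal M →
      eLpNorm (𝓕⁻ g) (ENNReal.ofReal (2 * (finrank ℝ V : ℝ) / (finrank ℝ V - 2 * s))) volume ≤
        ENNReal.ofReal (K * M) := by
  obtain ⟨K, hK, h⟩ := exists_lintegral_fourierInv_rpow_le hV hs hsV
  set p : ℝ := 2 * (finrank ℝ V : ℝ) / (finrank ℝ V - 2 * s)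
  have hp : 0 < p := by
    have : 0 < (finrank ℝ V : ℝ) := by linarith
    have : 0 < (finrank ℝ V : ℝ) - 2 * s := by linarith
    positivity
  refine ⟨K ^ (1 / p), by positivity, fun g hg hg2 M hM hgM => ?_⟩
  rw [eLpNorm_eq_lintegral_rpow_enorm_toReal (by simpa using hp) ENNReal.ofReal_ne_top,
    ENNReal.toReal_ofReal hp.le]
  refine (ENNReal.rpow_le_rpow (h g hg hg2 M hM hgM) (by positivity)).trans (le_of_eq ?_)
  rw [ENNReal.ofReal_rpow_of_nonneg (by positivity) (by positivity),
    Real.mul_rpow hK (by positivity), ← Real.rpow_mul hM.le, mul_one_div, div_self hp.ne',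
    Real.rpow_one]

/-- The annulus `(k + 1)⁻¹ ≤ ‖ξ‖ ≤ k + 1`. -/
def freqAnnulus (V : Type*) [NormedAddCommGroup V] (k : ℕ) : Set V :=
  {ξ | 1 / ((k : ℝ) + 1) ≤ ‖ξ‖ ∧ ‖ξ‖ ≤ k + 1}

theorem measurableSet_freqAnnulus (k : ℕ) : MeasurableSet (freqAnnulus V k) :=
  (measurableSet_le measurable_const measurable_norm).inter
    (measurableSet_le measurable_norm measurable_const)

theorem volume_freqAnnulus_lt_top (k : ℕ) : volume (freqAnnulus V k) < ⊤ :=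
  (measure_mono fun _ hξ => mem_closedBall_zero_iff.2 hξ.2).trans_lt
    (measure_closedBall_lt_top (x := (0 : V)) (r := (k : ℝ) + 1))

theorem eventually_mem_freqAnnulus {ξ : V} (hξ : ξ ≠ 0) : ∀ᶠ k : ℕ in atTop, ξ ∈ freqAnnulus V k := by
  have h1 := (tendsto_one_div_add_atTop_nhds_zero_nat (𝕜 := ℝ)).eventually_lt_const
    (norm_pos_iff.2 hξ)
  have h2 := (tendsto_natCast_atTop_atTop (R := ℝ)).eventually_ge_atTop ‖ξ‖
  filter_upwards [h1, h2] with k hk1 hk2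
  exact ⟨hk1.le, by linarith⟩

theorem tendsto_eLpNorm_indicator_freqAnnulus_sub [Nontrivial V] {G : V → ℂ} (hG : MemLp G 2) :
    Tendsto (fun k => eLpNorm ((freqAnnulus V k).indicator G - G) 2 volume) atTop (𝓝 0) := by
  have hne : ∀ᵐ ξ : V, ξ ≠ 0 := by simp [ae_iff, measure_singleton]
  have key : Tendsto (fun k => ∫⁻ ξ, ‖((freqAnnulus V k).indicator G - G) ξ‖ₑ ^ (2 : ℝ)) atTop
      (𝓝 (∫⁻ _ : V, 0)) := by
    refine tendsto_lintegral_of_dominated_convergence' (fun ξ => ‖G ξ‖ₑ ^ (2 : ℝ))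
      (fun k => ?_) (fun k => ?_) ?_ ?_
    · exact (((hG.1.indicator (measurableSet_freqAnnulus k)).sub hG.1).enorm).pow_const _
    · refine Eventually.of_forall fun ξ => ?_
      by_cases h : ξ ∈ freqAnnulus V k <;> simp [h]
    · have := hG.2
      rw [eLpNorm_lt_top_iff_lintegral_rpow_enorm_lt_top (by norm_num) (by norm_num)] at this
      simpa using this.ne
    · filter_upwards [hne] with ξ hξ
      refine tendsto_const_nhds.congr' ?_
      filter_upwards [eventually_mem_freqAnnulus hξ] with k hk
      simp [hk]
  rw [lintegral_zero] at key
  have h2 := key.ennrpow_const (1 / 2 : ℝ)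
  rw [ENNReal.zero_rpow_of_pos (by norm_num)] at h2
  refine h2.congr fun k => ?_
  rw [eLpNorm_eq_lintegral_rpow_enorm_toReal (by norm_num) (by norm_num), ENNReal.toReal_ofNat]

theorem memLp_indicator_freqAnnulus_rpow_mul (s : ℝ) {G : V → ℂ} (hG : MemLp G 2)
    (k : ℕ) :
    MemLp ((freqAnnulus V k).indicator
      fun ξ => (((2 * Real.pi * ‖ξ‖) ^ (-s) : ℝ) : ℂ) * G ξ) 2 := by
  obtain ⟨C, hC⟩ : ∃ C : ℝ, ∀ ξ ∈ freqAnnulus V k, (2 * Real.pi * ‖ξ‖) ^ (-s) ≤ C := by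
    have hcont : ContinuousOn (fun ξ : V => (2 * Real.pi * ‖ξ‖) ^ (-s)) (freqAnnulus V k) := by
      refine ContinuousOn.rpow_const (by fun_prop) fun ξ hξ => Or.inl ?_
      have : 0 < ‖ξ‖ := lt_of_lt_of_le (by positivity) hξ.1
      positivity
    have hcpt : IsCompact (freqAnnulus V k) := by
      refine Metric.isCompact_of_isClosed_isBounded
        ((isClosed_le continuous_const continuous_norm).inter
          (isClosed_le continuous_norm continuous_const)) ?_
      exact Metric.isBounded_closedBall.subset fun ξ hξ =>
        (mem_closedBall_zero_iff (r := (k : ℝ) + 1)).2 hξ.2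
    obtain ⟨C, hC⟩ := hcpt.exists_bound_of_continuousOn hcont
    exact ⟨C, fun ξ hξ => (le_abs_self _).trans (hC ξ hξ)⟩
  refine (hG.const_mul (C : ℂ)).mono (AEStronglyMeasurable.indicator ?_
    (measurableSet_freqAnnulus k)) (Eventually.of_forall fun ξ => ?_)
  · exact (Complex.measurable_ofReal.comp
      (measurable_two_pi_norm_rpow (-s))).aestronglyMeasurable.mul hG.1
  · by_cases h : ξ ∈ freqAnnulus V k
    · rw [indicator_of_mem h, norm_mul, norm_mul, Complex.norm_real, Complex.norm_real,
        Real.norm_of_nonneg (by positivity)]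
      gcongr
      exact (hC ξ h).trans (le_abs_self C)
    · rw [indicator_of_notMem h, norm_zero]
      positivity

theorem integrable_indicator_freqAnnulus_rpow_mul (s : ℝ) {G : V → ℂ}
    (hG : MemLp G 2) (k : ℕ) :
    Integrable ((freqAnnulus V k).indicator
      fun ξ => (((2 * Real.pi * ‖ξ‖) ^ (-s) : ℝ) : ℂ) * G ξ) := by
  have h := memLp_indicator_freqAnnulus_rpow_mul s hG k
  rw [memLp_indicator_iff_restrict (measurableSet_freqAnnulus k)] at h
  have : IsFiniteMeasure (volume.restrict (freqAnnulus V k)) :=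
    ⟨by simpa using volume_freqAnnulus_lt_top k⟩
  exact (integrable_indicator_iff (measurableSet_freqAnnulus k)).2 (h.integrable one_le_two)

theorem rpow_mul_indicator_freqAnnulus (s : ℝ) (G : V → ℂ) (k : ℕ) (ξ : V) :
    (((2 * Real.pi * ‖ξ‖) ^ s : ℝ) : ℂ) * (freqAnnulus V k).indicator
      (fun ξ => (((2 * Real.pi * ‖ξ‖) ^ (-s) : ℝ) : ℂ) * G ξ) ξ =
      (freqAnnulus V k).indicator G ξ := by
  by_cases h : ξ ∈ freqAnnulus V k
  · have h0 : 0 < ‖ξ‖ := lt_of_lt_of_le (by positivity) h.1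
    have h1 : (0 : ℝ) < 2 * Real.pi * ‖ξ‖ := by positivity
    rw [indicator_of_mem h, indicator_of_mem h, ← mul_assoc, ← Complex.ofReal_mul,
      ← Real.rpow_add h1]
    simp
  · simp [indicator_of_notMem h]

theorem integrable_rpow_neg_mul_schwartz (hV : 1 ≤ finrank ℝ V) {s : ℝ}
    (hsV : 2 * s < finrank ℝ V) {G : V → ℂ} (hG : MemLp G 2) (φ : 𝓢(V, ℂ)) :
    Integrable fun ξ => (((2 * Real.pi * ‖ξ‖) ^ (-s) : ℝ) : ℂ) * G ξ * φ ξ := by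
  refine (hG.integrable_mul (SchwartzMap.memLp_two_pi_norm_rpow_mul hV (r := -s) (by linarith)
    φ)).congr (Eventually.of_forall fun ξ => ?_)
  simp only [Pi.mul_apply]
  ring

theorem tendsto_integral_mul_of_tendsto_eLpNorm {X : Type*} [MeasurableSpace X] {μ : Measure X}
    {p q : ℝ≥0∞} [p.HolderTriple q 1] {f : ℕ → X → ℂ} {u v : X → ℂ} (hf : ∀ k, MemLp (f k) p μ)
    (hu : MemLp u p μ) (hv : MemLp v q μ)
    (h : Tendsto (fun k => eLpNorm (f k - u) p μ) atTop (𝓝 0)) :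
    Tendsto (fun k => ∫ x, f k x * v x ∂μ) atTop (𝓝 (∫ x, u x * v x ∂μ)) := by
  refine tendsto_integral_of_L1' _ (hu.1.mul hv.1)
    (Eventually.of_forall fun k => (hf k).integrable_mul hv) ?_
  have h2 : Tendsto (fun k => eLpNorm (f k - u) p μ * eLpNorm v q μ) atTop (𝓝 0) := by
    simpa using ENNReal.Tendsto.mul_const h (Or.inr hv.2.ne)
  refine tendsto_of_tendsto_of_tendsto_of_le_of_le tendsto_const_nhds h2 (fun k => zero_le)
    fun k => ?_
  refine le_trans (le_of_eq ?_) (eLpNorm_smul_le_mul_eLpNorm (p := p) (q := q) (r := 1) hv.1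
    ((hf k).1.sub hu.1))
  congr 1
  ext x
  simp [sub_mul]

/-- Restricted to annuli, $|\xi|^{-s}G$ is integrable and square integrable, so its inverse
transform is classical. The truncations of $G$ converge in $L^2$, so by the Sobolev inequality these
inverse transforms are Cauchy in $L^p$. The Fourier identity passes to their limit by Hölder on one
side and dominated convergence on the other. -/
theorem exists_memLp_integral_mul_fourier_eq (hV : 1 ≤ finrank ℝ V) {s : ℝ} (hs : 0 < s)
    (hsV : 2 * s < finrank ℝ V) {G : V → ℂ} (hG : MemLp G 2) :
    ∃ u : V → ℂ, MemLp u (ENNReal.ofReal (2 * (finrank ℝ V : ℝ) / (finrank ℝ V - 2 * s))) ∧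
      ∀ φ : 𝓢(V, ℂ), Integrable (fun x => u x * φ x) ∧
        ∫ ξ, (((2 * Real.pi * ‖ξ‖) ^ (-s) : ℝ) : ℂ) * G ξ * φ ξ = ∫ x, u x * 𝓕 φ x := by
  obtain ⟨K, hK, hSob⟩ := exists_eLpNorm_fourierInv_le hV hs hsV
  have : Nontrivial V := Module.nontrivial_of_finrank_pos (R := ℝ) (by omega)
  set p : ℝ := 2 * (finrank ℝ V : ℝ) / (finrank ℝ V - 2 * s) with hp
  have hp1 : 1 < p := by
    have : 0 < (finrank ℝ V : ℝ) - 2 * s := by linarith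
    rw [hp, one_lt_div this]
    linarith
  have hpfact : Fact (1 ≤ ENNReal.ofReal p) := ⟨by simpa using hp1.le⟩
  have hconj : (ENNReal.ofReal p).HolderTriple (ENNReal.ofReal p.conjExponent) 1 :=
    (Real.HolderConjugate.conjExponent hp1).ennrealOfReal
  set g : V → ℂ := fun ξ => (((2 * Real.pi * ‖ξ‖) ^ (-s) : ℝ) : ℂ) * G ξ with hg
  set gk : ℕ → V → ℂ := fun k => (freqAnnulus V k).indicator g with hgk
  have hgk1 : ∀ k, Integrable (gk k) := integrable_indicator_freqAnnulus_rpow_mul s hG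
  have hgk2 : ∀ k, MemLp (gk k) 2 := memLp_indicator_freqAnnulus_rpow_mul s hG
  have hwk : ∀ k ξ, (((2 * Real.pi * ‖ξ‖) ^ s : ℝ) : ℂ) * gk k ξ =
      (freqAnnulus V k).indicator G ξ := rpow_mul_indicator_freqAnnulus s G
  have hmem : ∀ k, MemLp (𝓕⁻ (gk k)) (ENNReal.ofReal p) := by
    intro k
    refine ⟨(continuous_fourierInv (hgk1 k)).aestronglyMeasurable, ?_⟩
    have hf : MemLp (fun ξ => (((2 * Real.pi * ‖ξ‖) ^ s : ℝ) : ℂ) * gk k ξ) 2 := by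
      simp only [hwk]
      exact hG.indicator (measurableSet_freqAnnulus k)
    refine (hSob (gk k) (hgk1 k) (hgk2 k) ((eLpNorm (fun ξ => (((2 * Real.pi * ‖ξ‖) ^ s : ℝ) : ℂ) *
      gk k ξ) 2 volume).toReal + 1) (by positivity) ?_).trans_lt ENNReal.ofReal_lt_top
    rw [ENNReal.ofReal_add ENNReal.toReal_nonneg zero_le_one, ENNReal.ofReal_toReal hf.2.ne]
    exact le_self_add
  set U : ℕ → Lp ℂ (ENNReal.ofReal p) (volume : Measure V) := fun k => (hmem k).toLp _ with hU
  have hcauchy : CauchySeq U := by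
    refine EMetric.cauchySeq_iff.2 fun ε hε => ?_
    obtain ⟨δ, hδ0, hδ⟩ : ∃ δ : ℝ, 0 < δ ∧ ENNReal.ofReal (K * (2 * δ)) < ε := by
      have ht : Tendsto (fun δ : ℝ => ENNReal.ofReal (K * (2 * δ))) (𝓝[>] 0) (𝓝 0) := by
        have : Continuous fun δ : ℝ => ENNReal.ofReal (K * (2 * δ)) :=
          ENNReal.continuous_ofReal.comp (by fun_prop)
        simpa using (this.tendsto 0).mono_left nhdsWithin_le_nhds
      obtain ⟨δ, h1, h2⟩ := ((ht.eventually_lt_const hε).and self_mem_nhdsWithin).exists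
      exact ⟨δ, h2, h1⟩
    obtain ⟨N, hN⟩ := eventually_atTop.1
      ((tendsto_eLpNorm_indicator_freqAnnulus_sub hG).eventually_lt_const
        (ENNReal.ofReal_pos.2 hδ0))
    refine ⟨N, fun m hm k hk => lt_of_le_of_lt ?_ hδ⟩
    rw [hU, Lp.edist_toLp_toLp]
    have e : 𝓕⁻ (gk m) - 𝓕⁻ (gk k) = 𝓕⁻ (gk m - gk k) := by
      ext x
      have h1 := fourierInv_add_apply ((hgk1 m).sub (hgk1 k)) (hgk1 k) x
      simp only [Pi.sub_apply, sub_add_cancel] at h1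
      rw [Pi.sub_apply, sub_eq_iff_eq_add]
      exact h1
    rw [e]
    refine hSob _ ((hgk1 m).sub (hgk1 k)) ((hgk2 m).sub (hgk2 k)) _ (by positivity) ?_
    have e2 : (fun ξ => (((2 * Real.pi * ‖ξ‖) ^ s : ℝ) : ℂ) * (gk m - gk k) ξ) =
        ((freqAnnulus V m).indicator G - G) - ((freqAnnulus V k).indicator G - G) := by
      ext ξ
      simp only [Pi.sub_apply, mul_sub, hwk]
      ring
    have hm' : ∀ j, AEStronglyMeasurable ((freqAnnulus V j).indicator G - G) volume := fun j =>
      (hG.1.indicator (measurableSet_freqAnnulus j)).sub hG.1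
    rw [e2, two_mul, ENNReal.ofReal_add hδ0.le hδ0.le]
    exact (eLpNorm_sub_le (hm' m) (hm' k) one_le_two).trans
      (add_le_add (hN m hm).le (hN k hk).le)
  obtain ⟨u, hu⟩ := cauchySeq_tendsto_of_complete hcauchy
  have hmul : ∀ (v : V → ℂ), MemLp v (ENNReal.ofReal p) → ∀ φ : 𝓢(V, ℂ),
      Integrable fun x => v x * φ x := fun v hv φ =>
    hv.integrable_mul (φ.memLp (ENNReal.ofReal p.conjExponent))
  refine ⟨u, Lp.memLp u, fun φ => ⟨hmul u (Lp.memLp u) φ, ?_⟩⟩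
  have h1 : Tendsto (fun k => ∫ x, 𝓕⁻ (gk k) x * 𝓕 φ x) atTop (𝓝 (∫ x, u x * 𝓕 φ x)) := by
    refine tendsto_integral_mul_of_tendsto_eLpNorm (p := ENNReal.ofReal p)
      (q := ENNReal.ofReal p.conjExponent) hmem (Lp.memLp u) ((𝓕 φ).memLp _) ?_
    refine (tendsto_iff_edist_tendsto_0.1 hu).congr fun k => ?_
    rw [Lp.edist_def]
    refine eLpNorm_congr_ae ?_
    filter_upwards [(hmem k).coeFn_toLp] with x hx
    simp only [Pi.sub_apply, hU, hx]
  have h2 : Tendsto (fun k => ∫ ξ, gk k ξ * φ ξ) atTop (𝓝 (∫ ξ, g ξ * φ ξ)) := by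
    have hi := integrable_rpow_neg_mul_schwartz hV hsV hG φ
    refine tendsto_integral_of_dominated_convergence (fun ξ => ‖g ξ * φ ξ‖)
      (fun k => (hgk1 k).1.mul φ.continuous.aestronglyMeasurable) hi.norm
      (fun k => Eventually.of_forall fun ξ => ?_) ?_
    · by_cases h : ξ ∈ freqAnnulus V k
      · simp [hgk, h]
      · simp only [hgk, indicator_of_notMem h, zero_mul, norm_zero]
        positivity
    · filter_upwards [(by simp [ae_iff, measure_singleton] : ∀ᵐ ξ : V, ξ ≠ 0)] with ξ hξ
      refine tendsto_const_nhds.congr' ?_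
      filter_upwards [eventually_mem_freqAnnulus hξ] with k hk
      simp [hgk, hk]
  refine tendsto_nhds_unique h2 (h1.congr fun k => ?_)
  have h3 := integral_fourierInv_mul_eq_flip (hgk1 k) (𝓕 φ).integrable
  refine h3.trans ?_
  rw [← SchwartzMap.fourierInv_coe, FourierTransform.fourierInv_fourier_eq]

end SobolevExtension

/-! ### Conjugation and reflection of Fourier transforms -/

section HermitianSymmetry

open Filter Topology Module Set

variable {V : Type*} [NormedAddCommGroup V] [InnerProductSpace ℝ V] [FiniteDimensional ℝ V]
  [MeasurableSpace V] [BorelSpace V]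

/-- The Schwartz function `x ↦ conj (φ (-x))`. -/
noncomputable def SchwartzMap.conjNeg (φ : 𝓢(V, ℂ)) : 𝓢(V, ℂ) :=
  (SchwartzMap.compCLMOfContinuousLinearEquiv ℝ (ContinuousLinearEquiv.neg ℝ) φ).postcompCLM
    (𝕜 := ℝ) (Complex.conjCLE : ℂ →L[ℝ] ℂ)

@[simp]
theorem SchwartzMap.conjNeg_apply (φ : 𝓢(V, ℂ)) (x : V) :
    φ.conjNeg x = (starRingEnd ℂ) (φ (-x)) := by
  rw [SchwartzMap.conjNeg, SchwartzMap.postcompCLM_apply]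
  rfl

theorem SchwartzMap.fourier_conjNeg (φ : 𝓢(V, ℂ)) (x : V) :
    𝓕 φ.conjNeg x = (starRingEnd ℂ) (𝓕 φ x) := by
  rw [SchwartzMap.fourier_coe, SchwartzMap.fourier_coe, conj_fourier,
    Real.fourierInv_eq_fourier_comp_neg]
  exact congrArg (fun f : V → ℂ => 𝓕 f x) (funext fun y => φ.conjNeg_apply y)

theorem integral_conj_neg_mul_eq {g u : V → ℂ}
    (h : ∀ φ : 𝓢(V, ℂ), ∫ ξ, g ξ * φ ξ = ∫ x, u x * 𝓕 φ x) (φ : 𝓢(V, ℂ)) :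
    ∫ ξ, (starRingEnd ℂ) (g (-ξ)) * φ ξ = ∫ x, (starRingEnd ℂ) (u x) * 𝓕 φ x := by
  have h1 := congrArg (starRingEnd ℂ) (h φ.conjNeg)
  rw [← integral_conj, ← integral_conj, ← integral_neg_eq_self] at h1
  simpa [SchwartzMap.fourier_conjNeg] using h1

theorem integrable_conj_neg_mul {g : V → ℂ} {φ : 𝓢(V, ℂ)}
    (h : Integrable fun ξ => g ξ * φ.conjNeg ξ) :
    Integrable fun ξ => (starRingEnd ℂ) (g (-ξ)) * φ ξ := by
  have h1 : Integrable fun ξ => (starRingEnd ℂ) (g ξ * φ.conjNeg ξ) :=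
    (Complex.conjCLE : ℂ →L[ℝ] ℂ).integrable_comp h
  simpa using h1.comp_neg

/-- On any ball $g$ coincides with its product with a Schwartz function equal to $1$ there. -/
theorem locallyIntegrable_of_integrable_mul_schwartz {g : V → ℂ}
    (h : ∀ φ : 𝓢(V, ℂ), Integrable fun ξ => g ξ * φ ξ) : LocallyIntegrable g volume := by
  intro ξ₀
  set R : ℝ := ‖ξ₀‖ + 1 with hR
  have hR0 : 0 < R := by positivity
  have hc : HasCompactSupport fun ξ : V => freqCutoff (R⁻¹ • ξ) :=
    hasCompactSupport_freqCutoff.comp_smul (inv_ne_zero hR0.ne')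
  have hd : ContDiff ℝ ∞ fun ξ : V => freqCutoff (R⁻¹ • ξ) :=
    contDiff_freqCutoff.comp (contDiff_const_smul _)
  refine ⟨Metric.ball 0 R, Metric.isOpen_ball.mem_nhds (by simp [hR]), ?_⟩
  refine ((h (toSchwartzComplex _ hc hd)).integrableOn (s := Metric.ball 0 R)).congr_fun
    (fun ξ hξ => ?_) measurableSet_ball
  have h1 : ‖ξ‖ < R := by simpa using hξ
  beta_reduce
  rw [toSchwartzComplex_apply, freqCutoff_eq_one]
  · simp
  · rw [norm_smul, norm_inv, Real.norm_of_nonneg hR0.le, sq_le_one_iff₀ (by positivity),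
      inv_mul_le_one₀ hR0]
    exact h1.le

end HermitianSymmetry

/-! ### The isometry into $L^2$ and the weak solution -/

section HomSobolevSpace

open Filter Topology Module Set

variable {d : ℕ} {s : ℝ}

local notation "E" => EuclideanSpace ℝ (Fin d)

theorem IsFourierTransformOf.conj_neg {g : E → ℂ} {u : E → ℝ} (H : IsFourierTransformOf g u) :
    IsFourierTransformOf (fun ξ => (starRingEnd ℂ) (g (-ξ))) u where
  locallyIntegrable_fun := H.locallyIntegrable_fun
  locallyIntegrable := locallyIntegrable_of_integrable_mul_schwartz fun φ =>
    integrable_conj_neg_mul (H.integrable_mul _)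
  integrable_fun_mul := H.integrable_fun_mul
  integrable_mul φ := integrable_conj_neg_mul (H.integrable_mul _)
  integral_eq φ := by
    rw [integral_conj_neg_mul_eq H.integral_eq]
    simp

/-- Every test function is the Fourier transform of a Schwartz function, so a vanishing transform
makes $u$ vanish as a distribution. -/
theorem IsFourierTransformOf.ae_eq_zero {g : E → ℂ} {u : E → ℝ} (H : IsFourierTransformOf g u)
    (hg : g =ᵐ[volume] 0) : u =ᵐ[volume] 0 := by
  refine ae_eq_zero_of_integral_contDiff_smul_eq_zero H.locallyIntegrable_fun fun φ hφ hc => ?_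
  have h := H.integral_eq (𝓕⁻ (toSchwartzComplex φ hc hφ))
  rw [FourierTransform.fourier_fourierInv_eq, integral_eq_zero_of_ae] at h
  · have h2 : ((∫ x, φ x • u x : ℝ) : ℂ) = 0 := by
      rw [← integral_complex_ofReal, h]
      congr 1 with x
      simp [mul_comm]
    exact_mod_cast h2
  · filter_upwards [hg] with ξ hξ
    simp [hξ]

theorem HomSobolev.ext_ae {u v : HomSobolev d s} (h : u =ᵐ[volume] v) : u = v :=
  Subtype.ext (Lp.ext h)

theorem HomSobolev.fourier_neg (u : HomSobolev d s) :
    ∀ᵐ ξ, u.fourier (-ξ) = (starRingEnd ℂ) (u.fourier ξ) := by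
  filter_upwards [u.isFourierTransformOf.ae_eq u.isFourierTransformOf.conj_neg] with ξ hξ
  rw [hξ, Complex.conj_conj]

theorem HomSobolev.sobolevWeight_fourier_neg (u : HomSobolev d s) :
    ∀ᵐ ξ, sobolevWeight s u.fourier (-ξ) = (starRingEnd ℂ) (sobolevWeight s u.fourier ξ) := by
  filter_upwards [u.fourier_neg] with ξ hξ
  simp [sobolevWeight, hξ]

theorem ae_ne_zero_euclideanSpace (hd : 1 ≤ d) : ∀ᵐ ξ : E, ξ ≠ 0 := by
  have : Nontrivial E := Module.nontrivial_of_finrank_pos (R := ℝ) (by simp; omega)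
  simp [ae_iff, measure_singleton]

theorem sobolevWeight_rpow_neg_mul (s : ℝ) (G : E → ℂ) {ξ : E} (hξ : ξ ≠ 0) :
    sobolevWeight s (fun ξ => (((2 * Real.pi * ‖ξ‖) ^ (-s) : ℝ) : ℂ) * G ξ) ξ = G ξ := by
  have h1 : (0 : ℝ) < 2 * Real.pi * ‖ξ‖ := by positivity
  rw [sobolevWeight, ← mul_assoc, ← Complex.ofReal_mul, ← Real.rpow_add h1]
  simp

theorem HomSobolev.ext_sobolevWeight (hd : 1 ≤ d) {u v : HomSobolev d s}
    (h : sobolevWeight s u.fourier =ᵐ[volume] sobolevWeight s v.fourier) : u = v := by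
  have h1 := u.isFourierTransformOf.add (v.isFourierTransformOf.smul (-1))
  have h2 := h1.ae_eq_zero (by
    filter_upwards [h, ae_ne_zero_euclideanSpace hd] with ξ hξ hξ0
    have h3 : (0 : ℝ) < (2 * Real.pi * ‖ξ‖) ^ s := by positivity
    have h4 := mul_left_cancel₀ (Complex.ofReal_ne_zero.2 h3.ne') hξ
    simp [h4])
  refine HomSobolev.ext_ae ?_
  filter_upwards [h2] with x hx
  simp only [Pi.add_apply, Pi.smul_apply, Pi.zero_apply, smul_eq_mul] at hx
  linarith

theorem one_lt_sobolevExponent (hs : 0 < s) (hsd : 2 * s < d) :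
    1 < 2 * (d : ℝ) / (d - 2 * s) := by
  rw [one_lt_div (by linarith)]
  linarith

/-- The function with transform $|2\pi\xi|^{-s}G$ may be complex. Taking its real part replaces $G$
by its Hermitian part, so the range of the isometry consists of all Hermitian $L^2$ functions. -/
theorem HomSobolev.exists_sobolevWeight_eq (hs : 0 < s) (hsd : 2 * s < d) {G : E → ℂ}
    (hG : MemLp G 2) :
    ∃ U : HomSobolev d s, sobolevWeight s U.fourier =ᵐ[volume]
      fun ξ => (G ξ + (starRingEnd ℂ) (G (-ξ))) / 2 := by
  have hd0 : 0 < (d : ℝ) := by linarith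
  have hd : 1 ≤ d := by exact_mod_cast hd0
  have hV : 1 ≤ finrank ℝ E := by simpa using hd
  have hsV : 2 * s < finrank ℝ E := by simpa using hsd
  obtain ⟨u, hu, hφ⟩ := exists_memLp_integral_mul_fourier_eq hV hs hsV hG
  have hfin : (finrank ℝ E : ℝ) = d := by simp
  rw [hfin] at hu
  have hure : MemLp (fun x => (u x).re) (sobolevExponent d s) volume := hu.re
  have hG' : MemLp (fun ξ => (G ξ + (starRingEnd ℂ) (G (-ξ))) / 2) 2 volume := by
    have h1 : MemLp (fun ξ => (starRingEnd ℂ) (G (-ξ))) 2 volume :=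
      (hG.comp_measurePreserving (Measure.measurePreserving_neg _)).star
    simpa [div_eq_inv_mul] using (hG.add h1).const_mul (2⁻¹ : ℂ)
  set g : E → ℂ := fun ξ => (((2 * Real.pi * ‖ξ‖) ^ (-s) : ℝ) : ℂ) * G ξ with hg
  have hgi : ∀ φ : 𝓢(E, ℂ), Integrable fun ξ => g ξ * φ ξ :=
    integrable_rpow_neg_mul_schwartz hV hsV hG
  have hgi' : ∀ φ : 𝓢(E, ℂ), Integrable fun ξ => (starRingEnd ℂ) (g (-ξ)) * φ ξ := fun φ =>
    integrable_conj_neg_mul (hgi _)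
  have hge : ∀ φ : 𝓢(E, ℂ), ∫ ξ, g ξ * φ ξ = ∫ x, u x * 𝓕 φ x := fun φ => (hφ φ).2
  have hgc := integral_conj_neg_mul_eq hge
  have hui : ∀ φ : 𝓢(E, ℂ), Integrable fun x => (starRingEnd ℂ) (u x) * φ x := fun φ => by
    have := integrable_conj_neg_mul (g := fun x => u (-x)) (φ := φ) (by
      have := (hφ (SchwartzMap.compCLMOfContinuousLinearEquiv ℝ (ContinuousLinearEquiv.neg ℝ)
        φ.conjNeg)).1.comp_neg
      simpa using this)
    simpa using this
  have hre : ∀ x, ((u x).re : ℂ) = 2⁻¹ * (u x + (starRingEnd ℂ) (u x)) := fun x => by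
    rw [Complex.add_conj]; push_cast; ring
  set g' : E → ℂ := fun ξ => (((2 * Real.pi * ‖ξ‖) ^ (-s) : ℝ) : ℂ) *
    ((G ξ + (starRingEnd ℂ) (G (-ξ))) / 2) with hg'
  have hexp : ∀ ξ, g' ξ = 2⁻¹ * (g ξ + (starRingEnd ℂ) (g (-ξ))) := fun ξ => by
    simp only [hg, hg', map_mul, Complex.conj_ofReal, norm_neg]
    ring
  have hg'i : ∀ φ : 𝓢(E, ℂ), Integrable fun ξ => g' ξ * φ ξ := fun φ => by
    refine (((hgi φ).add (hgi' φ)).const_mul (2⁻¹ : ℂ)).congr (Eventually.of_forall fun ξ => ?_)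
    simp only [hexp, Pi.add_apply]
    ring
  have hF : IsFourierTransformOf g' fun x => (u x).re := by
    refine ⟨hure.locallyIntegrable ?_, locallyIntegrable_of_integrable_mul_schwartz hg'i,
      fun φ => ?_, hg'i, fun φ => ?_⟩
    · rw [sobolevExponent, ← ENNReal.ofReal_one]
      exact ENNReal.ofReal_le_ofReal (one_lt_sobolevExponent hs hsd).le
    · refine (((hφ φ).1.add (hui φ)).const_mul (2⁻¹ : ℂ)).congr (Eventually.of_forall fun x => ?_)
      simp only [hre, Pi.add_apply]
      ring
    · simp only [hexp, hre, mul_assoc, add_mul]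
      rw [integral_const_mul, integral_const_mul, integral_add (hgi φ) (hgi' φ),
        integral_add (hφ _).1 (hui _), hgc, hge]
  have hw : sobolevWeight s g' =ᵐ[volume] fun ξ => (G ξ + (starRingEnd ℂ) (G (-ξ))) / 2 := by
    filter_upwards [ae_ne_zero_euclideanSpace hd] with ξ hξ
    exact sobolevWeight_rpow_neg_mul s _ hξ
  have hF' := hF.congr_fun hure.coeFn_toLp.symm
  let U : HomSobolev d s := ⟨hure.toLp _, g', hF', (memLp_congr_ae hw).2 hG'⟩
  refine ⟨U, ?_⟩
  filter_upwards [U.isFourierTransformOf.ae_eq hF', hw] with ξ h1 h2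
  rw [← h2]
  simp only [sobolevWeight, h1]

theorem HomSobolev.inner_eq (u v : HomSobolev d s) : inner ℝ u v =
    ∫ ξ, (sobolevWeight s u.fourier ξ * (starRingEnd ℂ) (sobolevWeight s v.fourier ξ)).re := rfl

/-- The isometry `u ↦ (2π|ξ|)^s 𝓕 u` into `L²`, as a linear map. -/
noncomputable def HomSobolev.toL2 (d : ℕ) (s : ℝ) :
    HomSobolev d s →ₗ[ℝ] Lp ℂ 2 (volume : Measure (EuclideanSpace ℝ (Fin d))) where
  toFun u := u.memLp_sobolevWeight.toLp _
  map_add' u v := by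
    rw [← MemLp.toLp_add, MemLp.toLp_eq_toLp_iff]
    filter_upwards [HomSobolev.fourier_add u v] with ξ hξ
    simp [sobolevWeight, hξ, mul_add]
  map_smul' c u := by
    rw [RingHom.id_apply, ← MemLp.toLp_const_smul, MemLp.toLp_eq_toLp_iff]
    filter_upwards [HomSobolev.fourier_smul c u] with ξ hξ
    simp [sobolevWeight, hξ, mul_left_comm]

theorem HomSobolev.coeFn_toL2 (u : HomSobolev d s) :
    HomSobolev.toL2 d s u =ᵐ[volume] sobolevWeight s u.fourier :=
  u.memLp_sobolevWeight.coeFn_toLp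

theorem HomSobolev.inner_toL2 (G : Lp ℂ 2 (volume : Measure E)) (u : HomSobolev d s) :
    inner ℝ G (HomSobolev.toL2 d s u) =
      ∫ ξ, (G ξ * (starRingEnd ℂ) (sobolevWeight s u.fourier ξ)).re := by
  rw [L2.inner_def]
  refine integral_congr_ae ?_
  filter_upwards [u.coeFn_toL2] with ξ hξ
  rw [hξ, Complex.inner]
  simp only [Complex.mul_re, Complex.conj_re, Complex.conj_im]
  ring

theorem HomSobolev.inner_toL2_toL2 (u v : HomSobolev d s) :
    inner ℝ (HomSobolev.toL2 d s u) (HomSobolev.toL2 d s v) = inner ℝ u v := by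
  rw [HomSobolev.inner_toL2, HomSobolev.inner_eq]
  refine integral_congr_ae ?_
  filter_upwards [u.coeFn_toL2] with ξ hξ
  rw [hξ]

theorem HomSobolev.norm_toL2 (u : HomSobolev d s) : ‖HomSobolev.toL2 d s u‖ = ‖u‖ := by
  have h := HomSobolev.inner_toL2_toL2 u u
  rw [real_inner_self_eq_norm_sq, real_inner_self_eq_norm_sq] at h
  exact (sq_eq_sq₀ (norm_nonneg _) (norm_nonneg _)).1 h

theorem HomSobolev.toL2_injective (hd : 1 ≤ d) : Function.Injective (HomSobolev.toL2 d s) := by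
  intro u v h
  refine HomSobolev.ext_sobolevWeight hd ?_
  exact u.coeFn_toL2.symm.trans ((Filter.EventuallyEq.of_eq (by rw [h])).trans v.coeFn_toL2)

/-- Weighted transforms of real functions are Hermitian, so the substitution $\xi\mapsto-\xi$ shows
that $G$ and its reflected conjugate have the same real inner product with them. -/
theorem HomSobolev.inner_symmetrized (G : Lp ℂ 2 (volume : Measure E)) {U : HomSobolev d s}
    (hU : sobolevWeight s U.fourier =ᵐ[volume] fun ξ => (G ξ + (starRingEnd ℂ) (G (-ξ))) / 2)
    (u : HomSobolev d s) : inner ℝ U u = inner ℝ G (HomSobolev.toL2 d s u) := by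
  rw [HomSobolev.inner_toL2, HomSobolev.inner_eq]
  set h := sobolevWeight s u.fourier
  have hh : MemLp h 2 volume := u.memLp_sobolevWeight
  have hG : MemLp G 2 volume := Lp.memLp G
  have hGn : MemLp (fun ξ => (starRingEnd ℂ) (G (-ξ))) 2 volume :=
    (hG.comp_measurePreserving (Measure.measurePreserving_neg _)).star
  have i1 : Integrable (fun ξ => (G ξ * (starRingEnd ℂ) (h ξ)).re) :=
    (hG.integrable_mul hh.star).re
  have i2 : Integrable (fun ξ => ((starRingEnd ℂ) (G (-ξ)) * (starRingEnd ℂ) (h ξ)).re) :=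
    (hGn.integrable_mul hh.star).re
  have e : ∫ ξ, ((starRingEnd ℂ) (G (-ξ)) * (starRingEnd ℂ) (h ξ)).re =
      ∫ ξ, (G ξ * (starRingEnd ℂ) (h ξ)).re := by
    rw [← integral_neg_eq_self]
    refine integral_congr_ae ?_
    filter_upwards [u.sobolevWeight_fourier_neg] with ξ hξ
    have hξ' : h (-ξ) = (starRingEnd ℂ) (h ξ) := hξ
    rw [hξ', neg_neg, Complex.conj_conj]
    simp only [Complex.mul_re, Complex.conj_re, Complex.conj_im]
    ring
  calc _ = ∫ ξ, 2⁻¹ * ((G ξ * (starRingEnd ℂ) (h ξ)).re +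
        ((starRingEnd ℂ) (G (-ξ)) * (starRingEnd ℂ) (h ξ)).re) := by
        refine integral_congr_ae ?_
        filter_upwards [hU] with ξ hξ
        rw [hξ, ← Complex.add_re, ← add_mul, div_eq_inv_mul, mul_assoc,
          show (2⁻¹ : ℂ) = ((2⁻¹ : ℝ) : ℂ) by push_cast; rfl, Complex.re_ofReal_mul]
    _ = _ := by
        rw [integral_const_mul, integral_add i1 i2, e]
        ring

/-- The functional is transported to the range of the isometry and extended by Hahn–Banach, so the
Riesz theorem is applied in $L^2$ and completeness of the Sobolev space is not needed. The Hermitian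
part of the representative comes from an element of the space. Uniqueness uses definiteness, through
injectivity of the isometry. -/
theorem existsUnique_isWeakSolution (hs : 0 < s) (hsd : 2 * s < d)
    (τ : StrongDual ℝ (HomSobolev d s)) : ∃! U : HomSobolev d s, IsWeakSolution τ U := by
  have hd0 : 0 < (d : ℝ) := by linarith
  have hd : 1 ≤ d := by exact_mod_cast hd0
  have hinj := HomSobolev.toL2_injective (s := s) hd
  let e := LinearEquiv.ofInjective (HomSobolev.toL2 d s) hinj
  have he : ∀ x, HomSobolev.toL2 d s (e.symm x) = x := fun x =>
    congrArg Subtype.val (e.apply_symm_apply x)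
  let f : StrongDual ℝ (LinearMap.range (HomSobolev.toL2 d s)) :=
    LinearMap.mkContinuous (τ.toLinearMap ∘ₗ e.symm.toLinearMap) ‖τ‖ fun x => by
      refine (τ.le_opNorm _).trans (le_of_eq ?_)
      rw [← HomSobolev.norm_toL2]
      exact congrArg (fun y => ‖τ‖ * ‖y‖) (he x)
  obtain ⟨F, hF, -⟩ := exists_extension_norm_eq _ f
  set G := (InnerProductSpace.toDual ℝ _).symm F with hG
  have hτ : ∀ u, τ u = inner ℝ G (HomSobolev.toL2 d s u) := by
    intro u
    rw [hG, InnerProductSpace.toDual_symm_apply]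
    have h1 := hF (e u)
    have h2 : f (e u) = τ u := congrArg τ (e.symm_apply_apply u)
    exact (h1.trans h2).symm
  obtain ⟨U, hU⟩ := HomSobolev.exists_sobolevWeight_eq hs hsd (Lp.memLp G)
  refine ⟨U, fun φ => ?_, fun W hW => hinj ?_⟩
  · rw [hτ, HomSobolev.inner_symmetrized G hU]
  · rw [← sub_eq_zero, ← map_sub, ← norm_eq_zero, HomSobolev.norm_toL2]
    have h : inner ℝ (W - U) (W - U) = 0 := by
      rw [inner_sub_left, ← hW, hτ, HomSobolev.inner_symmetrized G hU, sub_self]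
    exact (pow_eq_zero_iff two_ne_zero).1 ((real_inner_self_eq_norm_sq (W - U)).symm.trans h)

end HomSobolevSpace

/-! ### Spatial cutoffs seen in frequency -/

section SpatialCutoff

open Filter Topology Module Set

variable {V : Type*} [NormedAddCommGroup V] [InnerProductSpace ℝ V] [FiniteDimensional ℝ V]
  [MeasurableSpace V] [BorelSpace V]

/-- Multiplication by $M(rx)$ is convolution in frequency with an $L^1$-normalized dilate of a
Schwartz function, which concentrates as $r\to0$. Its weighted $L^1$ norm is therefore bounded for
$r\le1$, and Peetre's inequality gives a bound independent of $r$. -/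
theorem exists_norm_fourier_cutoff_mul_le (M Φ : 𝓢(V, ℂ)) {a : ℝ} (ha : 0 ≤ a) :
    ∃ C : ℝ, 0 ≤ C ∧ ∀ r : ℝ, 0 < r → r ≤ 1 → ∀ ξ,
      ‖𝓕 (fun x => M (r • x) * Φ x) ξ‖ ≤ C * (1 + ‖ξ‖) ^ (-a) := by
  obtain ⟨D, hD, h⟩ := (𝓕⁻ Φ).exists_norm_le_one_add_norm_rpow_neg a
  have hI := (𝓕⁻ M).integrable_norm_mul_one_add_norm_rpow a
  set J := ∫ y, ‖(𝓕⁻ M) y‖ * (1 + ‖y‖) ^ a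
  have hJ : 0 ≤ J := integral_nonneg fun y => by positivity
  refine ⟨D * J, by positivity, fun r hr hr1 ξ => ?_⟩
  let e : V ≃L[ℝ] V := ContinuousLinearEquiv.smulLeft (Units.mk0 r hr.ne')
  set Mr : 𝓢(V, ℂ) := SchwartzMap.compCLMOfContinuousLinearEquiv ℝ e M with hMr
  have hMr' : ∀ x, Mr x = M (r • x) := fun x => rfl
  have hψ : ∀ y, (𝓕⁻ Mr) y = (r ^ (-(finrank ℝ V : ℝ)) : ℝ) • (𝓕⁻ M) (r⁻¹ • y) := by
    intro y
    rw [SchwartzMap.fourierInv_coe, SchwartzMap.fourierInv_coe, ← fourierInv_comp_smul _ hr]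
    rfl
  have hMr'' : ∀ x, 𝓕 ((𝓕⁻ Mr : 𝓢(V, ℂ)) : V → ℂ) x = M (r • x) := fun x => by
    rw [← SchwartzMap.fourier_coe, FourierTransform.fourier_fourierInv_eq, hMr']
  have key : ∫ y, ‖(𝓕⁻ Mr) y‖ * (1 + ‖y‖) ^ a ≤ J := by
    have h1 := Measure.integral_comp_smul_of_nonneg (volume : Measure V)
      (fun y => ‖(𝓕⁻ M) y‖ * (1 + ‖r • y‖) ^ a) r⁻¹ (hR := by positivity)
    have h2 : ∀ y, ‖(𝓕⁻ Mr) y‖ * (1 + ‖y‖) ^ a = r ^ (-(finrank ℝ V : ℝ)) *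
        (‖(𝓕⁻ M) (r⁻¹ • y)‖ * (1 + ‖r • r⁻¹ • y‖) ^ a) := fun y => by
      rw [hψ, norm_smul, Real.norm_of_nonneg (by positivity), smul_inv_smul₀ hr.ne', mul_assoc]
    have hr2 : r ^ (-(finrank ℝ V : ℝ)) * ((r⁻¹) ^ finrank ℝ V)⁻¹ = 1 := by
      rw [Real.rpow_neg hr.le, Real.rpow_natCast, inv_pow, inv_inv]
      exact inv_mul_cancel₀ (by positivity)
    simp only [h2]
    rw [integral_const_mul, h1, smul_eq_mul, ← mul_assoc, hr2, one_mul]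
    refine integral_mono_of_nonneg (Eventually.of_forall fun y => by positivity) hI
      (Eventually.of_forall fun y => ?_)
    have : ‖r • y‖ ≤ ‖y‖ := by
      rw [norm_smul, Real.norm_of_nonneg hr.le]
      exact mul_le_of_le_one_left (norm_nonneg _) hr1
    beta_reduce
    gcongr
  have e1 : 𝓕 (fun x => M (r • x) * Φ x) ξ =
      𝓕⁻ (fun x => Φ x * 𝓕 ((𝓕⁻ Mr : 𝓢(V, ℂ)) : V → ℂ) x) (-ξ) := by
    rw [← fourier_neg_eq_fourierInv, neg_neg]
    exact congrArg (fun g : V → ℂ => 𝓕 g ξ) (funext fun x => by rw [hMr'', mul_comm])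
  rw [e1, fourierInv_mul_fourier_eq_integral Φ.integrable (𝓕⁻ Mr).integrable]
  calc ‖∫ y, (𝓕⁻ Mr) y * 𝓕⁻ (Φ : V → ℂ) (-ξ - y)‖
      ≤ ∫ y, D * (1 + ‖ξ‖) ^ (-a) * (‖(𝓕⁻ Mr) y‖ * (1 + ‖y‖) ^ a) := by
        refine norm_integral_le_of_norm_le
          (((𝓕⁻ Mr).integrable_norm_mul_one_add_norm_rpow a).const_mul _)
          (Eventually.of_forall fun y => ?_)
        rw [norm_mul, ← SchwartzMap.fourierInv_coe]
        have h3 := one_add_norm_rpow_neg_sub_le ha (-ξ) y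
        rw [norm_neg] at h3
        calc ‖(𝓕⁻ Mr) y‖ * ‖(𝓕⁻ Φ) (-ξ - y)‖
            ≤ ‖(𝓕⁻ Mr) y‖ * (D * ((1 + ‖ξ‖) ^ (-a) * (1 + ‖y‖) ^ a)) := by
              gcongr
              exact (h _).trans (by gcongr)
          _ = _ := by ring
    _ ≤ D * (1 + ‖ξ‖) ^ (-a) * J := by
        rw [integral_const_mul]
        gcongr
    _ = _ := by ring

theorem tendsto_fourier_of_dominated {F : ℕ → V → ℂ} {G : V → ℂ} {bound : V → ℝ}
    (hm : ∀ k, AEStronglyMeasurable (F k) volume) (hb : Integrable bound)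
    (h : ∀ k, ∀ᵐ x, ‖F k x‖ ≤ bound x)
    (hlim : ∀ᵐ x, Tendsto (fun k => F k x) atTop (𝓝 (G x))) (ξ : V) :
    Tendsto (fun k => 𝓕 (F k) ξ) atTop (𝓝 (𝓕 G ξ)) := by
  have e : ∀ f : V → ℂ, 𝓕 f ξ = 𝓕⁻ f (-ξ) := fun f => by
    rw [← fourier_neg_eq_fourierInv, neg_neg]
  simp only [e]
  exact tendsto_fourierInv_of_dominated hm hb h hlim _

theorem hasTemperateGrowth_highFreq (r : ℝ) (k : ℕ) :
    Function.HasTemperateGrowth fun ξ : V =>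
      (1 - freqCutoff ((2 : ℝ) ^ k • ξ)) * (2 * Real.pi * ‖ξ‖) ^ r := by
  have h := (Function.HasTemperateGrowth.const (E := V) ((((2 : ℝ) ^ k) ^ (-r)) : ℝ)).mul
    (hasTemperateGrowth_comp_const_smul (hasTemperateGrowth_highFreqPow (V := V) r) ((2 : ℝ) ^ k))
  refine Eq.subst (motive := Function.HasTemperateGrowth) (funext fun ξ => ?_) h
  have h2 : ((2 : ℝ) ^ k) ^ (-r) * ((2 : ℝ) ^ k) ^ r = 1 := by
    rw [← Real.rpow_add (by positivity), neg_add_cancel, Real.rpow_zero]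
  rw [Pi.mul_apply, highFreqPow, norm_smul, Real.norm_of_nonneg (by positivity),
    mul_left_comm (2 * Real.pi), Real.mul_rpow (by positivity) (by positivity)]
  linear_combination ((1 - freqCutoff ((2 : ℝ) ^ k • ξ)) * (2 * Real.pi * ‖ξ‖) ^ r) * h2

theorem conj_fourierInv_of_hermitian {F : V → ℂ} (hF : ∀ ξ, F (-ξ) = (starRingEnd ℂ) (F ξ))
    (x : V) : (starRingEnd ℂ) (𝓕⁻ F x) = 𝓕⁻ F x := by
  rw [conj_fourierInv, Real.fourierInv_eq_fourier_comp_neg]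
  exact congrArg (fun g : V → ℂ => 𝓕 g x) (funext fun ξ => (hF ξ).symm)

theorem fourierInv_fourierInv_of_hermitian {F : 𝓢(V, ℂ)}
    (hF : ∀ ξ, F (-ξ) = (starRingEnd ℂ) (F ξ)) (ξ : V) :
    (𝓕⁻ (𝓕⁻ F)) ξ = (starRingEnd ℂ) (F ξ) := by
  rw [SchwartzMap.fourierInv_coe, ← fourier_neg_eq_fourierInv, ← SchwartzMap.fourier_coe,
    FourierTransform.fourier_fourierInv_eq, hF]

end SpatialCutoff

/-! ### From test functions to Schwartz functions -/

section TestFunctions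

open Filter Topology Module Set

variable {d : ℕ} {s : ℝ}

local notation "E" => EuclideanSpace ℝ (Fin d)

theorem HomSobolev.exists_of_schwartz (hs : 0 < s) (hsd : 2 * s < d) (Φ : 𝓢(E, ℂ)) {f : E → ℝ}
    (hΦ : ∀ x, Φ x = f x) :
    ∃ u : HomSobolev d s, u =ᵐ[volume] f ∧ u.fourier =ᵐ[volume] 𝓕 (Φ : E → ℂ) := by
  have hd0 : 0 < (d : ℝ) := by linarith
  have hd : 1 ≤ d := by exact_mod_cast hd0
  have hV : 1 ≤ finrank ℝ E := by simpa using hd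
  have hf : ∀ x, f x = (Φ x).re := fun x => by rw [hΦ]; simp
  have hfp : MemLp f (sobolevExponent d s) volume := by
    have := (Φ.memLp (sobolevExponent d s)).re
    exact (memLp_congr_ae (Eventually.of_forall fun x => hf x)).2 this
  have hg : ∀ φ : 𝓢(E, ℂ), Integrable fun ξ => 𝓕 (Φ : E → ℂ) ξ * φ ξ := fun φ =>
    ((𝓕 Φ).memLp 2).integrable_mul (φ.memLp 2)
  have hF : IsFourierTransformOf (𝓕 (Φ : E → ℂ)) f := by
    refine ⟨hfp.locallyIntegrable ?_, locallyIntegrable_of_integrable_mul_schwartz hg,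
      fun φ => ?_, hg, fun φ => ?_⟩
    · rw [sobolevExponent, ← ENNReal.ofReal_one]
      exact ENNReal.ofReal_le_ofReal (one_lt_sobolevExponent hs hsd).le
    · simp only [← hΦ]
      exact (Φ.memLp 2).integrable_mul (φ.memLp 2)
    · simp only [← hΦ]
      rw [integral_fourier_mul_eq_flip Φ.integrable φ.integrable]
      rfl
  have hF' := hF.congr_fun hfp.coeFn_toLp.symm
  have hw : MemLp (sobolevWeight s (𝓕 (Φ : E → ℂ))) 2 volume :=
    SchwartzMap.memLp_two_pi_norm_rpow_mul hV (r := s) (by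
      have : (0 : ℝ) ≤ finrank ℝ E := by positivity
      linarith) (𝓕 Φ)
  let U : HomSobolev d s := ⟨hfp.toLp _, _, hF', hw⟩
  exact ⟨U, hfp.coeFn_toLp, U.isFourierTransformOf.ae_eq hF'⟩

theorem two_pi_norm_rpow_mul_self (s : ℝ) (hs : 0 < s) (ξ : E) :
    (2 * Real.pi * ‖ξ‖) ^ s * (2 * Real.pi * ‖ξ‖) ^ s = (2 * Real.pi * ‖ξ‖) ^ (2 * s) := by
  rw [← Real.rpow_add_of_nonneg (by positivity) hs.le hs.le, two_mul s]

/-- The defining identity of the transform is applied to $\mathscr F^{-1}\mathscr F^{-1}F$: its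
transform is $\mathscr F^{-1}F$, and by Hermitian symmetry it equals $\overline F$. The factor
$|2\pi\xi|^{2s}$ is then shared equally between the two sides. -/
theorem HomSobolev.integral_mul_fourierInv_eq (hs : 0 < s) (U : HomSobolev d s) {F F' : 𝓢(E, ℂ)}
    (hF : ∀ ξ, F (-ξ) = (starRingEnd ℂ) (F ξ))
    (h : ∀ ξ, F ξ = (((2 * Real.pi * ‖ξ‖) ^ (2 * s) : ℝ) : ℂ) * F' ξ) :
    ∫ x, (U x : ℂ) * 𝓕⁻ (F : E → ℂ) x =
      ∫ ξ, sobolevWeight s U.fourier ξ * (starRingEnd ℂ) (sobolevWeight s F' ξ) := by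
  have h1 := U.isFourierTransformOf.integral_eq (𝓕⁻ (𝓕⁻ F))
  rw [FourierTransform.fourier_fourierInv_eq] at h1
  rw [← SchwartzMap.fourierInv_coe, ← h1]
  congr 1 with ξ
  rw [fourierInv_fourierInv_of_hermitian hF, h, sobolevWeight,
    sobolevWeight, ← two_pi_norm_rpow_mul_self s hs]
  simp only [map_mul, Complex.conj_ofReal, Complex.ofReal_mul]
  ring

theorem memLp_two_pi_norm_rpow_mul_weight (hs : 0 < s) :
    MemLp (fun ξ : E => (2 * Real.pi * ‖ξ‖) ^ s * (1 + ‖ξ‖) ^ (-(s + d + 1))) 2 volume := by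
  -- In the exponent $s+d+1$, the $s$ cancels the growth of $|\xi|^s$ and $d+1$ is enough for square
  -- integrability, as $2(d+1)>d$.
  have h := memLp_one_add_norm_rpow_neg (volume : Measure E) (a := d + 1) (p := 2) (by norm_num)
    (by simp; nlinarith [(Nat.cast_nonneg d : (0 : ℝ) ≤ d)])
  rw [ENNReal.ofReal_ofNat] at h
  refine (h.const_mul ((2 * Real.pi) ^ s)).mono ?_ (Eventually.of_forall fun ξ => ?_)
  · exact ((measurable_two_pi_norm_rpow s).mul
      (continuous_one_add_norm_rpow _).measurable).aestronglyMeasurable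
  · rw [Real.norm_of_nonneg (by positivity), Real.norm_of_nonneg (by positivity),
      Real.mul_rpow (by positivity) (norm_nonneg _),
      show -(s + d + 1) = -s + -((d : ℝ) + 1) by ring, Real.rpow_add (by positivity),
      Real.rpow_neg (by positivity)]
    have h1 : ‖ξ‖ ^ s ≤ (1 + ‖ξ‖) ^ s := Real.rpow_le_rpow (norm_nonneg _) (by linarith) hs.le
    have h2 : 0 < (1 + ‖ξ‖) ^ s := by positivity
    calc (2 * Real.pi) ^ s * ‖ξ‖ ^ s * (((1 + ‖ξ‖) ^ s)⁻¹ * (1 + ‖ξ‖) ^ (-((d : ℝ) + 1)))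
        ≤ (2 * Real.pi) ^ s * (1 + ‖ξ‖) ^ s *
          (((1 + ‖ξ‖) ^ s)⁻¹ * (1 + ‖ξ‖) ^ (-((d : ℝ) + 1))) := by gcongr
      _ = _ := by field_simp

/-- A Sobolev function representing `T` against test functions represents it against real Schwartz
functions. -/
theorem HomSobolev.inner_schwartz_eq_integral (hs : 0 < s) (hsd : 2 * s < d) {T : E → ℝ}
    {c : ℝ} (hT : Integrable fun x => T x * (1 + ‖x‖) ^ (-c)) {U : HomSobolev d s}
    (hU : ∀ (φ : E → ℝ) (ψ : HomSobolev d s), ContDiff ℝ ∞ φ → HasCompactSupport φ →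
      ψ =ᵐ[volume] φ → inner ℝ U ψ = ∫ x, T x * φ x)
    (Φ : 𝓢(E, ℂ)) {f : E → ℝ} (hΦ : ∀ x, Φ x = f x) :
    ∫ ξ, (sobolevWeight s U.fourier ξ *
      (starRingEnd ℂ) (sobolevWeight s (𝓕 (Φ : E → ℂ)) ξ)).re = ∫ x, T x * f x := by
  have hf : f = fun x => (Φ x).re := funext fun x => by rw [hΦ]; simp
  have hfd : ContDiff ℝ ∞ f := by
    rw [hf]
    exact Complex.reCLM.contDiff.comp Φ.smooth'
  set M := toSchwartzComplex _ (hasCompactSupport_freqCutoff (V := E)) contDiff_freqCutoff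
  -- $\Phi$ is approximated by its products with cutoffs at scale $2^k$, which are test functions.
  -- This bound, uniform in $k$, supplies the majorant for the limit on the frequency side; on the
  -- space side the decay of $\Phi$ suffices.
  obtain ⟨C, hC, hbd⟩ := exists_norm_fourier_cutoff_mul_le M Φ (a := s + d + 1) (by positivity)
  set r : ℕ → ℝ := fun k => ((2 : ℝ) ^ k)⁻¹ with hr
  have hr0 : ∀ k, 0 < r k := fun k => by positivity
  have hr1 : ∀ k, r k ≤ 1 := fun k => inv_le_one_of_one_le₀ (one_le_pow₀ one_le_two)
  have hrt : Tendsto r atTop (𝓝 0) :=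
    tendsto_inv_atTop_zero.comp (tendsto_pow_atTop_atTop_of_one_lt one_lt_two)
  have hcut : ∀ x : E, Tendsto (fun k => freqCutoff (r k • x)) atTop (𝓝 1) := by
    intro x
    have h1 : Tendsto (fun k => freqCutoff (r k • x)) atTop (𝓝 (freqCutoff ((0 : ℝ) • x))) :=
      (contDiff_freqCutoff.continuous.tendsto _).comp (hrt.smul_const x)
    rwa [freqCutoff_eq_one (by simp)] at h1
  set φ : ℕ → E → ℝ := fun k x => freqCutoff (r k • x) * f x with hφ
  have hφd : ∀ k, ContDiff ℝ ∞ (φ k) := fun k =>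
    (contDiff_freqCutoff.comp (contDiff_const_smul _)).mul hfd
  have hφc : ∀ k, HasCompactSupport (φ k) := fun k =>
    (hasCompactSupport_freqCutoff.comp_smul (hr0 k).ne').mul_right
  have hfour : ∀ k, 𝓕 (toSchwartzComplex (φ k) (hφc k) (hφd k) : E → ℂ) =
      𝓕 (fun x => M (r k • x) * Φ x) := by
    intro k
    congr 1
    ext x
    simp [hφ, hΦ, M]
  have hstep : ∀ k, ∫ ξ, (sobolevWeight s U.fourier ξ * (starRingEnd ℂ)
      (sobolevWeight s (𝓕 (fun x => M (r k • x) * Φ x)) ξ)).re = ∫ x, T x * φ k x := by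
    intro k
    obtain ⟨u, hu, hu'⟩ := HomSobolev.exists_of_schwartz hs hsd
      (toSchwartzComplex (φ k) (hφc k) (hφd k)) (f := φ k) fun x => rfl
    rw [← hU (φ k) u (hφd k) (hφc k) hu, HomSobolev.inner_eq]
    refine integral_congr_ae ?_
    filter_upwards [hu'] with ξ hξ
    simp only [sobolevWeight, hξ, hfour k]
  have hTm := aestronglyMeasurable_of_integrable_mul_weight hT
  have lim1 : Tendsto (fun k => ∫ x, T x * φ k x) atTop (𝓝 (∫ x, T x * f x)) := by
    obtain ⟨D, hD, hDf⟩ := Φ.exists_norm_le_one_add_norm_rpow_neg c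
    have hfb : ∀ x, |f x| ≤ D * (1 + ‖x‖) ^ (-c) := fun x => by
      have := hDf x
      rwa [hΦ, Complex.norm_real, Real.norm_eq_abs] at this
    refine tendsto_integral_of_dominated_convergence
      (fun x => D * ‖T x * (1 + ‖x‖) ^ (-c)‖) (fun k => ?_) (hT.norm.const_mul D)
      (fun k => Eventually.of_forall fun x => ?_) (Eventually.of_forall fun x => ?_)
    · exact hTm.mul (hφd k).continuous.aestronglyMeasurable
    · rw [norm_mul (T x), norm_mul (T x) ((1 + ‖x‖) ^ (-c)),
        Real.norm_of_nonneg (r := (1 + ‖x‖) ^ (-c)) (by positivity)]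
      have h1 : ‖freqCutoff (r k • x) * f x‖ ≤ D * (1 + ‖x‖) ^ (-c) := by
        rw [norm_mul, Real.norm_of_nonneg (freqCutoff_nonneg _)]
        exact (mul_le_of_le_one_left (norm_nonneg _) (freqCutoff_le_one _)).trans (hfb x)
      calc ‖T x‖ * ‖freqCutoff (r k • x) * f x‖ ≤ ‖T x‖ * (D * (1 + ‖x‖) ^ (-c)) := by gcongr
        _ = _ := by ring
    · have := ((hcut x).mul_const (f x)).const_mul (T x)
      simpa [hφ] using this
  have hw : MemLp (sobolevWeight s U.fourier) 2 volume := U.memLp_sobolevWeight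
  have lim2 : Tendsto (fun k => ∫ ξ, (sobolevWeight s U.fourier ξ * (starRingEnd ℂ)
      (sobolevWeight s (𝓕 (fun x => M (r k • x) * Φ x)) ξ)).re) atTop
      (𝓝 (∫ ξ, (sobolevWeight s U.fourier ξ *
        (starRingEnd ℂ) (sobolevWeight s (𝓕 (Φ : E → ℂ)) ξ)).re)) := by
    have hlim : ∀ ξ, Tendsto (fun k => 𝓕 (fun x => M (r k • x) * Φ x) ξ) atTop
        (𝓝 (𝓕 (Φ : E → ℂ) ξ)) := by
      refine tendsto_fourier_of_dominated (bound := fun x => ‖Φ x‖) (fun k => ?_)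
        Φ.integrable.norm (fun k => Eventually.of_forall fun x => ?_)
        (Eventually.of_forall fun x => ?_)
      · exact ((M.continuous.comp (continuous_const_smul _)).mul
          Φ.continuous).aestronglyMeasurable
      · rw [norm_mul]
        refine mul_le_of_le_one_left (norm_nonneg _) ?_
        simp only [M, toSchwartzComplex_apply, Complex.norm_real]
        rw [Real.norm_of_nonneg (freqCutoff_nonneg _)]
        exact freqCutoff_le_one _
      · have h1 : Tendsto (fun k => M (r k • x)) atTop (𝓝 1) := by
          simpa [M, Function.comp_def] using (Complex.continuous_ofReal.tendsto 1).comp (hcut x)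
        simpa using h1.mul_const (Φ x)
    have hb : Integrable fun ξ => ‖sobolevWeight s U.fourier ξ‖ *
        ((2 * Real.pi * ‖ξ‖) ^ s * (1 + ‖ξ‖) ^ (-(s + d + 1))) :=
      hw.norm.integrable_mul (memLp_two_pi_norm_rpow_mul_weight hs)
    refine tendsto_integral_of_dominated_convergence _ (fun k => ?_) (hb.const_mul C)
      (fun k => Eventually.of_forall fun ξ => ?_) (Eventually.of_forall fun ξ => ?_)
    · refine Complex.continuous_re.comp_aestronglyMeasurable (hw.1.mul
        (Complex.continuous_conj.comp_aestronglyMeasurable ?_))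
      refine AEStronglyMeasurable.mul (Complex.measurable_ofReal.comp
        (measurable_two_pi_norm_rpow s)).aestronglyMeasurable ?_
      rw [← hfour k]
      exact (𝓕 (toSchwartzComplex (φ k) (hφc k) (hφd k))).continuous.aestronglyMeasurable
    · refine (Complex.abs_re_le_norm _).trans ?_
      rw [norm_mul, RCLike.norm_conj, sobolevWeight, sobolevWeight, norm_mul _ (𝓕 (fun x => M (r k • x) * Φ x) ξ),
        Complex.norm_real, Real.norm_of_nonneg (by positivity : 0 ≤ (2 * Real.pi * ‖ξ‖) ^ s)]
      calc _ ≤ ‖(((2 * Real.pi * ‖ξ‖) ^ s : ℝ) : ℂ) * U.fourier ξ‖ *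
            ((2 * Real.pi * ‖ξ‖) ^ s * (C * (1 + ‖ξ‖) ^ (-(s + d + 1)))) := by
            gcongr
            exact hbd _ (hr0 k) (hr1 k) ξ
        _ = _ := by ring
    · have h1 : Tendsto (fun k => sobolevWeight s (𝓕 (fun x => M (r k • x) * Φ x)) ξ) atTop
          (𝓝 (sobolevWeight s (𝓕 (Φ : E → ℂ)) ξ)) := (hlim ξ).const_mul _
      exact (Complex.continuous_re.tendsto _).comp
        (((Complex.continuous_conj.tendsto _).comp h1).const_mul _)
  exact tendsto_nhds_unique lim2 (lim1.congr fun k => (hstep k).symm)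

end TestFunctions

/-! ### Identification with the Riesz potential -/

section WeakSolutions

open Filter Topology Module Set

variable {d : ℕ} {s : ℝ}

local notation "E" => EuclideanSpace ℝ (Fin d)

theorem realMul_fourier_hermitian {m : E → ℝ} (hm : m.HasTemperateGrowth)
    (hmneg : ∀ ξ, m (-ξ) = m ξ) {f : 𝓢(E, ℂ)} {φ : E → ℝ} (hf : ∀ x, f x = φ x) (ξ : E) :
    ((𝓕 f).realMul m) (-ξ) = (starRingEnd ℂ) (((𝓕 f).realMul m) ξ) := by
  have e : (f : E → ℂ) = fun x => (φ x : ℂ) := funext hf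
  rw [SchwartzMap.realMul_apply hm, SchwartzMap.realMul_apply hm, SchwartzMap.fourier_coe, hmneg,
    map_mul, Complex.conj_ofReal, e, conj_fourier_ofReal]

theorem highFreq_neg (r : ℝ) (k : ℕ) (ξ : E) :
    (1 - freqCutoff ((2 : ℝ) ^ k • -ξ)) * (2 * Real.pi * ‖-ξ‖) ^ r =
      (1 - freqCutoff ((2 : ℝ) ^ k • ξ)) * (2 * Real.pi * ‖ξ‖) ^ r := by
  rw [smul_neg, freqCutoff_neg, norm_neg]

/-- At the origin the cutoff makes both sides zero, so the exponents may have any sign. -/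
theorem highFreq_add (r t : ℝ) (k : ℕ) (ξ : E) :
    (1 - freqCutoff ((2 : ℝ) ^ k • ξ)) * (2 * Real.pi * ‖ξ‖) ^ (r + t) =
      (2 * Real.pi * ‖ξ‖) ^ r *
        ((1 - freqCutoff ((2 : ℝ) ^ k • ξ)) * (2 * Real.pi * ‖ξ‖) ^ t) := by
  rcases eq_or_ne ξ 0 with rfl | hξ
  · simp [freqCutoff_eq_one]
  · rw [Real.rpow_add (by positivity)]
    ring

theorem ofReal_re_fourierInv {F : E → ℂ} (hF : ∀ ξ, F (-ξ) = (starRingEnd ℂ) (F ξ)) (x : E) :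
    (((𝓕⁻ F x).re : ℝ) : ℂ) = 𝓕⁻ F x :=
  Complex.conj_eq_iff_re.1 (conj_fourierInv_of_hermitian hF x)

theorem integral_ofReal_mul_re (v : E → ℝ) {ψ : E → ℂ} (hψ : ∀ x, (((ψ x).re : ℝ) : ℂ) = ψ x) :
    ∫ x, (v x : ℂ) * ψ x = ((∫ x, v x * (ψ x).re : ℝ) : ℂ) := by
  rw [← integral_complex_ofReal]
  congr 1 with x
  rw [Complex.ofReal_mul, hψ]

theorem HomSobolev.integrable_mul_weight (hs : 0 < s) (hsd : 2 * s < d) (U : HomSobolev d s)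
    {a : ℝ} (ha : (d : ℝ) / 2 + s < a) : Integrable fun x => U x * (1 + ‖x‖) ^ (-a) := by
  have hd0 : 0 < (d : ℝ) := by linarith
  have hU : MemLp U (ENNReal.ofReal (2 * (d : ℝ) / (d - 2 * s))) volume := Lp.memLp U.toLp
  refine hU.integrable_mul_one_add_norm_rpow_neg (one_lt_sobolevExponent hs hsd) ?_
  have : (d : ℝ) * (1 - 1 / (2 * (d : ℝ) / (d - 2 * s))) = d / 2 + s := by
    field_simp
    ring
  rw [finrank_euclideanSpace_fin, this]
  exact ha

/-- The Liouville theorem is applied to the difference. `hsa` makes $U$ integrable against the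
weight with exponent $a$, `hca` does so for the potential, and `had` is what the Liouville theorem
needs. The hypothesis on $U$ concerns test functions only, so weak and distributional solutions are
both covered. -/
theorem HomSobolev.ae_eq_rieszPotential (hs : 0 < s) (hsd : 2 * s < d) {a c : ℝ} (hc : 0 ≤ c)
    (hca : c < a - 2 * s) (had : a < d) (hsa : (d : ℝ) / 2 + s < a) {T : E → ℝ}
    (hT : Integrable fun x => T x * (1 + ‖x‖) ^ (-c)) {U : HomSobolev d s}
    (hU : ∀ (φ : E → ℝ) (ψ : HomSobolev d s), ContDiff ℝ ∞ φ → HasCompactSupport φ →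
      ψ =ᵐ[volume] φ → inner ℝ U ψ = ∫ x, T x * φ x) :
    U =ᵐ[volume] rieszPotential (2 * s) T := by
  have hα : 0 < 2 * s := by linarith
  have ha0 : 0 ≤ a := by linarith
  have hcd : c ≤ d - 2 * s := by linarith
  have hUa := U.integrable_mul_weight hs hsd hsa
  have hRa := integrable_rieszPotential_mul_weight hα hsd hc hca hcd hT
  have hv : Integrable fun x => (U x - rieszPotential (2 * s) T x) * (1 + ‖x‖) ^ (-a) := by
    simp only [sub_mul]
    exact hUa.sub hRa
  have key := ae_eq_zero_of_integral_mul_highFreq_eq_zero ha0 (by simpa using had) hv ?_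
  · filter_upwards [key] with x hx
    exact sub_eq_zero.1 hx
  intro φ hφ hφc k
  set f := toSchwartzComplex φ hφc hφ
  -- $F$ is the high-frequency part of $\mathscr F\varphi$, and $F'$ is $F$ divided by
  -- $|2\pi\xi|^{2s}$, Schwartz because of the cutoff. The exponent $0$ places $F$ in the same
  -- family of multipliers.
  set F : 𝓢(E, ℂ) := (𝓕 f).realMul fun ξ =>
    (1 - freqCutoff ((2 : ℝ) ^ k • ξ)) * (2 * Real.pi * ‖ξ‖) ^ (0 : ℝ) with hFdef
  set F' : 𝓢(E, ℂ) := (𝓕 f).realMul fun ξ =>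
    (1 - freqCutoff ((2 : ℝ) ^ k • ξ)) * (2 * Real.pi * ‖ξ‖) ^ (-(2 * s)) with hF'def
  have hF : ∀ ξ, F (-ξ) = (starRingEnd ℂ) (F ξ) :=
    realMul_fourier_hermitian (hasTemperateGrowth_highFreq 0 k) (highFreq_neg 0 k) fun x => rfl
  have hF' : ∀ ξ, F' (-ξ) = (starRingEnd ℂ) (F' ξ) :=
    realMul_fourier_hermitian (hasTemperateGrowth_highFreq _ k) (highFreq_neg _ k) fun x => rfl
  have hFF' : ∀ ξ, F ξ = (((2 * Real.pi * ‖ξ‖) ^ (2 * s) : ℝ) : ℂ) * F' ξ := fun ξ => by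
    rw [hFdef, hF'def, SchwartzMap.realMul_apply (hasTemperateGrowth_highFreq _ k),
      SchwartzMap.realMul_apply (hasTemperateGrowth_highFreq _ k), ← mul_assoc,
      ← Complex.ofReal_mul, ← highFreq_add, add_neg_cancel]
  have hF'F : ∀ ξ, (((2 * Real.pi * ‖ξ‖) ^ (-(2 * s)) : ℝ) : ℂ) * F ξ = F' ξ := fun ξ => by
    rw [hFdef, hF'def, SchwartzMap.realMul_apply (hasTemperateGrowth_highFreq _ k),
      SchwartzMap.realMul_apply (hasTemperateGrowth_highFreq _ k), ← mul_assoc,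
      ← Complex.ofReal_mul, ← highFreq_add, add_zero]
  have hψ : 𝓕⁻ (fun ξ => ((1 - freqCutoff ((2 : ℝ) ^ k • ξ) : ℝ) : ℂ) *
      𝓕 (fun y => (φ y : ℂ)) ξ) = 𝓕⁻ (F : E → ℂ) := by
    congr 1
    funext ξ
    rw [hFdef, SchwartzMap.realMul_apply (hasTemperateGrowth_highFreq _ k), Real.rpow_zero,
      mul_one, SchwartzMap.fourier_coe]
    rfl
  rw [hψ]
  obtain ⟨C, hC, hbd⟩ := (𝓕⁻ F).exists_norm_le_one_add_norm_rpow_neg a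
  rw [SchwartzMap.fourierInv_coe] at hbd
  have hψm : AEStronglyMeasurable (𝓕⁻ (F : E → ℂ)) volume :=
    (continuous_fourierInv F.integrable).aestronglyMeasurable
  -- This is the equation tested with $\mathscr F^{-1}F'$, a real Schwartz function that need not
  -- have compact support.
  have hU1 : ∫ x, (U x : ℂ) * 𝓕⁻ (F : E → ℂ) x = ∫ y, (T y : ℂ) * 𝓕⁻ (F' : E → ℂ) y := by
    have h1 := HomSobolev.inner_schwartz_eq_integral hs hsd hT hU (𝓕⁻ F')
      (f := fun x => (𝓕⁻ (F' : E → ℂ) x).re) fun x => by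
        rw [SchwartzMap.fourierInv_coe, ofReal_re_fourierInv hF']
    rw [← SchwartzMap.fourier_coe, FourierTransform.fourier_fourierInv_eq] at h1
    rw [integral_ofReal_mul_re T (ofReal_re_fourierInv hF'), ← h1,
      integral_ofReal_mul_re _ (ofReal_re_fourierInv hF)]
    congr 1
    have h2 := congrArg Complex.re (HomSobolev.integral_mul_fourierInv_eq hs U hF hFF')
    have h3 : Integrable fun ξ => sobolevWeight s U.fourier ξ *
        (starRingEnd ℂ) (sobolevWeight s F' ξ) := by
      have hd0 : 0 < (d : ℝ) := by linarith
      have hd : 1 ≤ d := by exact_mod_cast hd0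
      have h4 : MemLp (sobolevWeight s F') 2 volume :=
        SchwartzMap.memLp_two_pi_norm_rpow_mul (r := s) (by simpa using hd) (by simp; linarith) F'
      exact U.memLp_sobolevWeight.integrable_mul h4.star
    rw [integral_ofReal_mul_re _ (ofReal_re_fourierInv hF), Complex.ofReal_re] at h2
    exact h2.trans (integral_re h3).symm
  -- Fubini moves the kernel onto $\mathscr F^{-1}F$, where it acts as the multiplier
  -- $(2\pi|\xi|)^{-2s}$ and produces $\mathscr F^{-1}F'$.
  have hR1 : ∫ x, (rieszPotential (2 * s) T x : ℂ) * 𝓕⁻ (F : E → ℂ) x =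
      ∫ y, (T y : ℂ) * 𝓕⁻ (F' : E → ℂ) y := by
    rw [integral_rieszPotential_mul hα hsd hc hca hcd hT hψm hbd]
    congr 1 with y
    congr 1
    simp only [rieszKernel_sub_comm _ y]
    have hK : Integrable fun x => (rieszKernel d (2 * s) (y - x) : ℂ) * 𝓕⁻ (F : E → ℂ) x := by
      simp only [← rieszKernel_sub_comm _ y]
      exact integrable_rieszKernel_mul_of_norm_le hα hsd (by linarith) hψm hbd y
    rw [integral_rieszKernel_mul_fourierInv hα hsd F.integrable
      (by simpa only [hF'F] using F'.integrable) hψm y hK]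
    simp only [hF'F]
  simp only [Complex.ofReal_sub, sub_mul]
  rw [integral_sub (integrable_mul_of_norm_le_weight hUa hψm hbd)
    (integrable_mul_of_norm_le_weight hRa hψm hbd), hU1, hR1, sub_self]

end WeakSolutions

/-! ### The fractional Laplacian of test functions -/

section DistributionalSolutions

open Filter Topology Module Set

variable {d : ℕ} {s : ℝ}

local notation "E" => EuclideanSpace ℝ (Fin d)

theorem SchwartzMap.integrable_two_pi_norm_rpow_mul {r : ℝ} (hr : 0 ≤ r) (φ : 𝓢(E, ℂ)) :
    Integrable fun ξ => (((2 * Real.pi * ‖ξ‖) ^ r : ℝ) : ℂ) * φ ξ := by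
  refine ((φ.integrable_norm_mul_one_add_norm_rpow r).const_mul ((2 * Real.pi) ^ r)).mono' ?_
    (Eventually.of_forall fun ξ => ?_)
  · exact ((Complex.measurable_ofReal.comp (measurable_two_pi_norm_rpow r)).mul
      φ.continuous.measurable).aestronglyMeasurable
  · rw [norm_mul, Complex.norm_real, Real.norm_of_nonneg (by positivity),
      Real.mul_rpow (by positivity) (norm_nonneg _)]
    have h1 : ‖ξ‖ ^ r ≤ (1 + ‖ξ‖) ^ r := Real.rpow_le_rpow (norm_nonneg _) (by linarith) hr
    calc (2 * Real.pi) ^ r * ‖ξ‖ ^ r * ‖φ ξ‖ ≤ (2 * Real.pi) ^ r * (1 + ‖ξ‖) ^ r * ‖φ ξ‖ := by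
          gcongr
      _ = _ := by ring

/-- The symbol $|\xi|^{2s}$ need not be smooth at the origin, so the Fourier identity for Schwartz
functions cannot be used directly. It is used with low frequencies removed, and the cutoff is then
let go on both sides by dominated convergence. -/
theorem HomSobolev.integral_mul_fracLaplacian (hs : 0 < s) (hsd : 2 * s < d) (U : HomSobolev d s)
    {φ : E → ℝ} (hφ : ContDiff ℝ ∞ φ) (hφc : HasCompactSupport φ) {u : HomSobolev d s}
    (hu : u.fourier =ᵐ[volume] 𝓕 (fun x => (φ x : ℂ))) :
    ∫ x, U x * fracLaplacian s φ x = inner ℝ U u := by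
  have hd0 : 0 < (d : ℝ) := by linarith
  have hd : 1 ≤ d := by exact_mod_cast hd0
  set f := toSchwartzComplex φ hφc hφ
  have hf : (f : E → ℂ) = fun x => (φ x : ℂ) := rfl
  set F : ℕ → 𝓢(E, ℂ) := fun k => (𝓕 f).realMul fun ξ =>
    (1 - freqCutoff ((2 : ℝ) ^ k • ξ)) * (2 * Real.pi * ‖ξ‖) ^ (2 * s) with hFdef
  set F' : ℕ → 𝓢(E, ℂ) := fun k => (𝓕 f).realMul fun ξ =>
    (1 - freqCutoff ((2 : ℝ) ^ k • ξ)) * (2 * Real.pi * ‖ξ‖) ^ (0 : ℝ) with hF'def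
  have hFapp : ∀ k ξ, F k ξ = (((1 - freqCutoff ((2 : ℝ) ^ k • ξ)) *
      (2 * Real.pi * ‖ξ‖) ^ (2 * s) : ℝ) : ℂ) * 𝓕 (f : E → ℂ) ξ := fun k ξ => by
    rw [hFdef, SchwartzMap.realMul_apply (hasTemperateGrowth_highFreq _ k),
      SchwartzMap.fourier_coe]
  have hF'app : ∀ k ξ, F' k ξ = ((1 - freqCutoff ((2 : ℝ) ^ k • ξ) : ℝ) : ℂ) *
      𝓕 (f : E → ℂ) ξ := fun k ξ => by
    rw [hF'def, SchwartzMap.realMul_apply (hasTemperateGrowth_highFreq _ k),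
      SchwartzMap.fourier_coe, Real.rpow_zero, mul_one]
  have hF : ∀ k ξ, F k (-ξ) = (starRingEnd ℂ) (F k ξ) := fun k =>
    realMul_fourier_hermitian (hasTemperateGrowth_highFreq _ k) (highFreq_neg _ k) fun x => rfl
  have hFF' : ∀ k ξ, F k ξ = (((2 * Real.pi * ‖ξ‖) ^ (2 * s) : ℝ) : ℂ) * F' k ξ := fun k ξ => by
    rw [hFapp, hF'app]
    push_cast
    ring
  set G : E → ℂ := fun ξ => (((2 * Real.pi * ‖ξ‖) ^ (2 * s) : ℝ) : ℂ) * 𝓕 (f : E → ℂ) ξ with hG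
  have hGi : Integrable G := SchwartzMap.integrable_two_pi_norm_rpow_mul (by linarith) (𝓕 f)
  have hGh : ∀ ξ, G (-ξ) = (starRingEnd ℂ) (G ξ) := fun ξ => by
    simp only [hG, hf, norm_neg, map_mul, Complex.conj_ofReal, conj_fourier_ofReal]
  have hcut : ∀ ξ : E, ξ ≠ 0 →
      Tendsto (fun k => ((1 - freqCutoff ((2 : ℝ) ^ k • ξ) : ℝ) : ℂ)) atTop (𝓝 1) := by
    intro ξ hξ
    have h1 := (tendsto_freqCutoff_pow_smul hξ).const_sub 1
    rw [sub_zero] at h1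
    have h2 := (Complex.continuous_ofReal.tendsto 1).comp h1
    rwa [Complex.ofReal_one] at h2
  have hFlim : ∀ x, Tendsto (fun k => 𝓕⁻ (F k : E → ℂ) x) atTop (𝓝 (𝓕⁻ G x)) := by
    refine tendsto_fourierInv_of_dominated (bound := fun ξ => ‖G ξ‖)
      (fun k => (F k).continuous.aestronglyMeasurable) hGi.norm
      (fun k => Eventually.of_forall fun ξ => ?_) ?_
    · rw [hFapp, Complex.ofReal_mul, mul_assoc, norm_mul]
      exact mul_le_of_le_one_left (norm_nonneg _) (norm_one_sub_freqCutoff_le _)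
    · filter_upwards [ae_ne_zero_euclideanSpace hd] with ξ hξ
      have h1 := (hcut ξ hξ).mul_const (G ξ)
      rw [one_mul] at h1
      refine h1.congr fun k => ?_
      rw [hFapp, Complex.ofReal_mul, mul_assoc]
  -- The lower bound makes $U$ integrable against $(1+|x|)^{-a}$. The upper bound gives $a<d+2s$, as
  -- required for the decay of the truncations uniformly in $k$.
  obtain ⟨a, hsa, had⟩ : ∃ a : ℝ, (d : ℝ) / 2 + s < a ∧ a < d := exists_between (by linarith)
  have hUa := U.integrable_mul_weight hs hsd hsa
  obtain ⟨C, hbd⟩ := exists_norm_fourierInv_highFreq_le f (b := 2 * s) (a := a) (by linarith)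
    (by rw [finrank_euclideanSpace_fin]; linarith)
  have hbd' : ∀ k x, ‖𝓕⁻ (F k : E → ℂ) x‖ ≤ C * (1 + ‖x‖) ^ (-a) := fun k x => by
    have e : (F k : E → ℂ) = fun ξ => (((1 - freqCutoff ((2 : ℝ) ^ k • ξ)) *
      (2 * Real.pi * ‖ξ‖) ^ (2 * s) : ℝ) : ℂ) * 𝓕 (f : E → ℂ) ξ := funext (hFapp k)
    rw [e]
    exact hbd k x
  have lim1 : Tendsto (fun k => ∫ x, (U x : ℂ) * 𝓕⁻ (F k : E → ℂ) x) atTop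
      (𝓝 (∫ x, (U x : ℂ) * 𝓕⁻ G x)) := by
    refine tendsto_integral_of_dominated_convergence
      (fun x => C * ‖U x * (1 + ‖x‖) ^ (-a)‖) (fun k => ?_) (hUa.norm.const_mul C)
      (fun k => Eventually.of_forall fun x => ?_)
      (Eventually.of_forall fun x => (hFlim x).const_mul _)
    · exact (Complex.continuous_ofReal.comp_aestronglyMeasurable
        (Lp.aestronglyMeasurable U.toLp)).mul
        (continuous_fourierInv (F k).integrable).aestronglyMeasurable
    · rw [norm_mul, Complex.norm_real, norm_mul,
        Real.norm_of_nonneg (r := (1 + ‖x‖) ^ (-a)) (by positivity)]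
      calc ‖U x‖ * ‖𝓕⁻ (F k : E → ℂ) x‖ ≤ ‖U x‖ * (C * (1 + ‖x‖) ^ (-a)) := by
            gcongr
            exact hbd' k x
        _ = _ := by ring
  have hw : MemLp (sobolevWeight s (𝓕 (f : E → ℂ))) 2 volume :=
    SchwartzMap.memLp_two_pi_norm_rpow_mul (r := s) (by simpa using hd) (by simp; linarith) (𝓕 f)
  have hwm : ∀ g : 𝓢(E, ℂ), AEStronglyMeasurable (sobolevWeight s g) volume := fun g =>
    ((Complex.measurable_ofReal.comp (measurable_two_pi_norm_rpow s)).mul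
      g.continuous.measurable).aestronglyMeasurable
  have hprod : Integrable fun ξ => sobolevWeight s U.fourier ξ *
      (starRingEnd ℂ) (sobolevWeight s (𝓕 (f : E → ℂ)) ξ) :=
    U.memLp_sobolevWeight.integrable_mul hw.star
  have hweq : ∀ k ξ, sobolevWeight s (F' k) ξ = ((1 - freqCutoff ((2 : ℝ) ^ k • ξ) : ℝ) : ℂ) *
      sobolevWeight s (𝓕 (f : E → ℂ)) ξ := fun k ξ => by
    rw [sobolevWeight, sobolevWeight, hF'app, mul_left_comm]
  have lim2 : Tendsto (fun k => ∫ ξ, sobolevWeight s U.fourier ξ *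
      (starRingEnd ℂ) (sobolevWeight s (F' k) ξ)) atTop
      (𝓝 (∫ ξ, sobolevWeight s U.fourier ξ *
        (starRingEnd ℂ) (sobolevWeight s (𝓕 (f : E → ℂ)) ξ))) := by
    refine tendsto_integral_of_dominated_convergence _ (fun k => ?_) hprod.norm
      (fun k => Eventually.of_forall fun ξ => ?_) ?_
    · exact U.memLp_sobolevWeight.1.mul
        (Complex.continuous_conj.comp_aestronglyMeasurable (hwm _))
    · rw [norm_mul, norm_mul, RCLike.norm_conj, RCLike.norm_conj, hweq,
        norm_mul _ (sobolevWeight _ _ _)]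
      gcongr
      exact mul_le_of_le_one_left (norm_nonneg _) (norm_one_sub_freqCutoff_le _)
    · filter_upwards [ae_ne_zero_euclideanSpace hd] with ξ hξ
      have h1 := (hcut ξ hξ).mul_const (sobolevWeight s (𝓕 (f : E → ℂ)) ξ)
      rw [one_mul] at h1
      simp only [hweq]
      exact ((Complex.continuous_conj.tendsto _).comp h1).const_mul _
  have hlim := tendsto_nhds_unique lim1 (lim2.congr fun k =>
    (HomSobolev.integral_mul_fourierInv_eq hs U (hF k) (hFF' k)).symm)
  rw [integral_ofReal_mul_re _ (ofReal_re_fourierInv hGh)] at hlim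
  have hre := congrArg Complex.re hlim
  rw [Complex.ofReal_re] at hre
  refine hre.trans ((integral_re hprod).symm.trans (integral_congr_ae ?_))
  filter_upwards [hu] with ξ hξ
  simp only [sobolevWeight, hξ, hf, RCLike.re_to_complex]

end DistributionalSolutions

/-! ### Weak and distributional solutions as Riesz potentials -/

theorem corollary5p5 (d : ℕ) (hd : 2 ≤ d) (s : ℝ) (hs : 0 < s) (hsd : s < (d : ℝ) / 2)
    (q : ℝ) (hq : 1 < q) (hqd : q < (d : ℝ) / (2 * s))
    (T : EuclideanSpace ℝ (Fin d) → ℝ) (hT : MemLp T (ENNReal.ofReal q) volume)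
    (τ : StrongDual ℝ (HomSobolev d s)) (hτ : IsRegularDistribution τ T) :
    (∀ᵐ x ∂(volume : Measure (EuclideanSpace ℝ (Fin d))),
      ConvolutionExistsAt (rieszKernel d (2 * s)) T x (ContinuousLinearMap.mul ℝ ℝ) volume) ∧
    (∃! U : HomSobolev d s, IsWeakSolution τ U) ∧
    (∀ U : HomSobolev d s, IsWeakSolution τ U → U =ᵐ[volume] rieszPotential (2 * s) T) ∧
    IsDistributionalSolution s T (rieszPotential (2 * s) T) ∧
    (∀ U : HomSobolev d s, IsDistributionalSolution s T U →
      U =ᵐ[volume] rieszPotential (2 * s) T) := by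
  have hsd' : 2 * s < d := by linarith
  have hα : 0 < 2 * s := by linarith
  have hq0 : 0 < q := by linarith
  have hdq : 2 * s < d / q := by
    rw [lt_div_iff₀ hα] at hqd
    rw [lt_div_iff₀ hq0]
    linarith
  have hdq' : (d : ℝ) / q ≤ d := div_le_self (by positivity) hq.le
  -- The lower bound is Hölder's condition for $T\in L^q$ to be integrable against $(1+|x|)^{-c}$;
  -- the upper bound leaves room for $a$ with $c+2s<a<d$. Such a $c$ exists because $q<d/(2s)$.
  obtain ⟨c, hqc, hcd⟩ : ∃ c : ℝ, d - d / q < c ∧ c < d - 2 * s := exists_between (by linarith)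
  have hc : 0 ≤ c := by linarith
  -- The two lower bounds put $U$ and $I_{2s}*T$ respectively in the weighted $L^1$ space; $d/2+s$
  -- is $d$ divided by the exponent conjugate to $2d/(d-2s)$.
  obtain ⟨a, ha, had⟩ : ∃ a : ℝ, max ((d : ℝ) / 2 + s) (c + 2 * s) < a ∧ a < d :=
    exists_between (max_lt (by linarith) (by linarith))
  have hsa := (le_max_left _ _).trans_lt ha
  have hca : c < a - 2 * s := by linarith [(le_max_right _ _).trans_lt ha]
  have hTc : Integrable fun x => T x * (1 + ‖x‖) ^ (-c) := by
    refine hT.integrable_mul_one_add_norm_rpow_neg hq ?_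
    rw [finrank_euclideanSpace_fin, mul_sub, mul_one, mul_one_div]
    exact hqc
  have hweak : ∀ U : HomSobolev d s, IsWeakSolution τ U →
      U =ᵐ[volume] rieszPotential (2 * s) T := fun U hU =>
    HomSobolev.ae_eq_rieszPotential hs hsd' hc hca had hsa hTc fun φ ψ hφ hφc hψ =>
      (hU ψ).symm.trans (hτ φ ψ hφ hφc hψ)
  have hex := existsUnique_isWeakSolution hs hsd' τ
  have hRa := integrable_rieszPotential_mul_weight hα hsd' hc hca hcd.le hTc
  refine ⟨ae_convolutionExistsAt_rieszKernel hα hsd' hc hca hcd.le hTc, hex, hweak, ?_, ?_⟩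
  -- The equation is checked for the weak solution $U$ and transferred to the potential, with which
  -- it agrees almost everywhere.
  · obtain ⟨U, hU, -⟩ := hex
    refine ⟨locallyIntegrable_of_integrable_mul_weight hRa, ?_, fun φ hφ hφc => ?_⟩
    · refine (integrable_mul_weight_of_le (b := (d : ℝ) + 2 * s) (by linarith) hRa).norm.congr
        (Filter.Eventually.of_forall fun x => ?_)
      beta_reduce
      rw [norm_mul, Real.norm_eq_abs, Real.norm_of_nonneg (by positivity),
        Real.rpow_neg (by positivity), div_eq_mul_inv]
    · obtain ⟨u, hu, hu'⟩ := HomSobolev.exists_of_schwartz hs hsd' (toSchwartzComplex φ hφc hφ)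
        (f := φ) fun x => rfl
      rw [← hτ φ u hφ hφc hu, hU u, ← U.integral_mul_fracLaplacian hs hsd' hφ hφc hu']
      refine integral_congr_ae ?_
      filter_upwards [hweak U hU] with x hx
      rw [hx]
  · intro U hU
    refine HomSobolev.ae_eq_rieszPotential hs hsd' hc hca had hsa hTc fun φ ψ hφ hφc hψ => ?_
    obtain ⟨u, hu, hu'⟩ := HomSobolev.exists_of_schwartz hs hsd' (toSchwartzComplex φ hφc hφ)
      (f := φ) fun x => rfl
    -- An element is determined by its function, so the transform of $\psi$ is the classical
    -- transform of $\varphi$, and the pairing with $(-\Delta)^s\varphi$ becomes the inner product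
    -- with $\psi$.
    obtain rfl : ψ = u := HomSobolev.ext_ae (hψ.trans hu.symm)
    rw [← U.integral_mul_fracLaplacian hs hsd' hφ hφc hu', hU.integral_eq φ hφ hφc]
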